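/- All graphs are finite, simple and undirected. A path in an edge-colored graph (adjacent edges may receive the same color) is a rainbow path if its edges have pairwise distinct colors. For a connected graph $G$, the rainbow connection number $rc(G)$ is the least number of colors in an edge-coloring of $G$ such that every two vertices are joined by a rainbow path. A block of $G$ is a maximal connected subgraph without a cut vertex of its own; it is even if its number of vertices is even, and odd otherwise. **Theorem.** Let $G$ be a connected graph of order $n\ge 3$ with exactly $q\ge 2$ blocks, exactly $r$ of which are even. Then $$rc(G)\le \frac{n+r-1}{2}.$$ The bound is tight: for all integers $n\ge 3$, $q\ge 2$ and $r\ge 0$ for which there exists a connected graph of order $n$ with exactly $q$ blocks, exactly $r$ of them even, there is such a graph $H$ with $$\operatorname{diam}(H)=rc(H)=\frac{n+r-1}{2}.$$ Moreover, if $r<q$, then $H$ can be chosen so that its blocks are exactly $r$ copies of $K_2$, $q-r-1$ triangles, and one odd cycle of order $n-2q+r+2\ge 3$. -/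

import Mathlib

namespace RainbowBlocks

/-- A path is a rainbow path under the edge-coloring `c` (adjacent edges may share a color) if its
edges have pairwise distinct colors. -/
def IsRainbowPath {V K : Type*} {G : SimpleGraph V} (c : G.EdgeLabeling K) {u v : V}
    (p : G.Walk u v) : Prop :=
  p.IsPath ∧ ∀ e f : G.edgeSet, (e : Sym2 V) ∈ p.edges → (f : Sym2 V) ∈ p.edges →
    c e = c f → e = f

/-- The edge-coloring `c` makes `G` rainbow connected: every two vertices are joined by a
rainbow path. -/
def IsRainbowColoring {V K : Type*} {G : SimpleGraph V} (c : G.EdgeLabeling K) : Prop :=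
  ∀ u v : V, ∃ p : G.Walk u v, IsRainbowPath c p

/-- The rainbow connection number `rc(G)`: the least number of colors in an edge-coloring that
makes `G` rainbow connected (meaningful for finite connected `G`). -/
noncomputable def rc {V : Type*} (G : SimpleGraph V) : ℕ :=
  sInf {k : ℕ | ∃ c : G.EdgeLabeling (Fin k), IsRainbowColoring c}

/-- For a finite connected graph the minimum defining `rc` is over a nonempty set, so it is
attained. -/
theorem rc_spec {V : Type*} [Finite V] (G : SimpleGraph V) (hG : G.Connected) :
    ∃ c : G.EdgeLabeling (Fin (rc G)), IsRainbowColoring c := by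
  refine Nat.sInf_mem (s := {k : ℕ | ∃ c : G.EdgeLabeling (Fin k), IsRainbowColoring c}) ?_
  refine ⟨Nat.card G.edgeSet, fun e => Finite.equivFin G.edgeSet e, fun u v => ?_⟩
  obtain ⟨p, hp⟩ := (hG.preconnected u v).exists_isPath
  exact ⟨p, hp, fun e f _ _ h => (Finite.equivFin G.edgeSet).injective h⟩

/-- `v` is a cut vertex of `H`: deleting `v` increases the number of components, that is, it
disconnects two vertices that were joined in `H`. -/
def IsCutVertex {V : Type*} (H : SimpleGraph V) (v : V) : Prop :=
  ∃ u w : ({v}ᶜ : Set V), H.Reachable u w ∧ ¬ (H.induce ({v}ᶜ : Set V)).Reachable u w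

/-- A block of `G`: a maximal connected subgraph that has no cut vertex (of its own). -/
def IsBlock {V : Type*} {G : SimpleGraph V} (B : G.Subgraph) : Prop :=
  Maximal (fun H : G.Subgraph => H.Connected ∧ ∀ v : H.verts, ¬ IsCutVertex H.coe v) B

/-- The number of blocks of `G`. -/
noncomputable def numBlocks {V : Type*} (G : SimpleGraph V) : ℕ :=
  {B : G.Subgraph | IsBlock B}.ncard

/-- The number of even blocks of `G`, i.e. blocks whose order is even. -/
noncomputable def numEvenBlocks {V : Type*} (G : SimpleGraph V) : ℕ :=
  {B : G.Subgraph | IsBlock B ∧ Even B.verts.ncard}.ncard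

/-- The blocks of `G` are exactly one cycle of order `m`, `a` copies of `K₂` and `b` further
blocks that are triangles. -/
def HasCycleBlockDecomposition {V : Type*} (G : SimpleGraph V) (m a b : ℕ) : Prop :=
  ∃ C : G.Subgraph, IsBlock C ∧ Nonempty (C.coe ≃g SimpleGraph.cycleGraph m) ∧
    {B : G.Subgraph | IsBlock B ∧ B ≠ C ∧
      Nonempty (B.coe ≃g SimpleGraph.completeGraph (Fin 2))}.ncard = a ∧
    {B : G.Subgraph | IsBlock B ∧ B ≠ C ∧
      Nonempty (B.coe ≃g SimpleGraph.cycleGraph 3)}.ncard = b ∧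
    ∀ B : G.Subgraph, IsBlock B → B ≠ C →
      Nonempty (B.coe ≃g SimpleGraph.completeGraph (Fin 2)) ∨
        Nonempty (B.coe ≃g SimpleGraph.cycleGraph 3)

end RainbowBlocks

open RainbowBlocks

/-!
Colours are natural numbers, and colour `0` plays a special role. The heart of the matter is a
rooted statement (`Biconnected.exists_valid`): a vertex set `T` inducing a connected subgraph
without cut vertices has a colouring with the colours `0, …, ⌊|T| / 2⌋` in which any two vertices
are joined by a rainbow walk, and a prescribed root `v` is joined to every vertex by a rainbow walk
avoiding colour `0`. These colourings are glued at cut vertices (`ConnectedOn.exists_valid`): the two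
sides of a split share colour `0` only, and the side without the root is rooted at the cut vertex,
so a walk between the sides never meets colour `0` twice. A connected set `S` with `r` even blocks
thus gets a rooted colouring with the colours `0, …, (|S| + r - 1) / 2`. If there are at least two
blocks, both sides of one split are rooted at its cut vertex; walks between the sides then avoid
colour `0` altogether, and on each side colour `0` can be replaced by a colour of the other side
(`IsSplit.exists_coloring`). This saves one colour and gives `rc G ≤ (n + r - 1) / 2`.

The rooted statement is proved by growing a set `S` from `{v}` by ears with at least two internal
vertices. The two arms of an ear use the same new colours `k + 1, …, k + t` in opposite senses, seen
from the middle (`ColoredArms`), so that from each internal vertex the two ways back to `S` use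
disjoint sets of new colours. An ear with `2t` internal vertices has colour `0` on its middle edge. On
an ear with `2t + 1` internal vertices the middle vertex needs two further colours, and the number
of colours stays within half the order only if they are chosen with care. Therefore two invariants
are carried along, in which the colouring may depend on vertices prescribed in advance:
`OddState`, for sets of order `2k + 1`, asks for a link that spares one of the colours between two
prescribed pairs; `EvenState`, for sets of order `2k`, asks in addition that a further vertex
adjacent to two prescribed vertices can be attached with old colours. The four combinations
of an invariant and a parity of the ear are `OddState.addEar_even`, `EvenState.addEar_even`,
`OddState.addEar_odd` and `EvenState.addEar_odd`. When no ear is left, the vertices outside `S` are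
independent with at least two neighbours in `S` each, and they are attached directly
(`OddState.attach`, `EvenState.attach`): two new colours suffice for any number of them, and the
invariants handle the few cases in which that would be one colour too many.

For tightness, splitting at cut vertices shows `r ≤ q`, `2q + 1 ≤ n + r` and that `n + r` is odd
(`card_numBlocks`), which leaves room for a chain of edges and triangles followed by a cycle
(`blockChain`). A potential function bounds its diameter from below by `(n + r - 1) / 2`, the diameter
is at most the rainbow connection number, and the upper bound closes the circle.
-/

namespace RainbowBlocks

variable {V : Type*} {G : SimpleGraph V}

/-! ### Rainbow links -/

/-- Some walk of `G` inside the vertex set `S` joins `u` to `w`, its edges have pairwise distinct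
colours under `c`, and all these colours satisfy `X`. Colours are natural numbers, `c` is defined
on all unordered pairs, and a walk is enough: shortcutting it to a path keeps colours distinct. -/
def RainbowLink (G : SimpleGraph V) (c : Sym2 V → ℕ) (S : Set V) (u w : V) (X : ℕ → Prop) : Prop :=
  ∃ p : G.Walk u w, (∀ x ∈ p.support, x ∈ S) ∧ (p.edges.map c).Nodup ∧ ∀ e ∈ p.edges, X (c e)

namespace RainbowLink

variable {c c' : Sym2 V → ℕ} {S S' : Set V} {u w y : V} {X Y Z : ℕ → Prop}

theorem refl (hu : u ∈ S) : RainbowLink G c S u u X :=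
  ⟨.nil, by simpa using hu, by simp, by simp⟩

theorem of_adj (h : G.Adj u w) (hu : u ∈ S) (hw : w ∈ S) (hX : X (c s(u, w))) :
    RainbowLink G c S u w X :=
  ⟨h.toWalk, by simp [hu, hw], by simp, by simpa using hX⟩

theorem symm (h : RainbowLink G c S u w X) : RainbowLink G c S w u X := by
  obtain ⟨p, h1, h2, h3⟩ := h
  refine ⟨p.reverse, by simpa using h1, ?_, by simpa using h3⟩
  rw [SimpleGraph.Walk.edges_reverse, List.map_reverse]
  exact List.nodup_reverse.2 h2

theorem left_mem (h : RainbowLink G c S u w X) : u ∈ S := by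
  obtain ⟨p, h1, -⟩ := h
  exact h1 _ p.start_mem_support

theorem mono (h : RainbowLink G c S u w X) (hX : ∀ n, X n → Y n) : RainbowLink G c S u w Y := by
  obtain ⟨p, h1, h2, h3⟩ := h
  exact ⟨p, h1, h2, fun e he => hX _ (h3 e he)⟩

/-- Links survive enlarging the vertex set and recolouring edges outside the old one. -/
theorem congr (h : RainbowLink G c S u w X) (hS : S ⊆ S')
    (hc : ∀ x ∈ S, ∀ y ∈ S, G.Adj x y → c' s(x, y) = c s(x, y)) : RainbowLink G c' S' u w X := by
  obtain ⟨p, h1, h2, h3⟩ := h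
  have key : ∀ e ∈ p.edges, c' e = c e := by
    intro e he
    induction e using Sym2.ind with
    | _ a b =>
      exact hc a (h1 a (p.fst_mem_support_of_mem_edges he)) b
        (h1 b (p.snd_mem_support_of_mem_edges he)) (p.adj_of_mem_edges he)
  refine ⟨p, fun x hx => hS (h1 x hx), ?_, fun e he => key e he ▸ h3 e he⟩
  rwa [List.map_congr_left key]

theorem trans (h₁ : RainbowLink G c S u w X) (h₂ : RainbowLink G c S w y Y)
    (hd : ∀ n, X n → Y n → False) (hX : ∀ n, X n → Z n) (hY : ∀ n, Y n → Z n) :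
    RainbowLink G c S u y Z := by
  obtain ⟨p, h1, h2, h3⟩ := h₁
  obtain ⟨q, k1, k2, k3⟩ := h₂
  refine ⟨p.append q, ?_, ?_, ?_⟩
  · intro x hx
    rcases (SimpleGraph.Walk.mem_support_append_iff _ _).1 hx with hx | hx
    exacts [h1 x hx, k1 x hx]
  · rw [SimpleGraph.Walk.edges_append, List.map_append]
    refine List.nodup_append.2 ⟨h2, k2, ?_⟩
    intro a ha b hb hab
    obtain ⟨e, he, rfl⟩ := List.mem_map.1 ha
    obtain ⟨f, hf, rfl⟩ := List.mem_map.1 hb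
    exact hd _ (h3 e he) (hab ▸ k3 f hf)
  · intro e he
    rw [SimpleGraph.Walk.edges_append, List.mem_append] at he
    rcases he with he | he
    exacts [hX _ (h3 e he), hY _ (k3 e he)]

/-- Renaming colours by a map that is injective on the colours of the link. -/
theorem recolor (h : RainbowLink G c S u w X) (φ : ℕ → ℕ)
    (hφ : ∀ m n, X m → X n → φ m = φ n → m = n) (hX : ∀ n, X n → Y (φ n)) :
    RainbowLink G (fun e => φ (c e)) S u w Y := by
  obtain ⟨p, h1, h2, h3⟩ := h
  refine ⟨p, h1, ?_, fun e he => hX _ (h3 e he)⟩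
  have : p.edges.map (fun e => φ (c e)) = (p.edges.map c).map φ := by simp
  rw [this]
  refine List.Nodup.map_on ?_ h2
  intro a ha b hb hab
  obtain ⟨e, he, rfl⟩ := List.mem_map.1 ha
  obtain ⟨f, hf, rfl⟩ := List.mem_map.1 hb
  exact hφ _ _ (h3 e he) (h3 f hf) hab

/-- A stretch of a sequence of consecutively adjacent vertices whose colours are distinct. -/
theorem of_sequence {p : ℕ → V} {γ : ℕ → ℕ} {i j : ℕ} (hij : i ≤ j)
    (hS : ∀ l, i ≤ l → l ≤ j → p l ∈ S)
    (hadj : ∀ l, i ≤ l → l < j → G.Adj (p l) (p (l + 1)))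
    (hc : ∀ l, i ≤ l → l < j → c s(p l, p (l + 1)) = γ l)
    (hγ : ∀ l l', i ≤ l → l < l' → l' < j → γ l ≠ γ l') :
    RainbowLink G c S (p i) (p j) (fun n => ∃ l, i ≤ l ∧ l < j ∧ n = γ l) := by
  induction j, hij using Nat.le_induction with
  | base => exact refl (hS i le_rfl le_rfl)
  | succ j hij ih =>
    have h1 := ih (fun l h h' => hS l h (by omega)) (fun l h h' => hadj l h (by omega))
      (fun l h h' => hc l h (by omega)) (fun l l' h h' h'' => hγ l l' h h' (by omega))
    have h2 : RainbowLink G c S (p j) (p (j + 1)) (fun n => n = γ j) :=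
      of_adj (hadj j hij (by omega)) (hS _ hij (by omega)) (hS _ (by omega) le_rfl)
        (hc j hij (by omega))
    refine h1.trans h2 ?_ ?_ ?_
    · rintro n ⟨l, hl, hl', rfl⟩ h
      exact hγ l j hl hl' (by omega) h
    · rintro n ⟨l, hl, hl', rfl⟩
      exact ⟨l, hl, by omega, rfl⟩
    · rintro n rfl
      exact ⟨j, hij, by omega, rfl⟩

end RainbowLink

/-! ### Ears -/

/-- `p 0, p 1, …, p (m + 1)` is an ear of `S` inside `T` with `m ≥ 2` internal vertices
`p 1, …, p m`. The ends `p 0, p (m + 1) ∈ S` differ, except that the ear of a single vertex is a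
cycle through it. -/
structure IsEar (G : SimpleGraph V) (S T : Set V) (p : ℕ → V) (m : ℕ) : Prop where
  two_le : 2 ≤ m
  left_mem : p 0 ∈ S
  right_mem : p (m + 1) ∈ S
  mem : ∀ i, 1 ≤ i → i ≤ m → p i ∈ T
  notMem : ∀ i, 1 ≤ i → i ≤ m → p i ∉ S
  inj : ∀ i j, 1 ≤ i → i ≤ m → 1 ≤ j → j ≤ m → p i = p j → i = j
  adj : ∀ i, i ≤ m → G.Adj (p i) (p (i + 1))
  ends : p 0 = p (m + 1) → ∀ x ∈ S, x = p 0

namespace IsEar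

variable {S T : Set V} {p : ℕ → V} {m : ℕ}

theorem reverse (h : IsEar G S T p m) : IsEar G S T (fun i => p (m + 1 - i)) m where
  two_le := h.two_le
  left_mem := h.right_mem
  right_mem := by simpa using h.left_mem
  mem i h1 h2 := h.mem _ (by omega) (by omega)
  notMem i h1 h2 := h.notMem _ (by omega) (by omega)
  inj i j h1 h2 h3 h4 e := by
    have := h.inj _ _ (by omega) (by omega) (by omega) (by omega) e
    omega
  adj i hi := by
    have := (h.adj (m - i) (by omega)).symm
    rwa [show m - i + 1 = m + 1 - i by omega, show m - i = m + 1 - (i + 1) by omega] at this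
  ends e x hx := by
    simp only [Nat.sub_zero, Nat.sub_self] at e
    simpa [e] using h.ends e.symm x hx

/-- An ear can be coloured arbitrarily without changing the colours inside `S`. -/
theorem exists_coloring (h : IsEar G S T p m) (c : Sym2 V → ℕ) (γ : ℕ → ℕ) :
    ∃ c' : Sym2 V → ℕ, (∀ x ∈ S, ∀ y ∈ S, c' s(x, y) = c s(x, y)) ∧
      ∀ i, i ≤ m → c' s(p i, p (i + 1)) = γ i := by
  classical
  have h2 := h.two_le
  have hinj : ∀ i j, i ≤ m + 1 → j ≤ m + 1 → p i = p j →
      i = j ∨ (i = 0 ∨ i = m + 1) ∧ (j = 0 ∨ j = m + 1) := by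
    have hS : ∀ i, i ≤ m + 1 → p i ∈ S → i = 0 ∨ i = m + 1 := fun i hi hp => by
      by_contra hc
      exact h.notMem i (by omega) (by omega) hp
    have hS' : ∀ i, i = 0 ∨ i = m + 1 → p i ∈ S := by
      rintro i (rfl | rfl)
      exacts [h.left_mem, h.right_mem]
    intro i j hi hj e
    by_cases hi' : i = 0 ∨ i = m + 1
    · exact Or.inr ⟨hi', hS j hj (e ▸ hS' i hi')⟩
    · by_cases hj' : j = 0 ∨ j = m + 1
      · exact absurd (hS i hi (e ▸ hS' j hj')) hi'
      · exact Or.inl (h.inj i j (by omega) (by omega) (by omega) (by omega) e)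
  refine ⟨fun e => if he : ∃ i, i ≤ m ∧ e = s(p i, p (i + 1)) then γ he.choose else c e, ?_, ?_⟩
  · intro x hx y hy
    beta_reduce
    rw [dif_neg]
    rintro ⟨i, hi, e⟩
    have hm : p i ∈ S ∧ p (i + 1) ∈ S := by
      rcases Sym2.eq_iff.1 e with ⟨rfl, rfl⟩ | ⟨rfl, rfl⟩
      exacts [⟨hx, hy⟩, ⟨hy, hx⟩]
    rcases Nat.eq_zero_or_pos i with rfl | h0
    · exact h.notMem 1 le_rfl (by omega) hm.2
    · exact h.notMem i h0 hi hm.1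
  · intro i hi
    have he : ∃ j, j ≤ m ∧ s(p i, p (i + 1)) = s(p j, p (j + 1)) := ⟨i, hi, rfl⟩
    beta_reduce
    rw [dif_pos he]
    obtain ⟨hj, e⟩ := he.choose_spec
    congr 1
    generalize he.choose = j at hj e
    rcases Sym2.eq_iff.1 e with ⟨e1, e2⟩ | ⟨e1, e2⟩
    · have := hinj _ _ (by omega) (by omega) e1
      have := hinj _ _ (by omega) (by omega) e2
      omega
    · have := hinj _ _ (by omega) (by omega) e1
      have := hinj _ _ (by omega) (by omega) e2
      omega

end IsEar

/-! ### Coloured ears -/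

/-- The vertices of `S` together with the internal vertices of the ear `p`. -/
def addEar (S : Set V) (p : ℕ → V) (m : ℕ) : Set V :=
  {x | x ∈ S ∨ ∃ i, 1 ≤ i ∧ i ≤ m ∧ x = p i}

/-- Two arms of an ear attached to `S`, both using the `t` new colours `k + 1, …, k + t`: the arm
`P 0, …, P t` leaves `P 0 ∈ S` with colours `k + 1, …, k + t` in this order, and the arm
`Q 1, …, Q (t + 1)` arrives at `Q (t + 1) ∈ S` with colours `k + 1, …, k + t` in this order.
Colours inside `S` are those of `c`; the connection between `P t` and `Q 1` is not recorded. -/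
structure ColoredArms (G : SimpleGraph V) (S S' : Set V) (c c' : Sym2 V → ℕ) (P Q : ℕ → V)
    (k t : ℕ) : Prop where
  old : ∀ u w X, RainbowLink G c S u w X → RainbowLink G c' S' u w X
  left_mem : P 0 ∈ S
  right_mem : Q (t + 1) ∈ S
  left : ∀ i j, i ≤ j → j ≤ t →
    RainbowLink G c' S' (P i) (P j) (fun n => k + i < n ∧ n ≤ k + j)
  right : ∀ i j, 1 ≤ i → i ≤ j → j ≤ t + 1 →
    RainbowLink G c' S' (Q i) (Q j) (fun n => k + i ≤ n ∧ n < k + j)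

namespace ColoredArms

variable {S S' : Set V} {c c' : Sym2 V → ℕ} {P Q : ℕ → V} {k t i j : ℕ} {X M Z : ℕ → Prop} {u : V}

theorem left_old (E : ColoredArms G S S' c c' P Q k t) (hi : i ≤ t)
    (h : RainbowLink G c S (P 0) u X) (hX : ∀ n, X n → n ≤ k) (hZ : ∀ n, X n → Z n)
    (hZ' : ∀ n, k < n → n ≤ k + i → Z n) : RainbowLink G c' S' (P i) u Z := by
  refine (E.left 0 i (by omega) hi).symm.trans (E.old _ _ _ h) ?_ ?_ hZ
  · intro n h1 h2
    have := hX n h2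
    omega
  · intro n h1
    exact hZ' n (by omega) (by omega)

theorem right_old (E : ColoredArms G S S' c c' P Q k t) (hj : 1 ≤ j) (hj' : j ≤ t + 1)
    (h : RainbowLink G c S (Q (t + 1)) u X) (hX : ∀ n, X n → n ≤ k) (hZ : ∀ n, X n → Z n)
    (hZ' : ∀ n, k + j ≤ n → n ≤ k + t → Z n) : RainbowLink G c' S' (Q j) u Z := by
  refine (E.right j (t + 1) hj hj' le_rfl).trans (E.old _ _ _ h) ?_ ?_ hZ
  · intro n h1 h2
    have := hX n h2
    omega
  · intro n h1
    exact hZ' n (by omega) (by omega)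

/-- Through the middle of the ear: the colours do not repeat as long as `j ≤ i + 1`. -/
theorem across (E : ColoredArms G S S' c c' P Q k t) (hi : i ≤ t) (hj : 1 ≤ j) (hij : j ≤ i + 1)
    (h : RainbowLink G c' S' (P t) (Q 1) M) (hM : ∀ n, M n → n ≤ k) (hZ : ∀ n, M n → Z n)
    (hZ1 : ∀ n, k + i < n → n ≤ k + t → Z n) (hZ2 : ∀ n, k + 1 ≤ n → n < k + j → Z n) :
    RainbowLink G c' S' (P i) (Q j) Z := by
  have h1 : RainbowLink G c' S' (P i) (Q 1) (fun n => M n ∨ k + i < n ∧ n ≤ k + t) := by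
    refine (E.left i t hi le_rfl).trans h ?_ ?_ ?_
    · intro n h1 h2
      have := hM n h2
      omega
    · exact fun n h => Or.inr h
    · exact fun n h => Or.inl h
  refine h1.trans (E.right 1 j le_rfl hj (by omega)) ?_ ?_ ?_
  · rintro n (h1 | h1) h2
    · have := hM n h1
      omega
    · omega
  · rintro n (h1 | h1)
    exacts [hZ n h1, hZ1 n h1.1 h1.2]
  · intro n h1
    exact hZ2 n h1.1 h1.2

/-- Through `S`: the colours do not repeat as long as `i < j`. -/
theorem around (E : ColoredArms G S S' c c' P Q k t) (hij : i < j) (hj : j ≤ t + 1)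
    (h : RainbowLink G c S (P 0) (Q (t + 1)) X) (hX : ∀ n, X n → n ≤ k) (hZ : ∀ n, X n → Z n)
    (hZ1 : ∀ n, k < n → n ≤ k + i → Z n) (hZ2 : ∀ n, k + j ≤ n → n ≤ k + t → Z n) :
    RainbowLink G c' S' (P i) (Q j) Z := by
  have h1 : RainbowLink G c' S' (P i) (Q (t + 1)) (fun n => X n ∨ k < n ∧ n ≤ k + i) :=
    E.left_old (by omega) h hX (fun n h => Or.inl h) (fun n h h' => Or.inr ⟨h, h'⟩)
  refine h1.trans (E.right j (t + 1) (by omega) hj le_rfl).symm ?_ ?_ ?_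
  · rintro n (h1 | h1) h2
    · have := hX n h1
      omega
    · omega
  · rintro n (h1 | h1)
    exacts [hZ n h1, hZ1 n h1.1 h1.2]
  · intro n h1
    exact hZ2 n h1.1 (by omega)

theorem left_left (E : ColoredArms G S S' c c' P Q k t) (hi : i ≤ t) (hj : j ≤ t) :
    RainbowLink G c' S' (P i) (P j)
      (fun n => k + i < n ∧ n ≤ k + j ∨ k + j < n ∧ n ≤ k + i) := by
  rcases le_total i j with h | h
  · exact (E.left i j h hj).mono fun n h => by omega
  · exact (E.left j i h hi).symm.mono fun n h => by omega

theorem right_right (E : ColoredArms G S S' c c' P Q k t) (hi : 1 ≤ i) (hj : 1 ≤ j)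
    (hi' : i ≤ t + 1) (hj' : j ≤ t + 1) :
    RainbowLink G c' S' (Q i) (Q j)
      (fun n => k + i ≤ n ∧ n < k + j ∨ k + j ≤ n ∧ n < k + i) := by
  rcases le_total i j with h | h
  · exact (E.right i j hi h hj').mono fun n h => by omega
  · exact (E.right j i hj h hi').symm.mono fun n h => by omega

end ColoredArms

namespace IsEar

variable {S T : Set V} {p : ℕ → V} {m t : ℕ}

theorem mem_addEar (h : IsEar G S T p m) {i : ℕ} (hi : i ≤ m + 1) : p i ∈ addEar S p m := by
  rcases Nat.eq_zero_or_pos i with rfl | h0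
  · exact Or.inl h.left_mem
  · rcases Nat.lt_or_ge m i with h1 | h1
    · obtain rfl : i = m + 1 := by omega
      exact Or.inl h.right_mem
    · exact Or.inr ⟨i, h0, h1, rfl⟩

/-- Arms of length `t` on an ear whose middle part consists of the `d` edges from `p t` to
`p (t + d)`, coloured by `μ`. -/
theorem exists_arms {d : ℕ} (h : IsEar G S T p m) (hm : m + 1 = 2 * t + d) (hd : 1 ≤ d)
    (c : Sym2 V → ℕ) (k : ℕ) (μ : ℕ → ℕ) :
    ∃ c' : Sym2 V → ℕ,
      ColoredArms G S (addEar S p m) c c' p (fun j => p (t + (d - 1) + j)) k t ∧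
      ∀ i, i < d → RainbowLink G c' (addEar S p m) (p (t + i)) (p (t + i + 1)) (fun n => n = μ i) := by
  obtain ⟨c', h1, h2⟩ := h.exists_coloring c
    (fun i => if i < t then k + 1 + i else if i < t + d then μ (i - t) else k + 1 + (i - (t + d)))
  refine ⟨c', ⟨?_, h.left_mem, ?_, ?_, ?_⟩, ?_⟩
  · intro u w X hX
    exact hX.congr (fun x hx => Or.inl hx) fun x hx y hy _ => h1 x hx y hy
  · have := h.right_mem
    rwa [show m + 1 = t + (d - 1) + (t + 1) by omega] at this
  · intro i j hij hj
    refine (RainbowLink.of_sequence (γ := fun i => k + 1 + i) hij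
      (fun l _ _ => h.mem_addEar (by omega)) (fun l _ _ => h.adj l (by omega)) ?_ ?_).mono ?_
    · intro l hl hl'
      rw [h2 l (by omega), if_pos (by omega)]
    · intro l l' _ _ _
      omega
    · rintro n ⟨l, hl, hl', rfl⟩
      omega
  · intro i j hi hij hj
    refine (RainbowLink.of_sequence (γ := fun i => k + 1 + (i - (t + d)))
      (i := t + (d - 1) + i) (j := t + (d - 1) + j) (by omega)
      (fun l _ _ => h.mem_addEar (by omega)) (fun l _ _ => h.adj l (by omega)) ?_ ?_).mono ?_
    · intro l hl hl'
      rw [h2 l (by omega), if_neg (by omega), if_neg (by omega)]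
    · intro l l' _ _ _
      omega
    · rintro n ⟨l, hl, hl', rfl⟩
      omega
  · intro i hi
    refine RainbowLink.of_adj (h.adj _ (by omega)) (h.mem_addEar (by omega))
      (h.mem_addEar (by omega)) ?_
    rw [h2 _ (by omega), if_neg (by omega), if_pos (by omega)]
    congr 1
    omega

end IsEar

/-! ### Colouring states -/

/-- The colours `0, …, k` make the vertices of `S` pairwise linked, and the root `v` is linked to
every vertex of `S` without colour `0`. -/
structure Valid (G : SimpleGraph V) (c : Sym2 V → ℕ) (S : Set V) (v : V) (k : ℕ) : Prop where
  mem : v ∈ S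
  root : ∀ u ∈ S, RainbowLink G c S v u (fun n => 0 < n ∧ n ≤ k)
  all : ∀ u ∈ S, ∀ w ∈ S, RainbowLink G c S u w (fun n => n ≤ k)

/-- `u` and `w` are linked with one of the colours `0, …, k` to spare. -/
def SpareLink (G : SimpleGraph V) (c : Sym2 V → ℕ) (S : Set V) (k : ℕ) (u w : V) : Prop :=
  ∃ y, y ≤ k ∧ RainbowLink G c S u w (fun n => n ≤ k ∧ n ≠ y)

theorem SpareLink.symm {c : Sym2 V → ℕ} {S : Set V} {k : ℕ} {u w : V}
    (h : SpareLink G c S k u w) : SpareLink G c S k w u := by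
  obtain ⟨y, hy, h⟩ := h
  exact ⟨y, hy, h.symm⟩

/-- One of `a, b` has a link with a spare colour to one of `c₁, c₂`. -/
def SpareAmong (G : SimpleGraph V) (c : Sym2 V → ℕ) (S : Set V) (k : ℕ) (a b c₁ c₂ : V) : Prop :=
  SpareLink G c S k a c₁ ∨ SpareLink G c S k a c₂ ∨ SpareLink G c S k b c₁ ∨ SpareLink G c S k b c₂

/-- Two different colours `f, g` such that a further vertex adjacent to `e` and `e'` may be attached
with the colours `f` and `g` on these two edges: every vertex of `S` is linked to `e` without `f` or
to `e'` without `g`, and the root achieves this with colour `0` left out altogether. -/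
def Attachable (G : SimpleGraph V) (c : Sym2 V → ℕ) (S : Set V) (v : V) (k : ℕ) (e e' : V) : Prop :=
  ∃ f g, f ≤ k ∧ g ≤ k ∧ f ≠ g ∧
    (∀ u ∈ S, RainbowLink G c S u e (fun n => n ≤ k ∧ n ≠ f) ∨
      RainbowLink G c S u e' (fun n => n ≤ k ∧ n ≠ g)) ∧
    (f ≠ 0 ∧ RainbowLink G c S v e (fun n => 0 < n ∧ n ≤ k ∧ n ≠ f) ∨
      g ≠ 0 ∧ RainbowLink G c S v e' (fun n => 0 < n ∧ n ≤ k ∧ n ≠ g))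

theorem Attachable.symm {c : Sym2 V → ℕ} {S : Set V} {v : V} {k : ℕ} {e e' : V}
    (h : Attachable G c S v k e e') : Attachable G c S v k e' e := by
  obtain ⟨f, g, hf, hg, hfg, h1, h2⟩ := h
  exact ⟨g, f, hg, hf, hfg.symm, fun u hu => (h1 u hu).symm, h2.symm⟩

/-- The invariant of vertex sets of order `2 * k + 1`: for any two pairs of vertices prescribed in
advance there is a valid colouring that has a spare link between the pairs. -/
def OddState (G : SimpleGraph V) (S : Set V) (v : V) (k : ℕ) : Prop :=
  S.ncard = 2 * k + 1 ∧ ∀ a ∈ S, ∀ b ∈ S, ∀ c₁ ∈ S, ∀ c₂ ∈ S, ∃ c : Sym2 V → ℕ, Valid G c S v k ∧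
    (a ≠ b → c₁ ≠ c₂ → SpareAmong G c S k a b c₁ c₂)

/-- The invariant of vertex sets of order `2 * k`: a vertex can be attached to two prescribed
vertices `e, e'` without a new colour, again with a prescribed spare link. The first pair of the
spare link may shrink to one of `e, e'`. -/
def EvenState (G : SimpleGraph V) (S : Set V) (v : V) (k : ℕ) : Prop :=
  S.ncard = 2 * k ∧ 2 ≤ k ∧ ∀ e ∈ S, ∀ e' ∈ S, ∀ a ∈ S, ∀ b ∈ S, ∀ c₁ ∈ S, ∀ c₂ ∈ S,
    e ≠ e' → (a ≠ b ∨ a = e ∨ a = e') → c₁ ≠ c₂ →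
    ∃ c : Sym2 V → ℕ, Valid G c S v k ∧ Attachable G c S v k e e' ∧ SpareAmong G c S k a b c₁ c₂

theorem IsEar.ncard_addEar [Finite V] {S T : Set V} {p : ℕ → V} {m : ℕ} (h : IsEar G S T p m) :
    (addEar S p m).ncard = S.ncard + m := by
  have h1 : addEar S p m = S ∪ p '' Set.Icc 1 m := by
    ext x
    simp only [addEar, Set.mem_ofPred_eq, Set.mem_union, Set.mem_image, Set.mem_Icc]
    constructor
    · rintro (hx | ⟨i, h1, h2, rfl⟩)
      exacts [Or.inl hx, Or.inr ⟨i, ⟨h1, h2⟩, rfl⟩]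
    · rintro (hx | ⟨i, ⟨h1, h2⟩, rfl⟩)
      exacts [Or.inl hx, Or.inr ⟨i, h1, h2, rfl⟩]
  have h2 : Disjoint S (p '' Set.Icc 1 m) := by
    rw [Set.disjoint_right]
    rintro _ ⟨i, ⟨h1, h2⟩, rfl⟩
    exact h.notMem i h1 h2
  rw [h1, Set.ncard_union_eq h2 (Set.toFinite _) (Set.toFinite _), Set.InjOn.ncard_image]
  · rw [← Finset.coe_Icc, Set.ncard_coe_finset]
    simp
  · intro i hi j hj e
    exact h.inj i j hi.1 hi.2 hj.1 hj.2 e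

/-! ### Ears with an even number of internal vertices -/

/-- An ear with `2 * t` internal vertices attached to `S`, its arms `P` and `Q` joined by an edge
of colour `0`. -/
structure EvenEar (G : SimpleGraph V) (S S' : Set V) (c c' : Sym2 V → ℕ) (P Q : ℕ → V) (v : V)
    (k t : ℕ) : Prop extends ColoredArms G S S' c c' P Q k t where
  valid : Valid G c S v k
  one_le : 1 ≤ t
  mid : RainbowLink G c' S' (P t) (Q 1) (fun n => n = 0)
  cover : ∀ x ∈ S', x ∈ S ∨ (∃ i, 1 ≤ i ∧ i ≤ t ∧ x = P i) ∨ ∃ j, 1 ≤ j ∧ j ≤ t ∧ x = Q j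

theorem IsEar.exists_evenEar {S T : Set V} {p : ℕ → V} {t : ℕ} {c : Sym2 V → ℕ} {v : V} {k : ℕ}
    (h : IsEar G S T p (2 * t)) (hc : Valid G c S v k) :
    ∃ c', EvenEar G S (addEar S p (2 * t)) c c' p (fun j => p (t + j)) v k t := by
  obtain ⟨c', h1, h2⟩ := h.exists_arms (d := 1) (t := t) rfl le_rfl c k (fun _ => 0)
  have := h.two_le
  refine ⟨c', h1, hc, by omega, h2 0 (by omega), ?_⟩
  rintro x (hx | ⟨i, hi, hi', rfl⟩)
  · exact Or.inl hx
  · rcases Nat.lt_or_ge t i with h3 | h3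
    · exact Or.inr (Or.inr ⟨i - t, by omega, by omega, by congr 1; omega⟩)
    · exact Or.inr (Or.inl ⟨i, hi, h3, rfl⟩)

namespace EvenEar

variable {S S' : Set V} {c c' : Sym2 V → ℕ} {P Q : ℕ → V} {v : V} {k t : ℕ}

theorem left_right (E : EvenEar G S S' c c' P Q v k t) {i j : ℕ} (hi : i ≤ t)
    (hj : 1 ≤ j) (hj' : j ≤ t) : RainbowLink G c' S' (P i) (Q j) (fun n => n ≤ k + t) := by
  rcases Nat.lt_or_ge i j with h | h
  · exact E.around h (by omega) (E.valid.all _ E.left_mem _ E.right_mem) (fun n h => h)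
      (fun n h => by omega) (fun n h h' => by omega) (fun n h h' => by omega)
  · exact E.across hi hj (by omega) E.mid (fun n h => by omega) (fun n h => by omega)
      (fun n h h' => by omega) (fun n h h' => by omega)

theorem left_all (E : EvenEar G S S' c c' P Q v k t) {i : ℕ} (hi : i ≤ t) {w : V} (hw : w ∈ S) :
    RainbowLink G c' S' (P i) w (fun n => n ≤ k + i) :=
  E.left_old hi (E.valid.all _ E.left_mem _ hw) (fun n h => h)
    (fun n h => by omega) (fun n h h' => by omega)

theorem right_all (E : EvenEar G S S' c c' P Q v k t) {j : ℕ} (hj : 1 ≤ j) (hj' : j ≤ t + 1) {w : V}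
    (hw : w ∈ S) : RainbowLink G c' S' (Q j) w (fun n => n ≤ k ∨ k + j ≤ n ∧ n ≤ k + t) :=
  E.right_old hj hj' (E.valid.all _ E.right_mem _ hw) (fun n h => h)
    (fun n h => by omega) (fun n h h' => by omega)

theorem valid' (E : EvenEar G S S' c c' P Q v k t) : Valid G c' S' v (k + t) where
  mem := (E.old _ _ _ (E.valid.root _ E.valid.mem)).left_mem
  root u hu := by
    rcases E.cover u hu with hu | ⟨i, hi, hi', rfl⟩ | ⟨j, hj, hj', rfl⟩
    · exact (E.old _ _ _ (E.valid.root u hu)).mono fun n h => by omega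
    · exact (E.left_old hi' (E.valid.root _ E.left_mem).symm (fun n h => by omega)
        (fun n h => by omega) (fun n h h' => by omega)).symm
    · exact (E.right_old hj (by omega) (E.valid.root _ E.right_mem).symm (fun n h => by omega)
        (fun n h => by omega) (fun n h h' => by omega)).symm
  all u hu w hw := by
    rcases E.cover u hu with hu | ⟨i, hi, hi', rfl⟩ | ⟨j, hj, hj', rfl⟩ <;>
    rcases E.cover w hw with hw | ⟨i₂, hi₂, hi₂', rfl⟩ | ⟨j₂, hj₂, hj₂', rfl⟩
    · exact (E.old _ _ _ (E.valid.all u hu w hw)).mono fun n h => by omega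
    · exact (E.left_all hi₂' hu).symm.mono fun n h => by omega
    · exact (E.right_all hj₂ (by omega) hu).symm.mono fun n h => by omega
    · exact (E.left_all hi' hw).mono fun n h => by omega
    · exact (E.left_left hi' hi₂').mono fun n h => by omega
    · exact E.left_right hi' hj₂ hj₂'
    · exact (E.right_all hj (by omega) hw).mono fun n h => by omega
    · exact (E.left_right hi₂' hj hj').symm
    · exact (E.right_right hj hj₂ (by omega) (by omega)).mono fun n h => by omega

theorem spare_left_right (E : EvenEar G S S' c c' P Q v k t) (hk : 1 ≤ k ∨ P 0 = Q (t + 1))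
    {i j : ℕ} (hi : i ≤ t) (hj : 1 ≤ j) (hj' : j ≤ t) : SpareLink G c' S' (k + t) (P i) (Q j) := by
  rcases Nat.lt_or_ge (i + 1) j with h | h
  · exact ⟨k + (i + 1), by omega, E.around (by omega) (by omega)
      (E.valid.all _ E.left_mem _ E.right_mem) (fun n h => h)
      (fun n h => by omega) (fun n h h' => by omega) (fun n h h' => by omega)⟩
  · rcases Nat.lt_or_ge i j with h2 | h2
    · rcases hk with hk | hk
      · exact ⟨1, by omega, E.across hi hj (by omega) E.mid (fun n h => by omega)
          (fun n h => by omega) (fun n h h' => by omega) (fun n h h' => by omega)⟩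
      · refine ⟨0, by omega, E.around (X := fun _ => False) (by omega) (by omega) ?_
          (fun n h => h.elim) (fun n h => h.elim) (fun n h h' => by omega) (fun n h h' => by omega)⟩
        rw [← hk]
        exact .refl E.left_mem
    · exact ⟨k + j, by omega, E.across hi hj (by omega) E.mid (fun n h => by omega)
          (fun n h => by omega) (fun n h h' => by omega) (fun n h h' => by omega)⟩

/-- Only the two middle vertices may lack a spare link, and only to vertices of `S`. -/
theorem spare (E : EvenEar G S S' c c' P Q v k t) (hk : 1 ≤ k ∨ P 0 = Q (t + 1))
    (u w : V) (hu : u ∈ S') (hw : w ∈ S') :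
    SpareLink G c' S' (k + t) u w ∨ ((u = P t ∨ u = Q 1) ∧ w ∈ S) ∨
      ((w = P t ∨ w = Q 1) ∧ u ∈ S) := by
  have ht := E.one_le
  rcases E.cover u hu with hu | ⟨i, hi, hi', rfl⟩ | ⟨j, hj, hj', rfl⟩ <;>
  rcases E.cover w hw with hw | ⟨i₂, hi₂, hi₂', rfl⟩ | ⟨j₂, hj₂, hj₂', rfl⟩
  · exact Or.inl ⟨k + t, le_rfl, (E.old _ _ _ (E.valid.all u hu w hw)).mono fun n h => by omega⟩
  · rcases eq_or_ne i₂ t with rfl | h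
    · exact Or.inr (Or.inr ⟨Or.inl rfl, hu⟩)
    · exact Or.inl ⟨k + t, le_rfl, (E.left_all hi₂' hu).symm.mono fun n h => by omega⟩
  · rcases eq_or_ne j₂ 1 with rfl | h
    · exact Or.inr (Or.inr ⟨Or.inr rfl, hu⟩)
    · exact Or.inl ⟨k + 1, by omega,
        (E.right_all hj₂ (by omega) hu).symm.mono fun n h => by omega⟩
  · rcases eq_or_ne i t with rfl | h
    · exact Or.inr (Or.inl ⟨Or.inl rfl, hw⟩)
    · exact Or.inl ⟨k + t, le_rfl, (E.left_all hi' hw).mono fun n h => by omega⟩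
  · exact Or.inl ⟨0, by omega, (E.left_left hi' hi₂').mono fun n h => by omega⟩
  · exact Or.inl (E.spare_left_right hk hi' hj₂ hj₂')
  · rcases eq_or_ne j 1 with rfl | h
    · exact Or.inr (Or.inl ⟨Or.inr rfl, hw⟩)
    · exact Or.inl ⟨k + 1, by omega, (E.right_all hj (by omega) hw).mono fun n h => by omega⟩
  · exact Or.inl (E.spare_left_right hk hi₂' hj hj').symm
  · exact Or.inl ⟨0, by omega,
      (E.right_right hj hj₂ (by omega) (by omega)).mono fun n h => by omega⟩

theorem spare_of_left (E : EvenEar G S S' c c' P Q v k t) {w : V}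
    (h : SpareLink G c S k (P 0) w) : SpareLink G c' S' (k + t) (P t) w := by
  obtain ⟨y, hy, h⟩ := h
  exact ⟨y, by omega, E.left_old le_rfl h (fun n h => h.1) (fun n h => by omega)
    (fun n h h' => by omega)⟩

theorem spare_of_right (E : EvenEar G S S' c c' P Q v k t) {w : V}
    (h : SpareLink G c S k (Q (t + 1)) w) : SpareLink G c' S' (k + t) (Q 1) w := by
  obtain ⟨y, hy, h⟩ := h
  exact ⟨y, by omega, E.right_old le_rfl (by omega) h (fun n h => h.1) (fun n h => by omega)
    (fun n h h' => by omega)⟩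

theorem attachable_old (E : EvenEar G S S' c c' P Q v k t) {e e' : V}
    (h : Attachable G c S v k e e') : Attachable G c' S' v (k + t) e e' := by
  obtain ⟨f, g, hf, hg, hfg, h1, h2⟩ := h
  refine ⟨f, g, by omega, by omega, hfg, ?_, ?_⟩
  · intro u hu
    rcases E.cover u hu with hu | ⟨i, hi, hi', rfl⟩ | ⟨j, hj, hj', rfl⟩
    · exact (h1 u hu).imp (fun h => (E.old _ _ _ h).mono fun n h => by omega)
        (fun h => (E.old _ _ _ h).mono fun n h => by omega)
    · exact (h1 _ E.left_mem).imp
        (fun h => E.left_old hi' h (fun n h => h.1) (fun n h => by omega) (fun n h h' => by omega))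
        (fun h => E.left_old hi' h (fun n h => h.1) (fun n h => by omega) (fun n h h' => by omega))
    · exact (h1 _ E.right_mem).imp
        (fun h => E.right_old hj (by omega) h (fun n h => h.1) (fun n h => by omega)
          (fun n h h' => by omega))
        (fun h => E.right_old hj (by omega) h (fun n h => h.1) (fun n h => by omega)
          (fun n h h' => by omega))
  · exact h2.imp (fun h => ⟨h.1, (E.old _ _ _ h.2).mono fun n h => by omega⟩)
      (fun h => ⟨h.1, (E.old _ _ _ h.2).mono fun n h => by omega⟩)

theorem attachable_left_old (E : EvenEar G S S' c c' P Q v k t) (hk : 1 ≤ k) {i : ℕ} (hi : 1 ≤ i)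
    (hi' : i ≤ t) {e : V} (he : e ∈ S) : Attachable G c' S' v (k + t) (P i) e := by
  refine ⟨1, k + i, by omega, by omega, by omega, ?_, Or.inr ⟨by omega,
    (E.old _ _ _ (E.valid.root e he)).mono fun n h => by omega⟩⟩
  intro u hu
  rcases E.cover u hu with hu | ⟨l, hl, hl', rfl⟩ | ⟨l, hl, hl', rfl⟩
  · exact Or.inr ((E.old _ _ _ (E.valid.all u hu e he)).mono fun n h => by omega)
  · exact Or.inl ((E.left_left hl' hi').mono fun n h => by omega)
  · rcases Nat.lt_or_ge i l with h | h
    · exact Or.inr ((E.right_all hl (by omega) he).mono fun n h => by omega)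
    · exact Or.inl (E.across hi' hl (by omega) E.mid (fun n h => by omega) (fun n h => by omega)
        (fun n h h' => by omega) (fun n h h' => by omega)).symm

theorem attachable_right_old (E : EvenEar G S S' c c' P Q v k t) (hk : 1 ≤ k) {j : ℕ} (hj : 1 ≤ j)
    (hj' : j ≤ t) {e : V} (he : e ∈ S) : Attachable G c' S' v (k + t) (Q j) e := by
  refine ⟨1, k + j, by omega, by omega, by omega, ?_, Or.inr ⟨by omega,
    (E.old _ _ _ (E.valid.root e he)).mono fun n h => by omega⟩⟩
  intro u hu
  rcases E.cover u hu with hu | ⟨l, hl, hl', rfl⟩ | ⟨l, hl, hl', rfl⟩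
  · exact Or.inr ((E.old _ _ _ (E.valid.all u hu e he)).mono fun n h => by omega)
  · rcases Nat.lt_or_ge l j with h | h
    · exact Or.inr ((E.left_all hl' he).mono fun n h => by omega)
    · exact Or.inl (E.across hl' hj (by omega) E.mid (fun n h => by omega) (fun n h => by omega)
        (fun n h h' => by omega) (fun n h h' => by omega))
  · exact Or.inl ((E.right_right hl hj (by omega) (by omega)).mono fun n h => by omega)

theorem attachable_left_left (E : EvenEar G S S' c c' P Q v k t) (hk : 1 ≤ k) {i j : ℕ}
    (hi : 1 ≤ i) (hij : i < j) (hj : j ≤ t) : Attachable G c' S' v (k + t) (P i) (P j) := by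
  refine ⟨k + j, 1, by omega, by omega, by omega, ?_, Or.inl ⟨by omega,
    (E.left_old (by omega) (E.valid.root _ E.left_mem).symm (fun n h => h.2)
      (fun n h => by omega) (fun n h h' => by omega)).symm⟩⟩
  intro u hu
  rcases E.cover u hu with hu | ⟨l, hl, hl', rfl⟩ | ⟨l, hl, hl', rfl⟩
  · exact Or.inl ((E.left_all (by omega) hu).symm.mono fun n h => by omega)
  · exact Or.inr ((E.left_left hl' hj).mono fun n h => by omega)
  · rcases Nat.lt_or_ge j l with h | h
    · exact Or.inl (E.around (by omega) (by omega) (E.valid.all _ E.left_mem _ E.right_mem)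
        (fun n h => h) (fun n h => by omega) (fun n h h' => by omega) (fun n h h' => by omega)).symm
    · exact Or.inr (E.across hj hl (by omega) E.mid (fun n h => by omega) (fun n h => by omega)
        (fun n h h' => by omega) (fun n h h' => by omega)).symm

theorem attachable_right_right (E : EvenEar G S S' c c' P Q v k t) (hk : 1 ≤ k) {i j : ℕ}
    (hi : 1 ≤ i) (hij : i < j) (hj : j ≤ t) : Attachable G c' S' v (k + t) (Q i) (Q j) := by
  refine ⟨1, k + i, by omega, by omega, by omega, ?_, Or.inr ⟨by omega,
    (E.right_old (by omega) (by omega) (E.valid.root _ E.right_mem).symm (fun n h => h.2)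
      (fun n h => by omega) (fun n h h' => by omega)).symm⟩⟩
  intro u hu
  rcases E.cover u hu with hu | ⟨l, hl, hl', rfl⟩ | ⟨l, hl, hl', rfl⟩
  · exact Or.inr ((E.right_all (by omega) (by omega) hu).symm.mono fun n h => by omega)
  · rcases Nat.lt_or_ge l i with h | h
    · exact Or.inr (E.around (by omega) (by omega) (E.valid.all _ E.left_mem _ E.right_mem)
        (fun n h => h) (fun n h => by omega) (fun n h h' => by omega) (fun n h h' => by omega))
    · exact Or.inl (E.across hl' hi (by omega) E.mid (fun n h => by omega) (fun n h => by omega)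
        (fun n h h' => by omega) (fun n h h' => by omega))
  · exact Or.inl ((E.right_right hl hi (by omega) (by omega)).mono fun n h => by omega)

theorem attachable_left_right (E : EvenEar G S S' c c' P Q v k t) {i j : ℕ}
    (hi : i ≤ t) (hj : 1 ≤ j) (hj' : j ≤ t + 1)
    (h : Attachable G c S v k (P 0) (Q (t + 1))) : Attachable G c' S' v (k + t) (P i) (Q j) := by
  obtain ⟨f, g, hf, hg, hfg, h1, h2⟩ := h
  refine ⟨f, g, by omega, by omega, hfg, ?_, ?_⟩
  · intro u hu
    rcases E.cover u hu with hu | ⟨l, hl, hl', rfl⟩ | ⟨l, hl, hl', rfl⟩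
    · exact (h1 u hu).imp
        (fun h => (E.left_old hi h.symm (fun n h => h.1) (fun n h => by omega)
          (fun n h h' => by omega)).symm)
        (fun h => (E.right_old hj (by omega) h.symm (fun n h => h.1) (fun n h => by omega)
          (fun n h h' => by omega)).symm)
    · exact Or.inl ((E.left_left hl' hi).mono fun n h => by omega)
    · exact Or.inr ((E.right_right hl hj (by omega) (by omega)).mono fun n h => by omega)
  · exact h2.imp
      (fun h => ⟨h.1, (E.left_old hi h.2.symm (fun n h => h.2.1) (fun n h => by omega)
          (fun n h h' => by omega)).symm⟩)
      (fun h => ⟨h.1, (E.right_old hj (by omega) h.2.symm (fun n h => h.2.1) (fun n h => by omega)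
          (fun n h h' => by omega)).symm⟩)

/-- A vertex of the ear and any other vertex can be attached to as soon as the two ends can. -/
theorem attachable_new (E : EvenEar G S S' c c' P Q v k t) (hk : 1 ≤ k)
    (h : Attachable G c S v k (P 0) (Q (t + 1))) {e e' : V} (he : e ∈ S') (he' : e' ∈ S')
    (hne : e ≠ e') (hS : ¬ (e ∈ S ∧ e' ∈ S)) : Attachable G c' S' v (k + t) e e' := by
  rcases E.cover e he with he | ⟨i, hi, hi', rfl⟩ | ⟨i, hi, hi', rfl⟩ <;>
  rcases E.cover e' he' with he' | ⟨j, hj, hj', rfl⟩ | ⟨j, hj, hj', rfl⟩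
  · exact absurd ⟨he, he'⟩ hS
  · exact (E.attachable_left_old hk hj hj' he).symm
  · exact (E.attachable_right_old hk hj hj' he).symm
  · exact E.attachable_left_old hk hi hi' he'
  · rcases lt_trichotomy i j with h' | rfl | h'
    exacts [E.attachable_left_left hk hi h' hj', absurd rfl hne,
      (E.attachable_left_left hk hj h' hi').symm]
  · exact E.attachable_left_right hi' hj (by omega) h
  · exact E.attachable_right_old hk hi hi' he'
  · exact (E.attachable_left_right hj' hi (by omega) h).symm
  · rcases lt_trichotomy i j with h' | rfl | h'
    exacts [E.attachable_right_right hk hi h' hj', absurd rfl hne,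
      (E.attachable_right_right hk hj h' hi').symm]

end EvenEar

theorem IsEar.ne_of_ne {S T : Set V} {p : ℕ → V} {m : ℕ} (h : IsEar G S T p m) {x y : V}
    (hx : x ∈ S) (hy : y ∈ S) (hxy : x ≠ y) : p 0 ≠ p (m + 1) := fun e =>
  hxy ((h.ends e x hx).trans (h.ends e y hy).symm)

theorem SpareAmong.symm {c : Sym2 V → ℕ} {S : Set V} {k : ℕ} {a b c₁ c₂ : V}
    (h : SpareAmong G c S k a b c₁ c₂) : SpareAmong G c S k c₁ c₂ a b := by
  rcases h with h | h | h | h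
  exacts [Or.inl h.symm, Or.inr (Or.inr (Or.inl h.symm)), Or.inr (Or.inl h.symm),
    Or.inr (Or.inr (Or.inr h.symm))]

namespace EvenEar

variable {S S' : Set V} {c c' : Sym2 V → ℕ} {P Q : ℕ → V} {v : V} {k t : ℕ} {a b c₁ c₂ : V}

theorem spareAmong_of_not (E : EvenEar G S S' c c' P Q v k t) (hk : 1 ≤ k ∨ P 0 = Q (t + 1))
    (ha : a ∈ S') (hb : b ∈ S') (hc₁ : c₁ ∈ S') (hc₂ : c₂ ∈ S') (hab : ¬ (a ∈ S ∧ b ∈ S))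
    (hcc : ¬ (c₁ ∈ S ∧ c₂ ∈ S)) : SpareAmong G c' S' (k + t) a b c₁ c₂ := by
  have key : ∀ u ∈ S', ∀ w ∈ S', u ∉ S → w ∉ S → SpareLink G c' S' (k + t) u w := by
    intro u hu w hw hu' hw'
    rcases E.spare hk u w hu hw with h | h | h
    exacts [h, absurd h.2 hw', absurd h.2 hu']
  rcases not_and_or.1 hab with h | h <;> rcases not_and_or.1 hcc with h' | h'
  exacts [Or.inl (key _ ha _ hc₁ h h'), Or.inr (Or.inl (key _ ha _ hc₂ h h')),
    Or.inr (Or.inr (Or.inl (key _ hb _ hc₁ h h'))), Or.inr (Or.inr (Or.inr (key _ hb _ hc₂ h h')))]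

theorem spareLink_of_mem (E : EvenEar G S S' c c' P Q v k t) (hk : 1 ≤ k ∨ P 0 = Q (t + 1))
    (hP : P t ∉ S) (hQ : Q 1 ∉ S) (ha : a ∈ S') (hc₁ : c₁ ∈ S) (h1 : a ≠ P t) (h2 : a ≠ Q 1) :
    SpareLink G c' S' (k + t) a c₁ := by
  rcases E.spare hk a c₁ ha (E.old _ _ (fun _ => True) (.refl hc₁)).left_mem with h | ⟨h, -⟩ | ⟨h, -⟩
  · exact h
  · exact (h.elim h1 h2).elim
  · rcases h with rfl | rfl
    exacts [absurd hc₁ hP, absurd hc₁ hQ]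

theorem spareAmong_of_mem (E : EvenEar G S S' c c' P Q v k t) (hk : 1 ≤ k ∨ P 0 = Q (t + 1))
    (hP : P t ∉ S) (hQ : Q 1 ∉ S) (ha : a ∈ S') (hb : b ∈ S') (hc₁ : c₁ ∈ S) (hab : a ≠ b)
    (h : SpareAmong G c' S' (k + t) (P t) (Q 1) c₁ c₂) :
    SpareAmong G c' S' (k + t) a b c₁ c₂ := by
  by_cases ha' : a = P t ∨ a = Q 1
  · by_cases hb' : b = P t ∨ b = Q 1
    · rcases ha' with rfl | rfl <;> rcases hb' with rfl | rfl
      · exact absurd rfl hab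
      · exact h
      · rcases h with h | h | h | h
        exacts [Or.inr (Or.inr (Or.inl h)), Or.inr (Or.inr (Or.inr h)), Or.inl h, Or.inr (Or.inl h)]
      · exact absurd rfl hab
    · rw [not_or] at hb'
      exact Or.inr (Or.inr (Or.inl (E.spareLink_of_mem hk hP hQ hb hc₁ hb'.1 hb'.2)))
  · rw [not_or] at ha'
    exact Or.inl (E.spareLink_of_mem hk hP hQ ha hc₁ ha'.1 ha'.2)

theorem spareAmong_ends (E : EvenEar G S S' c c' P Q v k t)
    (h : SpareAmong G c S k (P 0) (Q (t + 1)) c₁ c₂) :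
    SpareAmong G c' S' (k + t) (P t) (Q 1) c₁ c₂ := by
  rcases h with h | h | h | h
  exacts [Or.inl (E.spare_of_left h), Or.inr (Or.inl (E.spare_of_left h)),
    Or.inr (Or.inr (Or.inl (E.spare_of_right h))), Or.inr (Or.inr (Or.inr (E.spare_of_right h)))]

end EvenEar

/-- The arms carry the new colours and the middle edge colour `0`. Only the
two middle vertices may lack spare links, and only to vertices of `S`; a spare link inside `S`
between the ends of the ear and a prescribed pair extends to them. -/
theorem OddState.addEar_even [Finite V] {S T : Set V} {p : ℕ → V} {t k : ℕ} {v : V}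
    (hS : OddState G S v k) (h : IsEar G S T p (2 * t)) :
    OddState G (addEar S p (2 * t)) v (k + t) := by
  have ht : 1 ≤ t := by have := h.two_le; omega
  refine ⟨by rw [h.ncard_addEar, hS.1]; omega, ?_⟩
  have hr : p (t + (t + 1)) = p (2 * t + 1) := by congr 1; omega
  have hk : 1 ≤ k ∨ p 0 = p (t + (t + 1)) := by
    rcases Nat.eq_zero_or_pos k with rfl | hk
    · have h1 : S.ncard = 1 := by rw [hS.1]
      obtain ⟨x, rfl⟩ := Set.ncard_eq_one.1 h1
      right
      rw [hr]
      have e1 : p 0 = x := h.left_mem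
      have e2 : p (2 * t + 1) = x := h.right_mem
      rw [e1, e2]
    · exact Or.inl hk
  have hl := h.left_mem
  have hr' := h.right_mem
  have hP : p t ∉ S := h.notMem _ ht (by omega)
  have hQ : p (t + 1) ∉ S := h.notMem _ (by omega) (by omega)
  -- Valid colourings with the spare links of `S` between the ends of the ear and a given pair.
  have main : ∀ x ∈ S, ∀ y ∈ S, ∃ c c' : Sym2 V → ℕ, EvenEar G S (addEar S p (2 * t)) c c' p
      (fun j => p (t + j)) v k t ∧ (x ≠ y →
        SpareAmong G c' (addEar S p (2 * t)) (k + t) (p t) (p (t + 1)) x y) := by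
    intro x hx y hy
    obtain ⟨c, hc, hsp⟩ := hS.2 _ hl _ hr' x hx y hy
    obtain ⟨c', E⟩ := h.exists_evenEar hc
    refine ⟨c, c', E, fun hxy => ?_⟩
    have hsp := hsp (h.ne_of_ne hx hy hxy) hxy
    rw [← hr] at hsp
    exact E.spareAmong_ends hsp
  intro a ha b hb c₁ hc₁ c₂ hc₂
  by_cases hcs : c₁ ∈ S ∧ c₂ ∈ S
  · obtain ⟨c, c', E, hsp⟩ := main c₁ hcs.1 c₂ hcs.2
    exact ⟨c', E.valid', fun hab hcc => E.spareAmong_of_mem hk hP hQ ha hb hcs.1 hab (hsp hcc)⟩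
  · by_cases hab : a ∈ S ∧ b ∈ S
    · obtain ⟨c, c', E, hsp⟩ := main a hab.1 b hab.2
      exact ⟨c', E.valid', fun hab' hcc =>
        (E.spareAmong_of_mem hk hP hQ hc₁ hc₂ hab.1 hcc (hsp hab')).symm⟩
    · obtain ⟨c, c', E, -⟩ := main _ hl _ hr'
      exact ⟨c', E.valid', fun _ _ => E.spareAmong_of_not hk ha hb hc₁ hc₂ hab hcs⟩

/-- Attachability at vertices of the ear comes from attachability at suitable vertices of `S`, which
are prescribed to the state of `S` in advance. -/
theorem EvenState.addEar_even [Finite V] {S T : Set V} {p : ℕ → V} {t k : ℕ} {v : V}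
    (hS : EvenState G S v k) (h : IsEar G S T p (2 * t)) :
    EvenState G (addEar S p (2 * t)) v (k + t) := by
  have ht : 1 ≤ t := by have := h.two_le; omega
  obtain ⟨hcard, hk2, hS⟩ := hS
  refine ⟨by rw [h.ncard_addEar, hcard]; omega, by omega, ?_⟩
  have hr : p (t + (t + 1)) = p (2 * t + 1) := by congr 1; omega
  have hk : 1 ≤ k := by omega
  have hl := h.left_mem
  have hr' : p (t + (t + 1)) ∈ S := hr ▸ h.right_mem
  have hlr : p 0 ≠ p (t + (t + 1)) := by
    obtain ⟨x, hx, y, hy, hxy⟩ := (Set.one_lt_ncard (s := S)).1 (by omega)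
    rw [hr]
    exact h.ne_of_ne hx hy hxy
  have hP : p t ∉ S := h.notMem _ ht (by omega)
  have hQ : p (t + 1) ∉ S := h.notMem _ (by omega) (by omega)
  -- The inner colouring, with inner attachment vertices `e₁, e₂` and inner spare pairs, together
  -- with the outer spare links it produces.
  have main : ∀ e₁ ∈ S, ∀ e₂ ∈ S, ∀ x ∈ S, ∀ y ∈ S, ∀ z ∈ S, ∀ w ∈ S, e₁ ≠ e₂ →
      (x ≠ y ∨ x = e₁ ∨ x = e₂) → z ≠ w → ∃ c c' : Sym2 V → ℕ, EvenEar G S (addEar S p (2 * t)) c c' p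
      (fun j => p (t + j)) v k t ∧ Attachable G c S v k e₁ e₂ ∧
        SpareAmong G c S k x y z w := by
    intro e₁ h1 e₂ h2 x hx y hy z hz w hw h3 h4 h5
    obtain ⟨c, hc, hat, hsp⟩ := hS e₁ h1 e₂ h2 x hx y hy z hz w hw h3 h4 h5
    obtain ⟨c', E⟩ := h.exists_evenEar hc
    exact ⟨c, c', E, hat, hsp⟩
  intro e he e' he' a ha b hb c₁ hc₁ c₂ hc₂ hee haa hcc
  -- The inner attachment vertices: `e, e'` themselves, or else the ends of the ear, or else the one
  -- of `e, e'` in `S` with an arbitrary partner.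
  have reduce : ∀ x ∈ S, ∀ y ∈ S, ∀ z ∈ S, ∀ w ∈ S, z ≠ w → (x ≠ y ∨ x = e ∨ x = e' ∨
      (¬ (e ∈ S ∧ e' ∈ S) ∧ (x = p 0 ∨ x = p (t + (t + 1))))) →
      ∃ c c' : Sym2 V → ℕ, EvenEar G S (addEar S p (2 * t)) c c' p (fun j => p (t + j)) v k t ∧
        Attachable G c' (addEar S p (2 * t)) v (k + t) e e' ∧
        SpareAmong G c S k x y z w := by
    intro x hx y hy z hz w hw hzw hxx
    by_cases hes : e ∈ S ∧ e' ∈ S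
    · obtain ⟨c, c', E, hat, hsp⟩ := main e hes.1 e' hes.2 x hx y hy z hz w hw hee (by tauto) hzw
      exact ⟨c, c', E, E.attachable_old hat, hsp⟩
    · by_cases hxy : x ≠ y ∨ x = p 0 ∨ x = p (t + (t + 1))
      · obtain ⟨c, c', E, hat, hsp⟩ := main _ hl _ hr' x hx y hy z hz w hw hlr hxy hzw
        exact ⟨c, c', E, E.attachable_new hk hat he he' hee hes, hsp⟩
      · obtain ⟨c, c', E, hat, hsp⟩ := main x hx _ hl x hx y hy z hz w hw (by tauto) (by tauto) hzw
        refine ⟨c, c', E, ?_, hsp⟩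
        rcases (show x = e ∨ x = e' by tauto) with rfl | rfl
        · rcases E.cover e' he' with h' | ⟨j, hj, hj', rfl⟩ | ⟨j, hj, hj', rfl⟩
          exacts [absurd ⟨hx, h'⟩ hes, (E.attachable_left_old hk hj hj' hx).symm,
            (E.attachable_right_old hk hj hj' hx).symm]
        · rcases E.cover e he with h' | ⟨j, hj, hj', rfl⟩ | ⟨j, hj, hj', rfl⟩
          exacts [absurd ⟨h', hx⟩ hes, E.attachable_left_old hk hj hj' hx,
            E.attachable_right_old hk hj hj' hx]
  by_cases hcs : c₁ ∈ S ∧ c₂ ∈ S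
  · by_cases hab : a = b
    · subst hab
      have haa : a = e ∨ a = e' := by simpa using haa
      by_cases hap : a = p t ∨ a = p (t + 1)
      · have hes : ¬ (e ∈ S ∧ e' ∈ S) := by
          rintro ⟨h1, h2⟩
          rcases haa with rfl | rfl <;> rcases hap with rfl | rfl <;> contradiction
        rcases hap with rfl | rfl
        · obtain ⟨c, c', E, hat, hsp⟩ := reduce _ hl _ hl _ hcs.1 _ hcs.2 hcc
            (Or.inr (Or.inr (Or.inr ⟨hes, Or.inl rfl⟩)))
          refine ⟨c', E.valid', hat, ?_⟩
          rcases hsp with h | h | h | h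
          exacts [Or.inl (E.spare_of_left h), Or.inr (Or.inl (E.spare_of_left h)),
            Or.inl (E.spare_of_left h), Or.inr (Or.inl (E.spare_of_left h))]
        · obtain ⟨c, c', E, hat, hsp⟩ := reduce _ hr' _ hr' _ hcs.1 _ hcs.2 hcc
            (Or.inr (Or.inr (Or.inr ⟨hes, Or.inr rfl⟩)))
          refine ⟨c', E.valid', hat, ?_⟩
          rcases hsp with h | h | h | h
          exacts [Or.inl (E.spare_of_right h), Or.inr (Or.inl (E.spare_of_right h)),
            Or.inl (E.spare_of_right h), Or.inr (Or.inl (E.spare_of_right h))]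
      · rw [not_or] at hap
        obtain ⟨c, c', E, hat, -⟩ := reduce _ hl _ hr' _ hl _ hr' hlr (Or.inl hlr)
        exact ⟨c', E.valid', hat,
          Or.inl (E.spareLink_of_mem (Or.inl hk) hP hQ ha hcs.1 hap.1 hap.2)⟩
    · obtain ⟨c, c', E, hat, hsp⟩ := reduce _ hl _ hr' _ hcs.1 _ hcs.2 hcc (Or.inl hlr)
      exact ⟨c', E.valid', hat,
        E.spareAmong_of_mem (Or.inl hk) hP hQ ha hb hcs.1 hab (E.spareAmong_ends hsp)⟩
  · by_cases habS : a ∈ S ∧ b ∈ S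
    · obtain ⟨c, c', E, hat, hsp⟩ :=
        reduce a habS.1 b habS.2 _ hl _ hr' hlr (by tauto)
      exact ⟨c', E.valid', hat, (E.spareAmong_of_mem (Or.inl hk) hP hQ hc₁ hc₂ habS.1 hcc
        (E.spareAmong_ends hsp.symm)).symm⟩
    · obtain ⟨c, c', E, hat, -⟩ := reduce _ hl _ hr' _ hl _ hr' hlr (Or.inl hlr)
      exact ⟨c', E.valid', hat, E.spareAmong_of_not (Or.inl hk) ha hb hc₁ hc₂ habS hcs⟩

/-! ### Ears with an odd number of internal vertices -/

/-- An ear with `2 * t + 1` internal vertices attached to `S`: its arms `P` and `Q`, and the middle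
vertex `x` joined to them by edges of two different old colours `μ` and `ν`. -/
structure OddEar (G : SimpleGraph V) (S S' : Set V) (c c' : Sym2 V → ℕ) (P Q : ℕ → V) (x : V)
    (μ ν k t : ℕ) : Prop extends ColoredArms G S S' c c' P Q k t where
  one_le : 1 ≤ t
  ne : μ ≠ ν
  left_le : μ ≤ k
  right_le : ν ≤ k
  notMem : x ∉ S
  mid_left : RainbowLink G c' S' (P t) x (fun n => n = μ)
  mid_right : RainbowLink G c' S' x (Q 1) (fun n => n = ν)
  cover : ∀ y ∈ S', y ∈ S ∨ (∃ i, 1 ≤ i ∧ i ≤ t ∧ y = P i) ∨ (∃ j, 1 ≤ j ∧ j ≤ t ∧ y = Q j) ∨ y = x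

theorem IsEar.exists_oddEar {S T : Set V} {p : ℕ → V} {t : ℕ} (h : IsEar G S T p (2 * t + 1))
    (c : Sym2 V → ℕ) {μ ν k : ℕ} (hμν : μ ≠ ν) (hμ : μ ≤ k) (hν : ν ≤ k) :
    ∃ c', OddEar G S (addEar S p (2 * t + 1)) c c' p (fun j => p (t + 1 + j)) (p (t + 1)) μ ν k t := by
  obtain ⟨c', h1, h2⟩ := h.exists_arms (d := 2) (t := t) rfl (by omega) c k
    (fun i => if i = 0 then μ else ν)
  have := h.two_le
  refine ⟨c', h1, by omega, hμν, hμ, hν, h.notMem _ (by omega) (by omega), h2 0 (by omega),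
    h2 1 (by omega), ?_⟩
  rintro y (hy | ⟨i, hi, hi', rfl⟩)
  · exact Or.inl hy
  · rcases lt_trichotomy i (t + 1) with h3 | rfl | h3
    · exact Or.inr (Or.inl ⟨i, hi, by omega, rfl⟩)
    · exact Or.inr (Or.inr (Or.inr rfl))
    · exact Or.inr (Or.inr (Or.inl ⟨i - (t + 1), by omega, by omega, by congr 1; omega⟩))

namespace OddEar

variable {S S' : Set V} {c c' : Sym2 V → ℕ} {P Q : ℕ → V} {x v w : V} {μ ν k t i j : ℕ}
  {X Z : ℕ → Prop}

theorem mid (E : OddEar G S S' c c' P Q x μ ν k t) :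
    RainbowLink G c' S' (P t) (Q 1) (fun n => n = μ ∨ n = ν) :=
  E.mid_left.trans E.mid_right (fun _ h h' => E.ne (h ▸ h')) (fun _ h => Or.inl h)
    (fun _ h => Or.inr h)

theorem left_mid (E : OddEar G S S' c c' P Q x μ ν k t) (hi : i ≤ t) :
    RainbowLink G c' S' (P i) x (fun n => n = μ ∨ k + i < n ∧ n ≤ k + t) :=
  (E.left i t hi le_rfl).trans E.mid_left (fun n h h' => by have := E.left_le; omega)
    (fun n h => Or.inr h) (fun n h => Or.inl h)

theorem right_mid (E : OddEar G S S' c c' P Q x μ ν k t) (hj : 1 ≤ j) (hj' : j ≤ t + 1) :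
    RainbowLink G c' S' (Q j) x (fun n => n = ν ∨ k + 1 ≤ n ∧ n < k + j) :=
  (E.right 1 j le_rfl hj hj').symm.trans E.mid_right.symm
    (fun n h h' => by have := E.right_le; omega) (fun n h => Or.inr h) (fun n h => Or.inl h)

theorem mid_old_left (E : OddEar G S S' c c' P Q x μ ν k t)
    (h : RainbowLink G c S (P 0) w X) (hX : ∀ n, X n → n ≤ k) (hμ : ¬ X μ) :
    RainbowLink G c' S' x w (fun n => n = μ ∨ X n ∨ k < n ∧ n ≤ k + t) :=
  (E.left_mid (Nat.zero_le t)).symm.trans (E.old _ _ _ h)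
    (fun n h1 h2 => by
      have := hX n h2
      rcases h1 with rfl | h1
      · exact hμ h2
      · omega)
    (fun n h => by omega) (fun n h => Or.inr (Or.inl h))

theorem mid_old_right (E : OddEar G S S' c c' P Q x μ ν k t)
    (h : RainbowLink G c S (Q (t + 1)) w X) (hX : ∀ n, X n → n ≤ k) (hν : ¬ X ν) :
    RainbowLink G c' S' x w (fun n => n = ν ∨ X n ∨ k < n ∧ n ≤ k + t) :=
  (E.right_mid (by omega) le_rfl).symm.trans (E.old _ _ _ h)
    (fun n h1 h2 => by
      have := hX n h2
      rcases h1 with rfl | h1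
      · exact hν h2
      · omega)
    (fun n h => by omega) (fun n h => Or.inr (Or.inl h))

section Fresh

/- The middle colours are the otherwise unused colour `k + 1` and the colour `0`; the colouring of
`S` uses the colours up to `k` only. -/

theorem left_all (E : OddEar G S S' c c' P Q x (k + 1) 0 (k + 1) t) (hv : Valid G c S v k)
    (hi : i ≤ t) (hw : w ∈ S) :
    RainbowLink G c' S' (P i) w (fun n => n ≤ k ∨ k + 1 < n ∧ n ≤ k + 1 + i) :=
  E.left_old hi (hv.all _ E.left_mem _ hw) (fun n h => by omega)
    (fun n h => by omega) (fun n h h' => by omega)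

theorem right_all (E : OddEar G S S' c c' P Q x (k + 1) 0 (k + 1) t) (hv : Valid G c S v k)
    (hj : 1 ≤ j) (hj' : j ≤ t + 1) (hw : w ∈ S) :
    RainbowLink G c' S' (Q j) w (fun n => n ≤ k ∨ k + 1 + j ≤ n ∧ n ≤ k + 1 + t) :=
  E.right_old hj hj' (hv.all _ E.right_mem _ hw) (fun n h => by omega)
    (fun n h => by omega) (fun n h h' => by omega)

theorem around_all (E : OddEar G S S' c c' P Q x (k + 1) 0 (k + 1) t) (hv : Valid G c S v k)
    (hij : i < j) (hj : j ≤ t) : RainbowLink G c' S' (P i) (Q j)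
      (fun n => n ≤ k ∨ k + 1 < n ∧ n ≤ k + 1 + i ∨ k + 1 + j ≤ n ∧ n ≤ k + 1 + t) :=
  E.around hij (by omega) (hv.all _ E.left_mem _ E.right_mem) (fun n h => by omega)
    (fun n h => by omega) (fun n h h' => by omega) (fun n h h' => by omega)

theorem across_all (E : OddEar G S S' c c' P Q x (k + 1) 0 (k + 1) t)
    (hij : j ≤ i) (hj : 1 ≤ j) (hi : i ≤ t) : RainbowLink G c' S' (P i) (Q j)
      (fun n => n = 0 ∨ n = k + 1 ∨ k + 1 + i < n ∧ n ≤ k + 1 + t ∨ k + 1 < n ∧ n < k + 1 + j) :=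
  E.across hi hj (by omega) E.mid (fun n h => by omega) (fun n h => by omega)
    (fun n h h' => by omega) (fun n h h' => by omega)

theorem fresh_valid (E : OddEar G S S' c c' P Q x (k + 1) 0 (k + 1) t) (hv : Valid G c S v k) :
    Valid G c' S' v (k + 1 + t) where
  mem := (E.old _ _ _ (hv.root _ hv.mem)).left_mem
  root u hu := by
    rcases E.cover u hu with hu | ⟨i, hi, hi', rfl⟩ | ⟨j, hj, hj', rfl⟩ | rfl
    · exact (E.old _ _ _ (hv.root u hu)).mono fun n h => by omega
    · exact (E.left_old hi' (hv.root _ E.left_mem).symm (fun n h => by omega)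
        (fun n h => by omega) (fun n h h' => by omega)).symm
    · exact (E.right_old hj (by omega) (hv.root _ E.right_mem).symm (fun n h => by omega)
        (fun n h => by omega) (fun n h h' => by omega)).symm
    · exact (E.mid_old_left (hv.root _ E.left_mem).symm (fun n h => by omega)
        (by omega)).symm.mono fun n h => by omega
  all u hu w hw := by
    have lr : ∀ i j, i ≤ t → 1 ≤ j → j ≤ t →
        RainbowLink G c' S' (P i) (Q j) (fun n => n ≤ k + 1 + t) := by
      intro i j hi hj hj'
      rcases Nat.lt_or_ge i j with h | h
      · exact (E.around_all hv h hj').mono fun n h => by omega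
      · exact (E.across_all h hj hi).mono fun n h => by omega
    have old_mid : ∀ u ∈ S, RainbowLink G c' S' x u (fun n => n ≤ k + 1 + t) := fun u hu =>
      (E.mid_old_left (hv.all _ E.left_mem u hu) (fun n h => by omega)
        (by omega)).mono fun n h => by omega
    have hx : x ∈ S' := E.mid_right.left_mem
    rcases E.cover u hu with hu | ⟨i, hi, hi', rfl⟩ | ⟨j, hj, hj', rfl⟩ | rfl <;>
    rcases E.cover w hw with hw | ⟨i₂, hi₂, hi₂', rfl⟩ | ⟨j₂, hj₂, hj₂', rfl⟩ | rfl
    · exact (E.old _ _ _ (hv.all u hu w hw)).mono fun n h => by omega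
    · exact (E.left_all hv hi₂' hu).symm.mono fun n h => by omega
    · exact (E.right_all hv hj₂ (by omega) hu).symm.mono fun n h => by omega
    · exact (old_mid u hu).symm
    · exact (E.left_all hv hi' hw).mono fun n h => by omega
    · exact (E.left_left hi' hi₂').mono fun n h => by omega
    · exact lr _ _ hi' hj₂ hj₂'
    · exact (E.left_mid hi').mono fun n h => by omega
    · exact (E.right_all hv hj (by omega) hw).mono fun n h => by omega
    · exact (lr _ _ hi₂' hj hj').symm
    · exact (E.right_right hj hj₂ (by omega) (by omega)).mono fun n h => by omega
    · exact (E.right_mid hj (by omega)).mono fun n h => by omega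
    · exact old_mid w hw
    · exact (E.left_mid hi₂').symm.mono fun n h => by omega
    · exact (E.right_mid hj₂ (by omega)).symm.mono fun n h => by omega
    · exact .refl hu

/-- Only the middle vertex may lack a spare link, and only to vertices of `S`. -/
theorem fresh_spare (E : OddEar G S S' c c' P Q x (k + 1) 0 (k + 1) t) (hv : Valid G c S v k)
    (u w : V) (hu : u ∈ S') (hw : w ∈ S') :
    SpareLink G c' S' (k + 1 + t) u w ∨ (u = x ∧ w ∈ S) ∨ (w = x ∧ u ∈ S) := by
  have lr : ∀ i j, i ≤ t → 1 ≤ j → j ≤ t → SpareLink G c' S' (k + 1 + t) (P i) (Q j) := by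
    intro i j hi hj hj'
    rcases Nat.lt_or_ge i j with h | h
    · exact ⟨k + 1, by omega, (E.around_all hv h hj').mono fun n h => by omega⟩
    · exact ⟨k + 1 + j, by omega, (E.across_all h hj hi).mono fun n h => by omega⟩
  have hk : k + 1 ≤ k + 1 + t := by omega
  have h0 : 0 ≤ k + 1 + t := by omega
  rcases E.cover u hu with hu | ⟨i, hi, hi', rfl⟩ | ⟨j, hj, hj', rfl⟩ | rfl <;>
  rcases E.cover w hw with hw | ⟨i₂, hi₂, hi₂', rfl⟩ | ⟨j₂, hj₂, hj₂', rfl⟩ | rfl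
  · exact Or.inl ⟨k + 1, hk, (E.old _ _ _ (hv.all u hu w hw)).mono fun n h => by omega⟩
  · exact Or.inl ⟨k + 1, hk, (E.left_all hv hi₂' hu).symm.mono fun n h => by omega⟩
  · exact Or.inl ⟨k + 1, hk, (E.right_all hv hj₂ (by omega) hu).symm.mono fun n h => by omega⟩
  · exact Or.inr (Or.inr ⟨rfl, hu⟩)
  · exact Or.inl ⟨k + 1, hk, (E.left_all hv hi' hw).mono fun n h => by omega⟩
  · exact Or.inl ⟨0, h0, (E.left_left hi' hi₂').mono fun n h => by omega⟩
  · exact Or.inl (lr _ _ hi' hj₂ hj₂')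
  · exact Or.inl ⟨0, h0, (E.left_mid hi').mono fun n h => by omega⟩
  · exact Or.inl ⟨k + 1, hk, (E.right_all hv hj (by omega) hw).mono fun n h => by omega⟩
  · exact Or.inl (lr _ _ hi₂' hj hj').symm
  · exact Or.inl ⟨0, h0, (E.right_right hj hj₂ (by omega) (by omega)).mono fun n h => by omega⟩
  · exact Or.inl ⟨k + 1, hk, (E.right_mid hj (by omega)).mono fun n h => by omega⟩
  · exact Or.inr (Or.inl ⟨rfl, hw⟩)
  · exact Or.inl ⟨0, h0, (E.left_mid hi₂').symm.mono fun n h => by omega⟩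
  · exact Or.inl ⟨k + 1, hk, (E.right_mid hj₂ (by omega)).symm.mono fun n h => by omega⟩
  · exact Or.inl ⟨0, h0, .refl hu⟩

theorem fresh_spare_mid (E : OddEar G S S' c c' P Q x (k + 1) 0 (k + 1) t)
    (h : SpareLink G c S k (P 0) w) : SpareLink G c' S' (k + 1 + t) x w := by
  obtain ⟨y, hy, h⟩ := h
  exact ⟨y, by omega, (E.mid_old_left h (fun n h => by omega) (by omega)).mono fun n h => by omega⟩

theorem fresh_attachable_old (E : OddEar G S S' c c' P Q x (k + 1) 0 (k + 1) t)
    (hv : Valid G c S v k) {e e' : V} (he' : e' ∈ S)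
    (h : SpareLink G c S k (P 0) e) : Attachable G c' S' v (k + 1 + t) e e' := by
  obtain ⟨y, hy, h⟩ := h
  refine ⟨y, k + 1, by omega, by omega, by omega, ?_, Or.inr ⟨by omega,
    (E.old _ _ _ (hv.root e' he')).mono fun n h => by omega⟩⟩
  intro u hu
  rcases E.cover u hu with hu | ⟨l, hl, hl', rfl⟩ | ⟨l, hl, hl', rfl⟩ | rfl
  · exact Or.inr ((E.old _ _ _ (hv.all u hu e' he')).mono fun n h => by omega)
  · exact Or.inr ((E.left_all hv hl' he').mono fun n h => by omega)
  · exact Or.inr ((E.right_all hv hl (by omega) he').mono fun n h => by omega)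
  · exact Or.inl ((E.mid_old_left h (fun n h => by omega) (by omega)).mono fun n h => by omega)

/-- Attaching to a vertex of the ear needs no assumption: colour `k + 1` is needed only near the
middle vertex. -/
theorem fresh_attachable_new (E : OddEar G S S' c c' P Q x (k + 1) 0 (k + 1) t)
    (hv : Valid G c S v k) {e e' : V} (he : e ∈ S') (he' : e' ∈ S') (hne : e ≠ e')
    (hS : ¬ (e ∈ S ∧ e' ∈ S)) : Attachable G c' S' v (k + 1 + t) e e' := by
  have ht := E.one_le
  have hx : x ∈ S' := E.mid_right.left_mem
  -- the root reaches `S` and the arms without the colours `0` and `k + 1`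
  have root : ∀ w ∈ S, RainbowLink G c' S' v w (fun n => 0 < n ∧ n ≤ k + 1 + t ∧ n ≠ k + 1) :=
    fun w hw => (E.old _ _ _ (hv.root w hw)).mono fun n h => by omega
  have root_left : ∀ i, i ≤ t →
      RainbowLink G c' S' v (P i) (fun n => 0 < n ∧ n ≤ k + 1 + t ∧ n ≠ k + 1) :=
    fun i hi => (E.left_old hi (hv.root _ E.left_mem).symm (fun n h => by omega)
        (fun n h => by omega) (fun n h h' => by omega)).symm
  have root_right : ∀ j, 1 ≤ j → j ≤ t →
      RainbowLink G c' S' v (Q j) (fun n => 0 < n ∧ n ≤ k + 1 + t ∧ n ≠ k + 1) :=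
    fun j hj hj' => (E.right_old hj (by omega) (hv.root _ E.right_mem).symm (fun n h => by omega)
        (fun n h => by omega) (fun n h h' => by omega)).symm
  have mid_old : ∀ w ∈ S, Attachable G c' S' v (k + 1 + t) x w := by
    intro w hw
    refine ⟨0, k + 1, by omega, by omega, by omega, ?_, Or.inr ⟨by omega, root w hw⟩⟩
    intro u hu
    rcases E.cover u hu with hu | ⟨l, hl, hl', rfl⟩ | ⟨l, hl, hl', rfl⟩ | rfl
    · exact Or.inr ((E.old _ _ _ (hv.all u hu w hw)).mono fun n h => by omega)
    · exact Or.inr ((E.left_all hv hl' hw).mono fun n h => by omega)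
    · exact Or.inr ((E.right_all hv hl (by omega) hw).mono fun n h => by omega)
    · exact Or.inl (.refl hu)
  have mid_left : ∀ i, 1 ≤ i → i ≤ t → Attachable G c' S' v (k + 1 + t) x (P i) := by
    intro i hi hi'
    refine ⟨k + 1 + t, k + 1, by omega, by omega, by omega, ?_,
      Or.inr ⟨by omega, root_left i hi'⟩⟩
    intro u hu
    rcases E.cover u hu with hu | ⟨l, hl, hl', rfl⟩ | ⟨l, hl, hl', rfl⟩ | rfl
    · exact Or.inr ((E.left_all hv hi' hu).symm.mono fun n h => by omega)
    · exact Or.inr ((E.left_left hl' hi').mono fun n h => by omega)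
    · exact Or.inl ((E.right_mid hl (by omega)).mono fun n h => by omega)
    · exact Or.inl (.refl hu)
  have mid_right : ∀ j, 1 ≤ j → j ≤ t → Attachable G c' S' v (k + 1 + t) x (Q j) := by
    intro j hj hj'
    refine ⟨k + 1 + 1, k + 1, by omega, by omega, by omega, ?_,
      Or.inr ⟨by omega, root_right j hj hj'⟩⟩
    intro u hu
    rcases E.cover u hu with hu | ⟨l, hl, hl', rfl⟩ | ⟨l, hl, hl', rfl⟩ | rfl
    · exact Or.inr ((E.right_all hv hj (by omega) hu).symm.mono fun n h => by omega)
    · exact Or.inl ((E.left_mid hl').mono fun n h => by omega)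
    · exact Or.inr ((E.right_right hl hj (by omega) (by omega)).mono fun n h => by omega)
    · exact Or.inl (.refl hu)
  have left_old : ∀ i, 1 ≤ i → i ≤ t → ∀ w ∈ S, Attachable G c' S' v (k + 1 + t) (P i) w := by
    intro i hi hi' w hw
    refine ⟨0, k + 1, by omega, by omega, by omega, ?_, Or.inr ⟨by omega, root w hw⟩⟩
    intro u hu
    rcases E.cover u hu with hu | ⟨l, hl, hl', rfl⟩ | ⟨l, hl, hl', rfl⟩ | rfl
    · exact Or.inr ((E.old _ _ _ (hv.all u hu w hw)).mono fun n h => by omega)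
    · exact Or.inr ((E.left_all hv hl' hw).mono fun n h => by omega)
    · exact Or.inr ((E.right_all hv hl (by omega) hw).mono fun n h => by omega)
    · exact Or.inl ((E.left_mid hi').symm.mono fun n h => by omega)
  have right_old : ∀ j, 1 ≤ j → j ≤ t → ∀ w ∈ S, Attachable G c' S' v (k + 1 + t) (Q j) w := by
    intro j hj hj' w hw
    refine ⟨k + 1 + t, k + 1, by omega, by omega, by omega, ?_, Or.inr ⟨by omega, root w hw⟩⟩
    intro u hu
    rcases E.cover u hu with hu | ⟨l, hl, hl', rfl⟩ | ⟨l, hl, hl', rfl⟩ | rfl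
    · exact Or.inr ((E.old _ _ _ (hv.all u hu w hw)).mono fun n h => by omega)
    · exact Or.inr ((E.left_all hv hl' hw).mono fun n h => by omega)
    · exact Or.inr ((E.right_all hv hl (by omega) hw).mono fun n h => by omega)
    · exact Or.inl ((E.right_mid hj (by omega)).symm.mono fun n h => by omega)
  have left_left : ∀ i j, 1 ≤ i → i < j → j ≤ t →
      Attachable G c' S' v (k + 1 + t) (P i) (P j) := by
    intro i j hi hij hj
    refine ⟨k + 1, k + 1 + j, by omega, by omega, by omega, ?_,
      Or.inl ⟨by omega, root_left i (by omega)⟩⟩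
    intro u hu
    rcases E.cover u hu with hu | ⟨l, hl, hl', rfl⟩ | ⟨l, hl, hl', rfl⟩ | rfl
    · exact Or.inl ((E.left_all hv (by omega) hu).symm.mono fun n h => by omega)
    · exact Or.inl ((E.left_left hl' (by omega)).mono fun n h => by omega)
    · rcases Nat.lt_or_ge j l with h | h
      · exact Or.inl ((E.around_all hv (by omega) hl').symm.mono fun n h => by omega)
      · exact Or.inr ((E.across_all h hl hj).symm.mono fun n h => by omega)
    · exact Or.inr ((E.left_mid hj).symm.mono fun n h => by omega)
  have right_right : ∀ i j, 1 ≤ i → i < j → j ≤ t →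
      Attachable G c' S' v (k + 1 + t) (Q i) (Q j) := by
    intro i j hi hij hj
    refine ⟨k + 1 + i, k + 1, by omega, by omega, by omega, ?_,
      Or.inr ⟨by omega, root_right j (by omega) hj⟩⟩
    intro u hu
    rcases E.cover u hu with hu | ⟨l, hl, hl', rfl⟩ | ⟨l, hl, hl', rfl⟩ | rfl
    · exact Or.inr ((E.right_all hv (by omega) (by omega) hu).symm.mono fun n h => by omega)
    · rcases Nat.lt_or_ge l j with h | h
      · exact Or.inr ((E.around_all hv h hj).mono fun n h => by omega)
      · exact Or.inl ((E.across_all (by omega) hi hl').mono fun n h => by omega)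
    · exact Or.inr ((E.right_right hl (by omega) (by omega) (by omega)).mono fun n h => by omega)
    · exact Or.inl ((E.right_mid hi (by omega)).symm.mono fun n h => by omega)
  have left_right : ∀ i j, 1 ≤ i → i ≤ t → 1 ≤ j → j ≤ t →
      Attachable G c' S' v (k + 1 + t) (P i) (Q j) := by
    intro i j hi hi' hj hj'
    refine ⟨k + 1, k + 1 + t, by omega, by omega, by omega, ?_,
      Or.inl ⟨by omega, root_left i hi'⟩⟩
    intro u hu
    rcases E.cover u hu with hu | ⟨l, hl, hl', rfl⟩ | ⟨l, hl, hl', rfl⟩ | rfl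
    · exact Or.inl ((E.left_all hv hi' hu).symm.mono fun n h => by omega)
    · exact Or.inl ((E.left_left hl' hi').mono fun n h => by omega)
    · exact Or.inr ((E.right_right hl hj (by omega) (by omega)).mono fun n h => by omega)
    · exact Or.inr ((E.right_mid hj (by omega)).symm.mono fun n h => by omega)
  rcases E.cover e he with he | ⟨i, hi, hi', rfl⟩ | ⟨i, hi, hi', rfl⟩ | rfl <;>
  rcases E.cover e' he' with he' | ⟨j, hj, hj', rfl⟩ | ⟨j, hj, hj', rfl⟩ | rfl
  · exact absurd ⟨he, he'⟩ hS
  · exact (left_old j hj hj' e he).symm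
  · exact (right_old j hj hj' e he).symm
  · exact (mid_old e he).symm
  · exact left_old i hi hi' e' he'
  · rcases lt_trichotomy i j with h' | rfl | h'
    exacts [left_left i j hi h' hj', absurd rfl hne, (left_left j i hj h' hi').symm]
  · exact left_right i j hi hi' hj hj'
  · exact (mid_left i hi hi').symm
  · exact right_old i hi hi' e' he'
  · exact (left_right j i hj hj' hi hi').symm
  · rcases lt_trichotomy i j with h' | rfl | h'
    exacts [right_right i j hi h' hj', absurd rfl hne, (right_right j i hj h' hi').symm]
  · exact (mid_right i hi hi').symm
  · exact mid_old e' he'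
  · exact mid_left j hj hj'
  · exact mid_right j hj hj'
  · exact absurd rfl hne

end Fresh

end OddEar

theorem addEar_reverse (S : Set V) (p : ℕ → V) (m : ℕ) :
    addEar S (fun i => p (m + 1 - i)) m = addEar S p m := by
  ext x
  constructor
  · rintro (h | ⟨i, h1, h2, rfl⟩)
    exacts [Or.inl h, Or.inr ⟨m + 1 - i, by omega, by omega, rfl⟩]
  · rintro (h | ⟨i, h1, h2, rfl⟩)
    exacts [Or.inl h, Or.inr ⟨m + 1 - i, by omega, by omega, by beta_reduce; congr 1; omega⟩]

namespace OddEar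

variable {S S' : Set V} {c c' : Sym2 V → ℕ} {P Q : ℕ → V} {x v : V} {μ ν k t : ℕ}
  {a b c₁ c₂ : V}

theorem fresh_spareAmong (E : OddEar G S S' c c' P Q x (k + 1) 0 (k + 1) t) (hv : Valid G c S v k)
    (ha : a ∈ S') (hb : b ∈ S') (hc₁ : c₁ ∈ S') (hc₂ : c₂ ∈ S') (hcc : c₁ ≠ c₂)
    (h : a ≠ x ∨ b ≠ x) : SpareAmong G c' S' (k + 1 + t) a b c₁ c₂ := by
  have key : ∀ u ∈ S', ∀ w ∈ S', u ≠ x → w ≠ x → SpareLink G c' S' (k + 1 + t) u w := by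
    intro u hu w hw hu' hw'
    rcases E.fresh_spare hv u w hu hw with h | h | h
    exacts [h, absurd h.1 hu', absurd h.1 hw']
  have hc : c₁ ≠ x ∨ c₂ ≠ x := by
    by_contra hno
    rw [not_or, not_not, not_not] at hno
    exact hcc (hno.1.trans hno.2.symm)
  rcases h with h | h <;> rcases hc with h' | h'
  exacts [Or.inl (key _ ha _ hc₁ h h'), Or.inr (Or.inl (key _ ha _ hc₂ h h')),
    Or.inr (Or.inr (Or.inl (key _ hb _ hc₁ h h'))), Or.inr (Or.inr (Or.inr (key _ hb _ hc₂ h h')))]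

end OddEar

/-- The middle vertex takes one further new colour `k + 1`. This colour is rarely used, so a later
vertex adjacent to two vertices prescribed in advance can reuse it on one of its edges. -/
theorem OddState.addEar_odd [Finite V] {S T : Set V} {p : ℕ → V} {t k : ℕ} {v : V}
    (hS : OddState G S v k) (h : IsEar G S T p (2 * t + 1)) :
    EvenState G (addEar S p (2 * t + 1)) v (k + 1 + t) := by
  have ht : 1 ≤ t := by have := h.two_le; omega
  refine ⟨by rw [h.ncard_addEar, hS.1]; omega, by omega, ?_⟩
  set S' := addEar S p (2 * t + 1) with hS'
  -- up to reversal, the left end of the ear has a spare link to one of two given vertices of `S`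
  have main : ∀ y ∈ S, ∀ z ∈ S, ∃ (p' : ℕ → V) (c c' : Sym2 V → ℕ), Valid G c S v k ∧
      OddEar G S S' c c' p' (fun j => p' (t + 1 + j)) (p (t + 1)) (k + 1) 0 (k + 1) t ∧
      (y ≠ z → SpareLink G c S k (p' 0) y ∨ SpareLink G c S k (p' 0) z) := by
    intro y hy z hz
    obtain ⟨c, hc, hsp⟩ := hS.2 _ h.left_mem _ h.right_mem y hy z hz
    by_cases hsl : SpareLink G c S k (p 0) y ∨ SpareLink G c S k (p 0) z
    · obtain ⟨c', E⟩ := h.exists_oddEar c (μ := k + 1) (ν := 0) (k := k + 1) (by omega) le_rfl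
        (by omega)
      exact ⟨p, c, c', hc, E, fun _ => hsl⟩
    · obtain ⟨c', E⟩ := h.reverse.exists_oddEar c (μ := k + 1) (ν := 0) (k := k + 1) (by omega)
        le_rfl (by omega)
      rw [addEar_reverse, ← hS'] at E
      have hx : 2 * t + 1 + 1 - (t + 1) = t + 1 := by omega
      simp only [hx] at E
      refine ⟨_, c, c', hc, E, fun hyz => ?_⟩
      rw [not_or] at hsl
      have := hsp (h.ne_of_ne hy hz hyz) hyz
      simp only [SpareAmong, hsl, false_or] at this
      exact this
  intro e he e' he' a ha b hb c₁ hc₁ c₂ hc₂ hee haa hcc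
  by_cases hes : e ∈ S ∧ e' ∈ S
  · obtain ⟨p', c, c', hc, E, hsp⟩ := main e hes.1 e' hes.2
    refine ⟨c', E.fresh_valid hc, ?_, E.fresh_spareAmong hc ha hb hc₁ hc₂ hcc ?_⟩
    · rcases hsp hee with h | h
      exacts [E.fresh_attachable_old hc hes.2 h, (E.fresh_attachable_old hc hes.1 h).symm]
    · by_contra hno
      rw [not_or, not_not, not_not] at hno
      rcases haa with h | h | h
      · exact h (hno.1.trans hno.2.symm)
      · exact E.notMem (by rw [← hno.1, h]; exact hes.1)
      · exact E.notMem (by rw [← hno.1, h]; exact hes.2)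
  · by_cases hab : a ≠ p (t + 1) ∨ b ≠ p (t + 1)
    · obtain ⟨p', c, c', hc, E, -⟩ := main _ h.left_mem _ h.left_mem
      exact ⟨c', E.fresh_valid hc, E.fresh_attachable_new hc he he' hee hes,
        E.fresh_spareAmong hc ha hb hc₁ hc₂ hcc hab⟩
    · rw [not_or, not_not, not_not] at hab
      obtain ⟨rfl, -⟩ := hab
      by_cases hcs : c₁ ∈ S ∧ c₂ ∈ S
      · obtain ⟨p', c, c', hc, E, hsp⟩ := main _ hcs.1 _ hcs.2
        refine ⟨c', E.fresh_valid hc, E.fresh_attachable_new hc he he' hee hes, ?_⟩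
        rcases hsp hcc with h | h
        exacts [Or.inl (E.fresh_spare_mid h), Or.inr (Or.inl (E.fresh_spare_mid h))]
      · obtain ⟨p', c, c', hc, E, -⟩ := main _ h.left_mem _ h.left_mem
        refine ⟨c', E.fresh_valid hc, E.fresh_attachable_new hc he he' hee hes, ?_⟩
        have key : ∀ w ∈ S', w ∉ S → SpareLink G c' S' (k + 1 + t) (p (t + 1)) w := by
          intro w hw hw'
          rcases E.fresh_spare hc _ w ha hw with h | h | h
          exacts [h, absurd h.2 hw', absurd h.2 E.notMem]
        rcases not_and_or.1 hcs with h' | h'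
        exacts [Or.inl (key _ hc₁ h'), Or.inr (Or.inl (key _ hc₂ h'))]

namespace OddEar

variable {S S' : Set V} {c c' : Sym2 V → ℕ} {P Q : ℕ → V} {x v : V} {f g k t : ℕ}
  {a b c₁ c₂ : V}

/- In this section the middle colours `f, g` come from attaching the middle vertex to the two ends
of the ear. -/

theorem reuse_valid (E : OddEar G S S' c c' P Q x f g k t) (hv : Valid G c S v k)
    (h1 : ∀ u ∈ S, RainbowLink G c S u (P 0) (fun n => n ≤ k ∧ n ≠ f) ∨
      RainbowLink G c S u (Q (t + 1)) (fun n => n ≤ k ∧ n ≠ g))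
    (h2 : f ≠ 0 ∧ RainbowLink G c S v (P 0) (fun n => 0 < n ∧ n ≤ k ∧ n ≠ f) ∨
      g ≠ 0 ∧ RainbowLink G c S v (Q (t + 1)) (fun n => 0 < n ∧ n ≤ k ∧ n ≠ g)) :
    Valid G c' S' v (k + t) where
  mem := (E.old _ _ _ (hv.root _ hv.mem)).left_mem
  root u hu := by
    have hf := E.left_le
    have hg := E.right_le
    rcases E.cover u hu with hu | ⟨i, hi, hi', rfl⟩ | ⟨j, hj, hj', rfl⟩ | rfl
    · exact (E.old _ _ _ (hv.root u hu)).mono fun n h => by omega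
    · exact (E.left_old hi' (hv.root _ E.left_mem).symm (fun n h => by omega)
        (fun n h => by omega) (fun n h h' => by omega)).symm
    · exact (E.right_old hj (by omega) (hv.root _ E.right_mem).symm (fun n h => by omega)
        (fun n h => by omega) (fun n h h' => by omega)).symm
    · rcases h2 with ⟨h0, h⟩ | ⟨h0, h⟩
      · exact (E.mid_old_left h.symm (fun n h => by omega) (by omega)).symm.mono
          fun n h => by omega
      · exact (E.mid_old_right h.symm (fun n h => by omega) (by omega)).symm.mono
          fun n h => by omega
  all u hu w hw := by
    have hf := E.left_le
    have hg := E.right_le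
    have left_all : ∀ i, i ≤ t → ∀ w ∈ S, RainbowLink G c' S' (P i) w (fun n => n ≤ k + t) :=
      fun i hi w hw => E.left_old hi (hv.all _ E.left_mem _ hw) (fun n h => h)
        (fun n h => by omega) (fun n h h' => by omega)
    have right_all : ∀ j, 1 ≤ j → j ≤ t → ∀ w ∈ S,
        RainbowLink G c' S' (Q j) w (fun n => n ≤ k + t) :=
      fun j hj hj' w hw => E.right_old hj (by omega) (hv.all _ E.right_mem _ hw) (fun n h => h)
        (fun n h => by omega) (fun n h h' => by omega)
    have lr : ∀ i j, i ≤ t → 1 ≤ j → j ≤ t →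
        RainbowLink G c' S' (P i) (Q j) (fun n => n ≤ k + t) := by
      intro i j hi hj hj'
      rcases Nat.lt_or_ge i j with h | h
      · exact E.around h (by omega) (hv.all _ E.left_mem _ E.right_mem) (fun n h => h)
          (fun n h => by omega) (fun n h h' => by omega) (fun n h h' => by omega)
      · exact E.across hi hj (by omega) E.mid (fun n h => by omega) (fun n h => by omega)
          (fun n h h' => by omega) (fun n h h' => by omega)
    have old_mid : ∀ u ∈ S, RainbowLink G c' S' x u (fun n => n ≤ k + t) := by
      intro u hu
      rcases h1 u hu with h | h
      · exact (E.mid_old_left h.symm (fun n h => by omega) (by omega)).mono fun n h => by omega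
      · exact (E.mid_old_right h.symm (fun n h => by omega) (by omega)).mono fun n h => by omega
    rcases E.cover u hu with hu | ⟨i, hi, hi', rfl⟩ | ⟨j, hj, hj', rfl⟩ | rfl <;>
    rcases E.cover w hw with hw | ⟨i₂, hi₂, hi₂', rfl⟩ | ⟨j₂, hj₂, hj₂', rfl⟩ | rfl
    · exact (E.old _ _ _ (hv.all u hu w hw)).mono fun n h => by omega
    · exact (left_all _ hi₂' _ hu).symm
    · exact (right_all _ hj₂ hj₂' _ hu).symm
    · exact (old_mid u hu).symm
    · exact left_all _ hi' _ hw
    · exact (E.left_left hi' hi₂').mono fun n h => by omega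
    · exact lr _ _ hi' hj₂ hj₂'
    · exact (E.left_mid hi').mono fun n h => by omega
    · exact right_all _ hj hj' _ hw
    · exact (lr _ _ hi₂' hj hj').symm
    · exact (E.right_right hj hj₂ (by omega) (by omega)).mono fun n h => by omega
    · exact (E.right_mid hj (by omega)).mono fun n h => by omega
    · exact old_mid w hw
    · exact (E.left_mid hi₂').symm.mono fun n h => by omega
    · exact (E.right_mid hj₂ (by omega)).symm.mono fun n h => by omega
    · exact .refl hu

/-- Only the middle vertex and its two neighbours may lack a spare link, and only to vertices
of `S`. -/
theorem reuse_spare (E : OddEar G S S' c c' P Q x f g k t) (hv : Valid G c S v k) (hk : 2 ≤ k)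
    (u w : V) (hu : u ∈ S') (hw : w ∈ S') :
    SpareLink G c' S' (k + t) u w ∨ ((u = P t ∨ u = Q 1 ∨ u = x) ∧ w ∈ S) ∨
      ((w = P t ∨ w = Q 1 ∨ w = x) ∧ u ∈ S) := by
  have ht := E.one_le
  obtain ⟨y, hy, hyf, hyg⟩ : ∃ y, y ≤ 2 ∧ y ≠ f ∧ y ≠ g := by
    by_contra hno
    push Not at hno
    have h0 := hno 0
    have h1 := hno 1
    have h2 := hno 2
    omega
  have left_all : ∀ i, i ≤ t → ∀ w ∈ S, SpareLink G c' S' (k + t) (P i) w ∨ P i = P t := by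
    intro i hi w hw
    rcases eq_or_ne i t with rfl | h
    · exact Or.inr rfl
    · exact Or.inl ⟨k + t, by omega, E.left_old hi (hv.all _ E.left_mem _ hw) (fun n h => h)
        (fun n h => by omega) (fun n h h' => by omega)⟩
  have right_all : ∀ j, 1 ≤ j → j ≤ t → ∀ w ∈ S,
      SpareLink G c' S' (k + t) (Q j) w ∨ Q j = Q 1 := by
    intro j hj hj' w hw
    rcases eq_or_ne j 1 with rfl | h
    · exact Or.inr rfl
    · exact Or.inl ⟨k + 1, by omega, E.right_old hj (by omega) (hv.all _ E.right_mem _ hw)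
        (fun n h => h) (fun n h => by omega) (fun n h h' => by omega)⟩
  have lr : ∀ i j, i ≤ t → 1 ≤ j → j ≤ t → SpareLink G c' S' (k + t) (P i) (Q j) := by
    intro i j hi hj hj'
    rcases Nat.lt_or_ge (i + 1) j with h | h
    · exact ⟨k + (i + 1), by omega, E.around (by omega) (by omega)
        (hv.all _ E.left_mem _ E.right_mem) (fun n h => h)
        (fun n h => by omega) (fun n h h' => by omega) (fun n h h' => by omega)⟩
    · have hf := E.left_le
      have hg := E.right_le
      exact ⟨y, by omega, E.across hi hj (by omega) E.mid (fun n h => by omega)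
        (fun n h => by omega) (fun n h h' => by omega) (fun n h h' => by omega)⟩
  have left_mid : ∀ i, i ≤ t → SpareLink G c' S' (k + t) (P i) x := fun i hi =>
    ⟨y, by omega, (E.left_mid hi).mono fun n h => by have := E.left_le; omega⟩
  have right_mid : ∀ j, 1 ≤ j → j ≤ t → SpareLink G c' S' (k + t) (Q j) x := fun j hj hj' =>
    ⟨y, by omega, (E.right_mid hj (by omega)).mono fun n h => by have := E.right_le; omega⟩
  rcases E.cover u hu with hu | ⟨i, hi, hi', rfl⟩ | ⟨j, hj, hj', rfl⟩ | rfl <;>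
  rcases E.cover w hw with hw | ⟨i₂, hi₂, hi₂', rfl⟩ | ⟨j₂, hj₂, hj₂', rfl⟩ | rfl
  · exact Or.inl ⟨k + t, le_rfl, (E.old _ _ _ (hv.all u hu w hw)).mono fun n h => by omega⟩
  · exact (left_all _ hi₂' _ hu).imp (fun h => h.symm) fun h => Or.inr ⟨Or.inl h, hu⟩
  · exact (right_all _ hj₂ hj₂' _ hu).imp (fun h => h.symm) fun h => Or.inr ⟨Or.inr (Or.inl h), hu⟩
  · exact Or.inr (Or.inr ⟨Or.inr (Or.inr rfl), hu⟩)
  · exact (left_all _ hi' _ hw).imp id fun h => Or.inl ⟨Or.inl h, hw⟩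
  · exact Or.inl ⟨0, by omega, (E.left_left hi' hi₂').mono fun n h => by omega⟩
  · exact Or.inl (lr _ _ hi' hj₂ hj₂')
  · exact Or.inl (left_mid _ hi')
  · exact (right_all _ hj hj' _ hw).imp id fun h => Or.inl ⟨Or.inr (Or.inl h), hw⟩
  · exact Or.inl (lr _ _ hi₂' hj hj').symm
  · exact Or.inl ⟨0, by omega,
      (E.right_right hj hj₂ (by omega) (by omega)).mono fun n h => by omega⟩
  · exact Or.inl (right_mid _ hj hj')
  · exact Or.inr (Or.inl ⟨Or.inr (Or.inr rfl), hw⟩)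
  · exact Or.inl (left_mid _ hi₂').symm
  · exact Or.inl (right_mid _ hj₂ hj₂').symm
  · exact Or.inl ⟨0, by omega, .refl hu⟩

theorem reuse_spare_left (E : OddEar G S S' c c' P Q x f g k t) {w : V}
    (h : SpareLink G c S k (P 0) w) : SpareLink G c' S' (k + t) (P t) w := by
  obtain ⟨y, hy, h⟩ := h
  exact ⟨y, by omega, E.left_old le_rfl h (fun n h => h.1) (fun n h => by omega)
    (fun n h h' => by omega)⟩

theorem reuse_spare_right (E : OddEar G S S' c c' P Q x f g k t) {w : V}
    (h : SpareLink G c S k (Q (t + 1)) w) : SpareLink G c' S' (k + t) (Q 1) w := by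
  obtain ⟨y, hy, h⟩ := h
  exact ⟨y, by omega, E.right_old le_rfl (by have := E.one_le; omega) h (fun n h => h.1)
    (fun n h => by omega) (fun n h h' => by omega)⟩

end OddEar

/-- The middle vertex is attached to both arms with the old colours `f` and `g` that attachability of
the two ends of the ear provides, so no colour beyond those of the arms is needed. -/
theorem EvenState.addEar_odd [Finite V] {S T : Set V} {p : ℕ → V} {t k : ℕ} {v : V}
    (hS : EvenState G S v k) (h : IsEar G S T p (2 * t + 1)) :
    OddState G (addEar S p (2 * t + 1)) v (k + t) := by
  have ht : 1 ≤ t := by have := h.two_le; omega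
  obtain ⟨hcard, hk, hS⟩ := hS
  refine ⟨by rw [h.ncard_addEar, hcard]; omega, ?_⟩
  set S' := addEar S p (2 * t + 1) with hS'
  have hr : p (t + 1 + (t + 1)) = p (2 * t + 1 + 1) := by congr 1; omega
  have hl := h.left_mem
  have hr' : p (t + 1 + (t + 1)) ∈ S := hr ▸ h.right_mem
  have hlr : p 0 ≠ p (t + 1 + (t + 1)) := by
    obtain ⟨x, hx, y, hy, hxy⟩ := (Set.one_lt_ncard (s := S)).1 (by omega)
    rw [hr]
    exact h.ne_of_ne hx hy hxy
  have main : ∀ a ∈ S, ∀ b ∈ S, ∀ y ∈ S, ∀ z ∈ S, (a ≠ b ∨ a = p 0 ∨ a = p (t + 1 + (t + 1))) →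
      y ≠ z → ∃ (f g : ℕ) (c c' : Sym2 V → ℕ), Valid G c S v k ∧ Valid G c' S' v (k + t) ∧
        OddEar G S S' c c' p (fun j => p (t + 1 + j)) (p (t + 1)) f g k t ∧
        SpareAmong G c S k a b y z := by
    intro a ha b hb y hy z hz hab hyz
    obtain ⟨c, hc, ⟨f, g, hf, hg, hfg, h1, h2⟩, hsp⟩ :=
      hS _ hl _ hr' a ha b hb y hy z hz hlr hab hyz
    obtain ⟨c', E⟩ := h.exists_oddEar c hfg hf hg
    exact ⟨f, g, c, c', hc, E.reuse_valid hc h1 h2, E, hsp⟩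
  have notMem : ∀ y, y = p t ∨ y = p (t + 1 + 1) ∨ y = p (t + 1) → y ∉ S := by
    rintro y (rfl | rfl | rfl) <;> exact h.notMem _ (by omega) (by omega)
  -- a pair of middle vertices against a pair in `S`
  have middle : ∀ a b y z, (a = p t ∨ a = p (t + 1 + 1) ∨ a = p (t + 1)) →
      (b = p t ∨ b = p (t + 1 + 1) ∨ b = p (t + 1)) → y ∈ S → z ∈ S → a ≠ b → y ≠ z →
      ∃ c', Valid G c' S' v (k + t) ∧ SpareAmong G c' S' (k + t) a b y z := by
    intro a b y z ha hb hy hz hab hyz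
    by_cases hP : a = p t ∨ b = p t
    · obtain ⟨f, g, c, c', hc, hc', E, hsp⟩ :=
        main _ hl _ hl _ hy _ hz (Or.inr (Or.inl rfl)) hyz
      refine ⟨c', hc', ?_⟩
      have hsp : SpareLink G c' S' (k + t) (p t) y ∨ SpareLink G c' S' (k + t) (p t) z := by
        rcases hsp with h | h | h | h
        exacts [Or.inl (E.reuse_spare_left h), Or.inr (E.reuse_spare_left h),
          Or.inl (E.reuse_spare_left h), Or.inr (E.reuse_spare_left h)]
      rcases hP with rfl | rfl
      · exact hsp.imp id Or.inl
      · exact Or.inr (Or.inr hsp)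
    · have hQ : a = p (t + 1 + 1) ∨ b = p (t + 1 + 1) := by
        rw [not_or] at hP
        by_contra hno
        rw [not_or] at hno
        exact hab (((ha.resolve_left hP.1).resolve_left hno.1).trans
          ((hb.resolve_left hP.2).resolve_left hno.2).symm)
      obtain ⟨f, g, c, c', hc, hc', E, hsp⟩ :=
        main _ hr' _ hr' _ hy _ hz (Or.inr (Or.inr rfl)) hyz
      refine ⟨c', hc', ?_⟩
      have hsp : SpareLink G c' S' (k + t) (p (t + 1 + 1)) y ∨
          SpareLink G c' S' (k + t) (p (t + 1 + 1)) z := by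
        rcases hsp with h | h | h | h
        exacts [Or.inl (E.reuse_spare_right h), Or.inr (E.reuse_spare_right h),
          Or.inl (E.reuse_spare_right h), Or.inr (E.reuse_spare_right h)]
      rcases hQ with rfl | rfl
      · exact hsp.imp id Or.inl
      · exact Or.inr (Or.inr hsp)
  obtain ⟨f, g, c, c', hc, hc', E, -⟩ := main _ hl _ hr' _ hl _ hr' (Or.inl hlr) hlr
  have default : ∀ u ∈ S', ∀ w ∈ S', SpareLink G c' S' (k + t) u w ∨
      ((u = p t ∨ u = p (t + 1 + 1) ∨ u = p (t + 1)) ∧ w ∈ S) ∨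
      ((w = p t ∨ w = p (t + 1 + 1) ∨ w = p (t + 1)) ∧ u ∈ S) :=
    fun u hu w hw => E.reuse_spare hc hk u w hu hw
  intro a ha b hb c₁ hc₁ c₂ hc₂
  by_cases hne : a ≠ b ∧ c₁ ≠ c₂
  swap
  · exact ⟨c', hc', fun h1 h2 => absurd ⟨h1, h2⟩ hne⟩
  by_cases h1 : (a = p t ∨ a = p (t + 1 + 1) ∨ a = p (t + 1)) ∧
      (b = p t ∨ b = p (t + 1 + 1) ∨ b = p (t + 1)) ∧ c₁ ∈ S ∧ c₂ ∈ S
  · obtain ⟨c'', hv, hsp⟩ := middle a b c₁ c₂ h1.1 h1.2.1 h1.2.2.1 h1.2.2.2 hne.1 hne.2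
    exact ⟨c'', hv, fun _ _ => hsp⟩
  by_cases h2 : (c₁ = p t ∨ c₁ = p (t + 1 + 1) ∨ c₁ = p (t + 1)) ∧
      (c₂ = p t ∨ c₂ = p (t + 1 + 1) ∨ c₂ = p (t + 1)) ∧ a ∈ S ∧ b ∈ S
  · obtain ⟨c'', hv, hsp⟩ := middle c₁ c₂ a b h2.1 h2.2.1 h2.2.2.1 h2.2.2.2 hne.2 hne.1
    exact ⟨c'', hv, fun _ _ => hsp.symm⟩
  refine ⟨c', hc', fun _ _ => ?_⟩
  by_contra hno
  simp only [SpareAmong, not_or] at hno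
  have k1 := (default a ha c₁ hc₁).resolve_left hno.1
  have k2 := (default a ha c₂ hc₂).resolve_left hno.2.1
  have k3 := (default b hb c₁ hc₁).resolve_left hno.2.2.1
  rcases k1 with k1 | k1
  · have := notMem a k1.1
    have k2 := k2.resolve_right fun h => this h.2
    have k3 := k3.resolve_right fun h => notMem _ h.1 k1.2
    exact h1 ⟨k1.1, k3.1, k1.2, k2.2⟩
  · have := notMem c₁ k1.1
    have k3 := k3.resolve_left fun h => this h.2
    have k2 := k2.resolve_left fun h => notMem _ h.1 k1.2
    exact h2 ⟨k1.1, k2.1, k1.2, k3.2⟩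

/-! ### Attaching the remaining independent vertices -/

theorem Valid.mono {c : Sym2 V → ℕ} {S : Set V} {v : V} {k k' : ℕ} (h : Valid G c S v k)
    (hk : k ≤ k') : Valid G c S v k' where
  mem := h.mem
  root u hu := (h.root u hu).mono fun n h => by omega
  all u hu w hw := (h.all u hu w hw).mono fun n h => by omega

/-- Every vertex `x` of `T \ S` is joined to the vertices `α x`, `β x` of `S` by edges of colour `A x`
and `B x`; inside `S` the colours are those of `c`. -/
structure Attached (G : SimpleGraph V) (S T : Set V) (c c' : Sym2 V → ℕ) (α β : V → V)
    (A B : V → ℕ) : Prop where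
  old : ∀ u w X, RainbowLink G c S u w X → RainbowLink G c' T u w X
  left_mem : ∀ x ∈ T \ S, α x ∈ S
  right_mem : ∀ x ∈ T \ S, β x ∈ S
  left : ∀ x ∈ T \ S, RainbowLink G c' T x (α x) (fun n => n = A x)
  right : ∀ x ∈ T \ S, RainbowLink G c' T x (β x) (fun n => n = B x)

theorem exists_attached {S T : Set V} (hST : S ⊆ T) {α β : V → V}
    (hα : ∀ x ∈ T \ S, α x ∈ S ∧ G.Adj x (α x)) (hβ : ∀ x ∈ T \ S, β x ∈ S ∧ G.Adj x (β x))
    (hαβ : ∀ x ∈ T \ S, α x ≠ β x) (c : Sym2 V → ℕ) (A B : V → ℕ) :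
    ∃ c', Attached G S T c c' α β A B := by
  classical
  have key : ∀ x y a b : V, x ∉ S → y ∉ S → a ∈ S → b ∈ S → s(x, a) = s(y, b) → x = y ∧ a = b := by
    intro x y a b hx hy ha hb e
    rcases Sym2.eq_iff.1 e with h | ⟨rfl, rfl⟩
    exacts [h, absurd hb hx]
  refine ⟨fun e => if h : ∃ x ∈ T \ S, e = s(x, α x) then A h.choose else
    if h : ∃ x ∈ T \ S, e = s(x, β x) then B h.choose else c e, ?_, fun x hx => (hα x hx).1,
    fun x hx => (hβ x hx).1, ?_, ?_⟩
  · intro u w X h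
    refine h.congr hST ?_
    intro x hx y hy _
    have no : ∀ z, z ∈ T \ S → ∀ a, s(x, y) ≠ s(z, a) := by
      intro z hz a e
      rcases Sym2.eq_iff.1 e with ⟨rfl, -⟩ | ⟨-, rfl⟩
      exacts [hz.2 hx, hz.2 hy]
    rw [dif_neg, dif_neg]
    · rintro ⟨z, hz, e⟩
      exact no z hz _ e
    · rintro ⟨z, hz, e⟩
      exact no z hz _ e
  · intro x hx
    refine .of_adj (hα x hx).2 hx.1 (hST (hα x hx).1) ?_
    have h : ∃ y ∈ T \ S, s(x, α x) = s(y, α y) := ⟨x, hx, rfl⟩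
    rw [dif_pos h]
    have := h.choose_spec
    rw [← (key _ _ _ _ hx.2 this.1.2 (hα x hx).1 (hα _ this.1).1 this.2).1]
  · intro x hx
    refine .of_adj (hβ x hx).2 hx.1 (hST (hβ x hx).1) ?_
    have h : ∃ y ∈ T \ S, s(x, β x) = s(y, β y) := ⟨x, hx, rfl⟩
    rw [dif_neg, dif_pos h]
    · have := h.choose_spec
      rw [← (key _ _ _ _ hx.2 this.1.2 (hβ x hx).1 (hβ _ this.1).1 this.2).1]
    · rintro ⟨y, hy, e⟩
      obtain ⟨rfl, h2⟩ := key _ _ _ _ hx.2 hy.2 (hβ x hx).1 (hα _ hy).1 e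
      exact hαβ x hx h2.symm

namespace Attached

variable {S T : Set V} {c c' : Sym2 V → ℕ} {α β : V → V} {A B : V → ℕ} {v x y u : V} {k K : ℕ}
  {X Z : ℕ → Prop}

theorem left_old (E : Attached G S T c c' α β A B) (hx : x ∈ T \ S)
    (h : RainbowLink G c S (α x) u X) (hX : ¬ X (A x)) (hZ : ∀ n, X n → Z n) (hA : Z (A x)) :
    RainbowLink G c' T x u Z :=
  (E.left x hx).trans (E.old _ _ _ h) (fun _ h1 h2 => hX (h1 ▸ h2)) (fun _ h => h ▸ hA) hZ

theorem right_old (E : Attached G S T c c' α β A B) (hx : x ∈ T \ S)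
    (h : RainbowLink G c S (β x) u X) (hX : ¬ X (B x)) (hZ : ∀ n, X n → Z n) (hB : Z (B x)) :
    RainbowLink G c' T x u Z :=
  (E.right x hx).trans (E.old _ _ _ h) (fun _ h1 h2 => hX (h1 ▸ h2)) (fun _ h => h ▸ hB) hZ

theorem valid (E : Attached G S T c c' α β A B) (hv : Valid G c S v k) (hk : k ≤ K)
    (h1 : ∀ x ∈ T \ S, RainbowLink G c' T x v (fun n => 0 < n ∧ n ≤ K))
    (h2 : ∀ x ∈ T \ S, ∀ u ∈ S, RainbowLink G c' T x u (fun n => n ≤ K))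
    (h3 : ∀ x ∈ T \ S, ∀ y ∈ T \ S, x ≠ y → RainbowLink G c' T x y (fun n => n ≤ K)) :
    Valid G c' T v K where
  mem := (E.old _ _ _ (hv.root v hv.mem)).left_mem
  root u hu := by
    by_cases huS : u ∈ S
    · exact (E.old _ _ _ (hv.root u huS)).mono fun n h => by omega
    · exact (h1 u ⟨hu, huS⟩).symm
  all u hu w hw := by
    by_cases huS : u ∈ S <;> by_cases hwS : w ∈ S
    · exact (E.old _ _ _ (hv.all u huS w hwS)).mono fun n h => by omega
    · exact (h2 w ⟨hw, hwS⟩ u huS).symm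
    · exact h2 u ⟨hu, huS⟩ w hwS
    · rcases eq_or_ne u w with rfl | hne
      · exact .refl hu
      · exact h3 u ⟨hu, huS⟩ w ⟨hw, hwS⟩ hne

end Attached

/-- Every vertex of `T` outside `S` has two neighbours in `S`. -/
def TwoNeighbors (G : SimpleGraph V) (S T : Set V) : Prop :=
  ∀ x ∈ T \ S, ∃ a ∈ S, ∃ b ∈ S, a ≠ b ∧ G.Adj x a ∧ G.Adj x b

/-- Two new colours attach any number of vertices. -/
theorem Valid.attach_two_colors {S T : Set V} {c : Sym2 V → ℕ} {v : V} {k : ℕ}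
    (hv : Valid G c S v k) (hST : S ⊆ T) (hT : TwoNeighbors G S T) :
    ∃ c', Valid G c' T v (k + 2) := by
  choose! α hα β hβ hαβ ha hb using hT
  obtain ⟨c', E⟩ := exists_attached (G := G) hST (fun x hx => ⟨hα x hx, ha x hx⟩)
    (fun x hx => ⟨hβ x hx, hb x hx⟩) hαβ c (fun _ => k + 1) (fun _ => k + 2)
  refine ⟨c', E.valid hv (by omega) ?_ ?_ ?_⟩
  · intro x hx
    exact E.left_old hx (hv.root _ (E.left_mem x hx)).symm (by omega) (fun n h => by omega)
      (by omega)
  · intro x hx u hu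
    exact E.left_old hx (hv.all _ (E.left_mem x hx) u hu) (by omega) (fun n h => by omega)
      (by omega)
  · intro x hx y hy _
    have h1 : RainbowLink G c' T x (β y) (fun n => n ≤ k + 1) :=
      E.left_old hx (hv.all _ (E.left_mem x hx) _ (E.right_mem y hy)) (by omega)
        (fun n h => by omega) (by omega)
    exact h1.trans (E.right y hy).symm (fun n h h' => by omega) (fun n h => by omega)
      (fun n h => by omega)

/-- The independent vertices outside a set of odd order are attached within the bound: two new
colours suffice for three or more of them. A single one takes one new colour on both edges. Two of
them share a new colour, and a spare link between their neighbourhoods lets its missing colour be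
used on an edge of the second one. -/
theorem OddState.attach {S T : Set V} [Finite V] {v : V} {k : ℕ} (hS : OddState G S v k)
    (hv : v ∈ S) (hST : S ⊆ T) (hT : TwoNeighbors G S T) :
    ∃ c, Valid G c T v (T.ncard / 2) := by
  classical
  have hcard : T.ncard = (T \ S).ncard + S.ncard := (Set.ncard_sdiff_add_ncard_of_subset hST).symm
  rw [hS.1] at hcard
  obtain ⟨c, hc, -⟩ := hS.2 v hv v hv v hv v hv
  rcases Nat.lt_or_ge 2 (T \ S).ncard with h3 | h3
  · obtain ⟨c', hc'⟩ := hc.attach_two_colors hST hT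
    exact ⟨c', hc'.mono (by omega)⟩
  obtain h | h | h : (T \ S).ncard = 0 ∨ (T \ S).ncard = 1 ∨ (T \ S).ncard = 2 := by omega
  · rw [Set.ncard_eq_zero, Set.sdiff_eq_empty] at h
    obtain rfl := hST.antisymm h
    exact ⟨c, hc.mono (by omega)⟩
  · obtain ⟨x, hx⟩ := Set.ncard_eq_one.1 h
    choose! α hα β hβ hαβ ha hb using hT
    obtain ⟨c', E⟩ := exists_attached (G := G) hST (fun x hx => ⟨hα x hx, ha x hx⟩)
      (fun x hx => ⟨hβ x hx, hb x hx⟩) hαβ c (fun _ => k + 1) (fun _ => k + 1)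
    refine ⟨c', E.valid hc (by omega) ?_ ?_ ?_⟩
    · intro x hx
      exact E.left_old hx (hc.root _ (E.left_mem x hx)).symm (by omega) (fun n h => by omega)
        (by omega)
    · intro x hx u hu
      exact E.left_old hx (hc.all _ (E.left_mem x hx) u hu) (by omega) (fun n h => by omega)
        (by omega)
    · intro y hy z hz hyz
      rw [hx] at hy hz
      exact absurd (hy.trans hz.symm) hyz
  · obtain ⟨x, y, hxy, hN⟩ := Set.ncard_eq_two.1 h
    have hx : x ∈ T \ S := by simp [hN]
    have hy : y ∈ T \ S := by simp [hN]
    -- neighbours `a` of `x` and `a'` of `y` with a spare colour on the way between them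
    obtain ⟨c, hc, a, ha, b, hb, hab, hxa, hxb, a', ha', b', hb', hab', hya, hyb, f, hf, hsp⟩ :
        ∃ c, Valid G c S v k ∧ ∃ a ∈ S, ∃ b ∈ S, a ≠ b ∧ G.Adj x a ∧ G.Adj x b ∧ ∃ a' ∈ S, ∃ b' ∈ S,
          a' ≠ b' ∧ G.Adj y a' ∧ G.Adj y b' ∧ SpareLink G c S k a a' := by
      obtain ⟨a, ha, b, hb, hab, hxa, hxb⟩ := hT x hx
      obtain ⟨a', ha', b', hb', hab', hya, hyb⟩ := hT y hy
      obtain ⟨c, hc, hsp⟩ := hS.2 a ha b hb a' ha' b' hb'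
      refine ⟨c, hc, ?_⟩
      rcases hsp hab hab' with h | h | h | h
      · exact ⟨a, ha, b, hb, hab, hxa, hxb, a', ha', b', hb', hab', hya, hyb, h⟩
      · exact ⟨a, ha, b, hb, hab, hxa, hxb, b', hb', a', ha', hab'.symm, hyb, hya, h⟩
      · exact ⟨b, hb, a, ha, hab.symm, hxb, hxa, a', ha', b', hb', hab', hya, hyb, h⟩
      · exact ⟨b, hb, a, ha, hab.symm, hxb, hxa, b', hb', a', ha', hab'.symm, hyb, hya, h⟩
    obtain ⟨c', E⟩ := exists_attached (G := G) hST (α := fun z => if z = x then a else b')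
      (β := fun z => if z = x then b else a') (c := c) (A := fun _ => k + 1)
      (B := fun z => if z = x then 0 else f)
      (by intro z hz; rw [hN] at hz; rcases hz with rfl | rfl <;> simp [hxy.symm, *])
      (by intro z hz; rw [hN] at hz; rcases hz with rfl | rfl <;> simp [hxy.symm, *])
      (by intro z hz; rw [hN] at hz; rcases hz with rfl | rfl <;> simp [hxy.symm, hab, hab'.symm])
    refine ⟨c', E.valid hc (by omega) ?_ ?_ ?_⟩
    · intro x hx
      exact E.left_old hx (hc.root _ (E.left_mem x hx)).symm (by omega) (fun n h => by omega)
        (by omega)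
    · intro x hx u hu
      exact E.left_old hx (hc.all _ (E.left_mem x hx) u hu) (by omega) (fun n h => by omega)
        (by omega)
    · have main : RainbowLink G c' T x y (fun n => n ≤ T.ncard / 2) := by
        have h1 : RainbowLink G c' T x a' (fun n => n = k + 1 ∨ n ≤ k ∧ n ≠ f) := by
          have := E.left x hx
          simp only [if_true] at this
          exact this.trans (E.old _ _ _ hsp) (fun n h h' => by omega) (fun n h => by omega)
            (fun n h => by omega)
        have h2 := E.right y hy
        simp only [hxy.symm, if_false] at h2
        exact h1.trans h2.symm (fun n h h' => by omega) (fun n h => by omega) (fun n h => by omega)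
      intro z hz w hw hzw
      rw [hN] at hz hw
      rcases hz with rfl | rfl <;> rcases hw with rfl | rfl
      exacts [absurd rfl hzw, main, main.symm, absurd rfl hzw]

/-- Of up to three further vertices one is attached by old colours alone and the other ones as in
`OddState.attach`; for more vertices two new colours are within the bound. -/
theorem EvenState.attach {S T : Set V} [Finite V] {v : V} {k : ℕ} (hS : EvenState G S v k)
    (hST : S ⊆ T) (hT : TwoNeighbors G S T) : ∃ c, Valid G c T v (T.ncard / 2) := by
  classical
  have hcard : T.ncard = (T \ S).ncard + S.ncard := (Set.ncard_sdiff_add_ncard_of_subset hST).symm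
  obtain ⟨hS1, hk, hS⟩ := hS
  rw [hS1] at hcard
  obtain ⟨e, he, e', he', hee⟩ := (Set.one_lt_ncard (s := S)).1 (by omega)
  obtain ⟨c, hc, -⟩ := hS e he e' he' e he e' he' e he e' he' hee (Or.inl hee) hee
  rcases Nat.lt_or_ge 3 (T \ S).ncard with h3 | h3
  · obtain ⟨c', hc'⟩ := hc.attach_two_colors hST hT
    exact ⟨c', hc'.mono (by omega)⟩
  obtain h | h | h | h : (T \ S).ncard = 0 ∨ (T \ S).ncard = 1 ∨ (T \ S).ncard = 2 ∨
      (T \ S).ncard = 3 := by omega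
  · rw [Set.ncard_eq_zero, Set.sdiff_eq_empty] at h
    obtain rfl := hST.antisymm h
    exact ⟨c, hc.mono (by omega)⟩
  · obtain ⟨x, hN⟩ := Set.ncard_eq_one.1 h
    obtain ⟨a, ha, b, hb, hab, hxa, hxb⟩ := hT x (by simp [hN])
    obtain ⟨c, hc, ⟨f, g, hf, hg, hfg, h1, h2⟩, -⟩ :=
      hS a ha b hb a ha b hb a ha b hb hab (Or.inl hab) hab
    obtain ⟨c', E⟩ := exists_attached (G := G) hST (α := fun _ => a) (β := fun _ => b) (c := c)
      (A := fun _ => f) (B := fun _ => g)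
      (by intro z hz; rw [hN] at hz; obtain rfl := hz; exact ⟨ha, hxa⟩)
      (by intro z hz; rw [hN] at hz; obtain rfl := hz; exact ⟨hb, hxb⟩)
      (fun _ _ => hab)
    refine ⟨c', E.valid hc (by omega) ?_ ?_ ?_⟩
    · intro x hx
      rcases h2 with ⟨h0, h⟩ | ⟨h0, h⟩
      · exact E.left_old hx h.symm (by omega) (fun n h => by omega) (by omega)
      · exact E.right_old hx h.symm (by omega) (fun n h => by omega) (by omega)
    · intro x hx u hu
      rcases h1 u hu with h | h
      · exact E.left_old hx h.symm (by omega) (fun n h => by omega) (by omega)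
      · exact E.right_old hx h.symm (by omega) (fun n h => by omega) (by omega)
    · intro y hy z hz hyz
      rw [hN] at hy hz
      exact absurd (hy.trans hz.symm) hyz
  · -- one vertex is attached by a new colour, the other one by old colours
    obtain ⟨x, y, hxy, hN⟩ := Set.ncard_eq_two.1 h
    have hx : x ∈ T \ S := by simp [hN]
    have hy : y ∈ T \ S := by simp [hN]
    obtain ⟨a, ha, b, hb, hab, hxa, hxb⟩ := hT x hx
    obtain ⟨a', ha', b', hb', hab', hya, hyb⟩ := hT y hy
    obtain ⟨c, hc, ⟨f, g, hf, hg, hfg, h1, h2⟩, -⟩ :=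
      hS a ha b hb a ha b hb a ha b hb hab (Or.inl hab) hab
    obtain ⟨c', E⟩ := exists_attached (G := G) hST (α := fun z => if z = x then a else a')
      (β := fun z => if z = x then b else b') (c := c) (A := fun z => if z = x then f else k + 1)
      (B := fun z => if z = x then g else k + 1)
      (by intro z hz; rw [hN] at hz; rcases hz with rfl | rfl <;> simp [hxy.symm, *])
      (by intro z hz; rw [hN] at hz; rcases hz with rfl | rfl <;> simp [hxy.symm, *])
      (by intro z hz; rw [hN] at hz; rcases hz with rfl | rfl <;> simp [hxy.symm, hab, hab'])
    have lx : RainbowLink G c' T x a (fun n => n = f) := by simpa using E.left x hx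
    have rx : RainbowLink G c' T x b (fun n => n = g) := by simpa using E.right x hx
    have ly : RainbowLink G c' T y a' (fun n => n = k + 1) := by
      simpa [hxy.symm] using E.left y hy
    have hxS : ∀ u ∈ S, RainbowLink G c' T x u (fun n => n ≤ k) := by
      intro u hu
      rcases h1 u hu with h | h
      · exact lx.trans (E.old _ _ _ h.symm) (fun n h h' => by omega) (fun n h => by omega)
          (fun n h => by omega)
      · exact rx.trans (E.old _ _ _ h.symm) (fun n h h' => by omega) (fun n h => by omega)
          (fun n h => by omega)
    have main : RainbowLink G c' T x y (fun n => n ≤ T.ncard / 2) :=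
      (hxS a' ha').trans ly.symm (fun n h h' => by omega) (fun n h => by omega)
        (fun n h => by omega)
    refine ⟨c', E.valid hc (by omega) ?_ ?_ ?_⟩
    · intro z hz
      rw [hN] at hz
      rcases hz with rfl | rfl
      · rcases h2 with ⟨h0, h⟩ | ⟨h0, h⟩
        · exact lx.trans (E.old _ _ _ h.symm) (fun n h h' => by omega) (fun n h => by omega)
            (fun n h => by omega)
        · exact rx.trans (E.old _ _ _ h.symm) (fun n h h' => by omega) (fun n h => by omega)
            (fun n h => by omega)
      · exact ly.trans (E.old _ _ _ (hc.root _ ha').symm) (fun n h h' => by omega)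
          (fun n h => by omega) (fun n h => by omega)
    · intro z hz u hu
      rw [hN] at hz
      rcases hz with rfl | rfl
      · exact (hxS u hu).mono fun n h => by omega
      · exact ly.trans (E.old _ _ _ (hc.all _ ha' _ hu)) (fun n h h' => by omega)
          (fun n h => by omega) (fun n h => by omega)
    · intro z hz w hw hzw
      rw [hN] at hz hw
      rcases hz with rfl | rfl <;> rcases hw with rfl | rfl
      exacts [absurd rfl hzw, main, main.symm, absurd rfl hzw]
  · -- `w` is attached by old colours, `x` and `y` share one new colour
    obtain ⟨w, x, y, hwx, hwy, hxy, hN⟩ := Set.ncard_eq_three.1 h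
    have hw : w ∈ T \ S := by simp [hN]
    have hx : x ∈ T \ S := by simp [hN]
    have hy : y ∈ T \ S := by simp [hN]
    obtain ⟨d, hd, d', hd', hdd, hwd, hwd'⟩ := hT w hw
    obtain ⟨c, hc, ⟨f, g, hf, hg, hfg, h1, h2⟩, a, ha, b, hb, hab, hxa, hxb, a', ha', b', hb', hab',
        hya, hyb, z, hz, hsp⟩ :
        ∃ c, Valid G c S v k ∧ Attachable G c S v k d d' ∧ ∃ a ∈ S, ∃ b ∈ S, a ≠ b ∧ G.Adj x a ∧
          G.Adj x b ∧ ∃ a' ∈ S, ∃ b' ∈ S, a' ≠ b' ∧ G.Adj y a' ∧ G.Adj y b' ∧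
          SpareLink G c S k a a' := by
      obtain ⟨a, ha, b, hb, hab, hxa, hxb⟩ := hT x hx
      obtain ⟨a', ha', b', hb', hab', hya, hyb⟩ := hT y hy
      obtain ⟨c, hc, hat, hsp⟩ := hS d hd d' hd' a ha b hb a' ha' b' hb' hdd (Or.inl hab) hab'
      refine ⟨c, hc, hat, ?_⟩
      rcases hsp with h | h | h | h
      · exact ⟨a, ha, b, hb, hab, hxa, hxb, a', ha', b', hb', hab', hya, hyb, h⟩
      · exact ⟨a, ha, b, hb, hab, hxa, hxb, b', hb', a', ha', hab'.symm, hyb, hya, h⟩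
      · exact ⟨b, hb, a, ha, hab.symm, hxb, hxa, a', ha', b', hb', hab', hya, hyb, h⟩
      · exact ⟨b, hb, a, ha, hab.symm, hxb, hxa, b', hb', a', ha', hab'.symm, hyb, hya, h⟩
    obtain ⟨c', E⟩ := exists_attached (G := G) hST
      (α := fun u => if u = w then d else if u = x then a else b')
      (β := fun u => if u = w then d' else if u = x then b else a') (c := c)
      (A := fun u => if u = w then f else k + 1)
      (B := fun u => if u = w then g else if u = x then 0 else z)
      (by intro z hz; rw [hN] at hz
          rcases hz with rfl | rfl | rfl <;> simp [hxy.symm, hwx.symm, hwy.symm, *])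
      (by intro z hz; rw [hN] at hz
          rcases hz with rfl | rfl | rfl <;> simp [hxy.symm, hwx.symm, hwy.symm, *])
      (by intro z hz; rw [hN] at hz
          rcases hz with rfl | rfl | rfl <;>
            simp [hxy.symm, hwx.symm, hwy.symm, hab, hab'.symm, hdd])
    have lw : RainbowLink G c' T w d (fun n => n = f) := by simpa using E.left w hw
    have rw' : RainbowLink G c' T w d' (fun n => n = g) := by simpa using E.right w hw
    have lx : RainbowLink G c' T x a (fun n => n = k + 1) := by
      simpa [hwx.symm] using E.left x hx
    have ly : RainbowLink G c' T y b' (fun n => n = k + 1) := by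
      simpa [hwy.symm, hxy.symm] using E.left y hy
    have ry : RainbowLink G c' T y a' (fun n => n = z) := by
      simpa [hwy.symm, hxy.symm] using E.right y hy
    have hwS : ∀ u ∈ S, RainbowLink G c' T w u (fun n => n ≤ k) := by
      intro u hu
      rcases h1 u hu with h | h
      · exact lw.trans (E.old _ _ _ h.symm) (fun n h h' => by omega) (fun n h => by omega)
          (fun n h => by omega)
      · exact rw'.trans (E.old _ _ _ h.symm) (fun n h h' => by omega) (fun n h => by omega)
          (fun n h => by omega)
    have main : RainbowLink G c' T w x (fun n => n ≤ T.ncard / 2) :=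
      (hwS a ha).trans lx.symm (fun n h h' => by omega) (fun n h => by omega)
        (fun n h => by omega)
    have main' : RainbowLink G c' T w y (fun n => n ≤ T.ncard / 2) :=
      (hwS b' hb').trans ly.symm (fun n h h' => by omega) (fun n h => by omega)
        (fun n h => by omega)
    have main'' : RainbowLink G c' T x y (fun n => n ≤ T.ncard / 2) := by
      have h3 : RainbowLink G c' T x a' (fun n => n = k + 1 ∨ n ≤ k ∧ n ≠ z) :=
        lx.trans (E.old _ _ _ hsp) (fun n h h' => by omega) (fun n h => by omega)
          (fun n h => by omega)
      exact h3.trans ry.symm (fun n h h' => by omega) (fun n h => by omega) (fun n h => by omega)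
    refine ⟨c', E.valid hc (by omega) ?_ ?_ ?_⟩
    · intro u hu
      rw [hN] at hu
      rcases hu with rfl | rfl | rfl
      · rcases h2 with ⟨h0, h⟩ | ⟨h0, h⟩
        · exact lw.trans (E.old _ _ _ h.symm) (fun n h h' => by omega) (fun n h => by omega)
            (fun n h => by omega)
        · exact rw'.trans (E.old _ _ _ h.symm) (fun n h h' => by omega) (fun n h => by omega)
            (fun n h => by omega)
      · exact lx.trans (E.old _ _ _ (hc.root _ ha).symm) (fun n h h' => by omega)
          (fun n h => by omega) (fun n h => by omega)
      · exact ly.trans (E.old _ _ _ (hc.root _ hb').symm) (fun n h h' => by omega)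
          (fun n h => by omega) (fun n h => by omega)
    · intro u hu s hs
      rw [hN] at hu
      rcases hu with rfl | rfl | rfl
      · exact (hwS s hs).mono fun n h => by omega
      · exact lx.trans (E.old _ _ _ (hc.all _ ha _ hs)) (fun n h h' => by omega)
          (fun n h => by omega) (fun n h => by omega)
      · exact ly.trans (E.old _ _ _ (hc.all _ hb' _ hs)) (fun n h h' => by omega)
          (fun n h => by omega) (fun n h => by omega)
    · intro u hu s hs hus
      rw [hN] at hu hs
      rcases hu with rfl | rfl | rfl <;> rcases hs with rfl | rfl | rfl
      exacts [absurd rfl hus, main, main', main.symm, absurd rfl hus, main'', main'.symm,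
        main''.symm, absurd rfl hus]

/-! ### Vertex sets without cut vertices -/

/-- `u` and `w` are joined by a walk inside the vertex set `T`. -/
def Linked (G : SimpleGraph V) (T : Set V) (u w : V) : Prop :=
  ∃ p : G.Walk u w, ∀ x ∈ p.support, x ∈ T

namespace Linked

variable {T T' : Set V} {u w y : V}

theorem refl (hu : u ∈ T) : Linked G T u u := ⟨.nil, by simpa using hu⟩

theorem symm (h : Linked G T u w) : Linked G T w u := by
  obtain ⟨p, hp⟩ := h
  exact ⟨p.reverse, by simpa using hp⟩

theorem trans (h : Linked G T u w) (h' : Linked G T w y) : Linked G T u y := by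
  obtain ⟨p, hp⟩ := h
  obtain ⟨q, hq⟩ := h'
  refine ⟨p.append q, fun x hx => ?_⟩
  rcases (SimpleGraph.Walk.mem_support_append_iff _ _).1 hx with hx | hx
  exacts [hp x hx, hq x hx]

theorem of_adj (h : G.Adj u w) (hu : u ∈ T) (hw : w ∈ T) : Linked G T u w :=
  ⟨h.toWalk, by simp [hu, hw]⟩

theorem mono (h : Linked G T u w) (hT : T ⊆ T') : Linked G T' u w := by
  obtain ⟨p, hp⟩ := h
  exact ⟨p, fun x hx => hT (hp x hx)⟩

theorem left_mem (h : Linked G T u w) : u ∈ T := by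
  obtain ⟨p, hp⟩ := h
  exact hp _ p.start_mem_support

theorem right_mem (h : Linked G T u w) : w ∈ T := h.symm.left_mem

/-- A walk leaving the set `C` crosses its boundary. -/
theorem exists_crossing (h : Linked G T u w) {C : Set V} (hu : u ∈ C) (hw : w ∉ C) :
    ∃ a b, a ∈ T ∧ b ∈ T ∧ a ∈ C ∧ b ∉ C ∧ G.Adj a b := by
  obtain ⟨p, hp⟩ := h
  obtain ⟨d, hd, h1, h2⟩ := p.exists_boundary_dart C hu hw
  exact ⟨d.fst, d.snd, hp _ (p.dart_fst_mem_support_of_mem_darts hd),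
    hp _ (p.dart_snd_mem_support_of_mem_darts hd), h1, h2, d.adj⟩

end Linked

/-- Any two vertices of `T` are joined by a walk inside `T`. -/
def ConnectedOn (G : SimpleGraph V) (T : Set V) : Prop := ∀ u ∈ T, ∀ w ∈ T, Linked G T u w

/-- The subgraph induced on `T` is connected and has no cut vertex. -/
structure Biconnected (G : SimpleGraph V) (T : Set V) : Prop where
  nonempty : T.Nonempty
  connectedOn : ConnectedOn G T
  connectedOn_diff : ∀ x ∈ T, ConnectedOn G (T \ {x})

/-- A path through `T \ S` between distinct vertices with neighbours in `S` is an ear. -/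
theorem exists_isEar_of_linked {S T : Set V} {c₁ c₂ s₁ s₂ : V} (h : Linked G (T \ S) c₁ c₂)
    (hc : c₁ ≠ c₂) (h1 : s₁ ∈ S) (h2 : s₂ ∈ S) (a1 : G.Adj s₁ c₁) (a2 : G.Adj c₂ s₂)
    (hs : s₁ = s₂ → ∀ x ∈ S, x = s₁) : ∃ p m, IsEar G S T p m := by
  classical
  obtain ⟨q, hq⟩ := h
  have hr : ∀ x ∈ q.bypass.support, x ∈ T \ S := fun x hx => hq x (q.support_bypass_subset_support hx)
  have hp := q.bypass_isPath
  generalize q.bypass = r at hr hp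
  have hlen : r.length ≠ 0 := fun h0 => hc (SimpleGraph.Walk.eq_of_length_eq_zero h0)
  obtain ⟨p, p_zero, p_mid, p_end⟩ : ∃ p : ℕ → V, p 0 = s₁ ∧
      (∀ i, 1 ≤ i → i ≤ r.length + 1 → p i = r.getVert (i - 1)) ∧ p (r.length + 1 + 1) = s₂ := by
    refine ⟨fun i => if i = 0 then s₁ else if i ≤ r.length + 1 then r.getVert (i - 1) else s₂,
      by simp, fun i hi hi' => ?_, by simp⟩
    beta_reduce
    rw [if_neg (by omega), if_pos hi']
  refine ⟨p, r.length + 1, ⟨by omega, p_zero ▸ h1, p_end ▸ h2, ?_, ?_, ?_, ?_, ?_⟩⟩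
  · intro i hi hi'
    rw [p_mid i hi hi']
    exact (hr _ (r.getVert_mem_support _)).1
  · intro i hi hi'
    rw [p_mid i hi hi']
    exact (hr _ (r.getVert_mem_support _)).2
  · intro i j hi hi' hj hj' e
    rw [p_mid i hi hi', p_mid j hj hj'] at e
    have := hp.getVert_injOn (by simp; omega) (by simp; omega) e
    omega
  · intro i hi
    rcases Nat.eq_zero_or_pos i with rfl | h0
    · rw [p_zero, p_mid 1 le_rfl (by omega)]
      simpa using a1
    · rw [p_mid i h0 hi]
      rcases Nat.lt_or_ge i (r.length + 1) with h3 | h3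
      · rw [p_mid (i + 1) (by omega) (by omega)]
        have := r.adj_getVert_succ (i := i - 1) (by omega)
        rwa [show i - 1 + 1 = i + 1 - 1 by omega] at this
      · obtain rfl : i = r.length + 1 := by omega
        rw [p_end]
        simpa using a2
  · rw [p_zero, p_end]
    exact hs

/-- As long as two vertices outside `S` are adjacent there is an ear with at least two internal
vertices: otherwise the component of these vertices in `T \ S` would be attached to `S` at a single
vertex of the component or at a single vertex of `S`, a cut vertex. -/
theorem Biconnected.exists_isEar {S T : Set V} (hT : Biconnected G T) (hST : S ⊆ T)
    (hS : S.Nonempty) {x y : V} (hx : x ∈ T \ S) (hy : y ∈ T \ S) (hxy : G.Adj x y) :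
    ∃ p m, IsEar G S T p m := by
  obtain ⟨s₀, hs₀⟩ := hS
  set C : Set V := {z | Linked G (T \ S) x z} with hC
  have hxC : x ∈ C := .refl hx
  have hyC : y ∈ C := .of_adj hxy hx hy
  have hCS : ∀ z ∈ C, z ∉ S := fun z hz => hz.right_mem.2
  have hCT : ∀ z ∈ C, z ∈ T := fun z hz => hz.right_mem.1
  have out : ∀ a b, a ∈ C → b ∉ C → b ∈ T → G.Adj a b → b ∈ S := by
    intro a b ha hb hbT hab
    by_contra hbS
    exact hb (ha.trans (.of_adj hab ha.right_mem ⟨hbT, hbS⟩))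
  have link : ∀ a ∈ C, ∀ b ∈ C, Linked G (T \ S) a b := fun a ha b hb => ha.symm.trans hb
  obtain ⟨c₁, s₁, -, h1T, hc₁, h1C, a1⟩ :=
    (hT.connectedOn x hx.1 s₀ (hST hs₀)).exists_crossing hxC (fun h => hCS _ h hs₀)
  have hs₁ := out _ _ hc₁ h1C h1T a1
  obtain ⟨z, hz, hzc⟩ : ∃ z ∈ C, z ≠ c₁ := by
    by_cases h : x = c₁
    · exact ⟨y, hyC, fun e => hxy.ne (h.trans e.symm)⟩
    · exact ⟨x, hxC, h⟩
  obtain ⟨c₂, s₂, hc₂', h2T, hc₂, h2C, a2⟩ :=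
    (hT.connectedOn_diff c₁ (hCT _ hc₁) z ⟨hCT _ hz, hzc⟩ s₀
      ⟨hST hs₀, fun e => hCS _ hc₁ (e ▸ hs₀)⟩).exists_crossing hz (fun h => hCS _ h hs₀)
  have hs₂ := out _ _ hc₂ h2C h2T.1 a2
  have hne : c₁ ≠ c₂ := fun e => hc₂'.2 e.symm
  by_cases hs : s₁ = s₂ → ∀ x ∈ S, x = s₁
  · exact exists_isEar_of_linked (link _ hc₁ _ hc₂) hne hs₁ hs₂ a1.symm a2 hs
  · push Not at hs
    obtain ⟨rfl, s', hs', hne'⟩ := hs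
    obtain ⟨c₃, s₃, hc₃', h3T, hc₃, h3C, a3⟩ :=
      (hT.connectedOn_diff s₁ (hST hs₁) x ⟨hx.1, fun e => hx.2 (e ▸ hs₁)⟩ s'
        ⟨hST hs', hne'⟩).exists_crossing hxC (fun h => hCS _ h hs')
    have hs₃ := out _ _ hc₃ h3C h3T.1 a3
    have h13 : s₁ ≠ s₃ := fun e => h3T.2 e.symm
    by_cases h : c₁ = c₃
    · exact exists_isEar_of_linked (link _ hc₂ _ hc₃) (h ▸ hne.symm) hs₁ hs₃ a2.symm a3
        (fun e => absurd e h13)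
    · exact exists_isEar_of_linked (link _ hc₁ _ hc₃) h hs₁ hs₃ a1.symm a3
        (fun e => absurd e h13)

theorem Biconnected.twoNeighbors {S T : Set V} (hT : Biconnected G T) (hST : S ⊆ T)
    (hS : S.Nontrivial) (hind : ∀ x ∈ T \ S, ∀ y ∈ T \ S, ¬ G.Adj x y) : TwoNeighbors G S T := by
  intro x hx
  have key : ∀ T' ⊆ T, x ∈ T' → ConnectedOn G T' → ∀ s ∈ S, s ∈ T' → ∃ a ∈ S, a ∈ T' ∧ G.Adj x a := by
    intro T' hT' hxT' hc s hs hsT'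
    obtain ⟨a, b, ha, hb, rfl, hbx, hab⟩ :=
      (hc x hxT' s hsT').exists_crossing (C := {x}) rfl (fun e => hx.2 (e ▸ hs))
    refine ⟨b, ?_, hb, hab⟩
    by_contra hbS
    exact hind _ hx _ ⟨hT' hb, hbS⟩ hab
  obtain ⟨s, hs⟩ := hS.nonempty
  obtain ⟨a, ha, haT, hxa⟩ := key T subset_rfl hx.1 hT.connectedOn s hs (hST hs)
  obtain ⟨s', hs', hne⟩ := hS.exists_ne a
  obtain ⟨b, hb, hbT, hxb⟩ := key (T \ {a}) Set.sdiff_subset ⟨hx.1, fun e => hx.2 (e ▸ ha)⟩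
    (hT.connectedOn_diff a haT) s' hs' ⟨hST hs', hne⟩
  exact ⟨a, ha, b, hb, fun e => hbT.2 e.symm, hxa, hxb⟩

/-- Growing a set with one of the two invariants by ears, and attaching the independent rest. -/
theorem Biconnected.exists_valid_of_state [Finite V] {T : Set V} (hT : Biconnected G T)
    (hcard : 3 ≤ T.ncard) {v : V} : ∀ (n : ℕ) (S : Set V) (k : ℕ), (T \ S).ncard = n → S ⊆ T → v ∈ S →
      OddState G S v k ∨ EvenState G S v k → ∃ c, Valid G c T v (T.ncard / 2) := by
  intro n
  induction n using Nat.strong_induction_on with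
  | _ n ih =>
    intro S k hn hST hv hS
    by_cases hind : ∀ x ∈ T \ S, ∀ y ∈ T \ S, ¬ G.Adj x y
    · have hnon : S.Nontrivial := by
        rw [← Set.one_lt_ncard_iff_nontrivial]
        by_contra hno
        have h1 : S.ncard = 1 := by
          have := (Set.ncard_pos (s := S)).2 ⟨v, hv⟩
          omega
        obtain ⟨x, rfl⟩ := Set.ncard_eq_one.1 h1
        have h2 : 1 < (T \ {x}).ncard := by
          have := Set.ncard_sdiff_add_ncard_of_subset hST
          rw [h1] at this
          omega
        obtain ⟨a, ha, b, hb, hab⟩ := (Set.one_lt_ncard (s := T \ {x})).1 h2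
        obtain ⟨a', b', ha', hb', -, -, h3⟩ := (hT.connectedOn_diff x (hST rfl) a ha b hb).exists_crossing
          (C := {a}) rfl (fun e => hab e.symm)
        exact hind _ ha' _ hb' h3
      have h2 := hT.twoNeighbors hST hnon hind
      rcases hS with hS | hS
      exacts [hS.attach hv hST h2, hS.attach hST h2]
    · push Not at hind
      obtain ⟨x, hx, y, hy, hxy⟩ := hind
      obtain ⟨p, m, hp⟩ := hT.exists_isEar hST ⟨v, hv⟩ hx hy hxy
      have hsub : addEar S p m ⊆ T := by
        rintro z (hz | ⟨i, h1, h2, rfl⟩)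
        exacts [hST hz, hp.mem i h1 h2]
      have hlt : (T \ addEar S p m).ncard < n := by
        have h1 := Set.ncard_sdiff_add_ncard_of_subset hST
        have h2 := Set.ncard_sdiff_add_ncard_of_subset hsub
        have h3 := hp.ncard_addEar
        have h4 := hp.two_le
        omega
      have hv' : v ∈ addEar S p m := Or.inl hv
      obtain ⟨t, rfl | rfl⟩ := Nat.even_or_odd' m
      · rcases hS with hS | hS
        · exact ih _ hlt _ _ rfl hsub hv' (Or.inl (hS.addEar_even hp))
        · exact ih _ hlt _ _ rfl hsub hv' (Or.inr (hS.addEar_even hp))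
      · rcases hS with hS | hS
        · exact ih _ hlt _ _ rfl hsub hv' (Or.inr (hS.addEar_odd hp))
        · exact ih _ hlt _ _ rfl hsub hv' (Or.inl (hS.addEar_odd hp))

/-- A connected vertex set `T` without cut vertices has a colouring with the `⌊|T| / 2⌋ + 1` colours
`0, …, ⌊|T| / 2⌋` that makes any two vertices linked and in which a prescribed root needs
colour `0` for none of its links. -/
theorem Biconnected.exists_valid [Finite V] {T : Set V} (hT : Biconnected G T) {v : V} (hv : v ∈ T) :
    ∃ c, Valid G c T v (T.ncard / 2) := by
  rcases Nat.lt_or_ge T.ncard 3 with h | h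
  · have hpos := (Set.ncard_pos (s := T)).2 ⟨v, hv⟩
    -- every vertex other than the root is adjacent to it
    have adj : ∀ u ∈ T, u ≠ v → G.Adj v u := by
      intro u hu huv
      obtain ⟨a, b, ha, hb, rfl, hba, hab⟩ :=
        (hT.connectedOn v hv u hu).exists_crossing (C := {v}) rfl huv
      have hb' : b = u := by
        by_contra hbu
        have : 2 < T.ncard := (Set.two_lt_ncard (s := T)).2
          ⟨a, ha, u, hu, b, hb, huv.symm, fun e => hba e.symm, fun e => hbu e.symm⟩
        omega
      exact hb' ▸ hab
    have card : ∀ u ∈ T, u ≠ v → T.ncard = 2 := fun u hu huv => by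
      have : 1 < T.ncard := (Set.one_lt_ncard (s := T)).2 ⟨u, hu, v, hv, huv⟩
      omega
    have root : ∀ u ∈ T, RainbowLink G (fun _ => 1) T v u (fun n => 0 < n ∧ n ≤ T.ncard / 2) := by
      intro u hu
      rcases eq_or_ne u v with rfl | huv
      · exact .refl hv
      · have := card u hu huv
        exact .of_adj (adj u hu huv) hv hu (by omega)
    refine ⟨fun _ => 1, hv, root, fun u hu w hw => ?_⟩
    rcases eq_or_ne u v with rfl | huv
    · exact (root w hw).mono fun n h => h.2
    · rcases eq_or_ne w v with rfl | hwv
      · exact (root u hu).symm.mono fun n h => h.2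
      · rcases eq_or_ne u w with rfl | huw
        · exact .refl hu
        · have : 2 < T.ncard := (Set.two_lt_ncard (s := T)).2
            ⟨u, hu, w, hw, v, hv, huw, huv, hwv⟩
          omega
  · refine hT.exists_valid_of_state h _ {v} 0 rfl (by simpa using hv) rfl (Or.inl ⟨by simp, ?_⟩)
    rintro a rfl b rfl c₁ rfl c₂ rfl
    refine ⟨fun _ => 0, ⟨rfl, ?_, ?_⟩, fun h => absurd rfl h⟩
    · rintro u rfl
      exact .refl rfl
    · rintro u rfl w rfl
      exact .refl rfl

/-! ### Blocks as vertex sets -/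

/-- `T` is the vertex set of a block of the subgraph induced on `S`. -/
def IsBlockSet (G : SimpleGraph V) (S T : Set V) : Prop :=
  Maximal (fun T => T ⊆ S ∧ Biconnected G T) T

/-- The vertex set `S` is the union of two connected sets `A` and `B` with at least two vertices
each, which have only `x` in common and no edges between their other vertices. -/
structure IsSplit (G : SimpleGraph V) (S A B : Set V) (x : V) : Prop where
  union : S = A ∪ B
  mem_left : x ∈ A
  mem_right : x ∈ B
  eq_of_mem : ∀ y ∈ A, y ∈ B → y = x
  not_adj : ∀ a ∈ A, ∀ b ∈ B, a ≠ x → b ≠ x → ¬ G.Adj a b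
  left_connected : ConnectedOn G A
  right_connected : ConnectedOn G B
  left_nontrivial : A.Nontrivial
  right_nontrivial : B.Nontrivial

theorem Biconnected.pair {a b : V} (h : G.Adj a b) : Biconnected G {a, b} where
  nonempty := ⟨a, Or.inl rfl⟩
  connectedOn := by
    have ha : a ∈ ({a, b} : Set V) := Or.inl rfl
    have hb : b ∈ ({a, b} : Set V) := Or.inr rfl
    rintro u (rfl | rfl) w (rfl | rfl)
    exacts [.refl ha, .of_adj h ha hb, .of_adj h.symm hb ha, .refl hb]
  connectedOn_diff := by
    rintro x (rfl | rfl) u ⟨rfl | rfl, hu⟩ w ⟨rfl | rfl, hw⟩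
    all_goals first | exact absurd rfl hu | exact absurd rfl hw | skip
    · exact .refl ⟨Or.inr rfl, hu⟩
    · exact .refl ⟨Or.inl rfl, hu⟩

theorem IsBlockSet.nontrivial {S T : Set V} (hT : IsBlockSet G S T) (hS : ConnectedOn G S)
    (hS' : S.Nontrivial) : T.Nontrivial := by
  by_contra hno
  obtain ⟨t, rfl⟩ : ∃ t, T = {t} := by
    rcases (Set.not_nontrivial_iff.1 hno).eq_empty_or_singleton with h | h
    · exact absurd h hT.prop.2.nonempty.ne_empty
    · exact h
  have htS : t ∈ S := hT.prop.1 rfl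
  obtain ⟨t', ht', hne⟩ := hS'.exists_ne t
  obtain ⟨a, b, ha, hb, rfl, hba, hab⟩ := (hS t htS t' ht').exists_crossing (C := {t}) rfl hne
  have := hT.le_of_ge (y := {a, b}) ⟨by rintro z (rfl | rfl) <;> assumption, .pair hab⟩
    (by simp)
  exact hba (this (Or.inr rfl))

theorem Biconnected.isBlockSet_iff {S T : Set V} (hS : Biconnected G S) :
    IsBlockSet G S T ↔ T = S := by
  constructor
  · intro h
    exact h.prop.1.antisymm (h.le_of_ge ⟨subset_rfl, hS⟩ h.prop.1)
  · rintro rfl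
    exact ⟨⟨subset_rfl, hS⟩, fun U hU _ => hU.1⟩

namespace IsSplit

variable {S A B T : Set V} {x : V}

theorem symm (h : IsSplit G S A B x) : IsSplit G S B A x where
  union := by rw [h.union, Set.union_comm]
  mem_left := h.mem_right
  mem_right := h.mem_left
  eq_of_mem y hy hy' := h.eq_of_mem y hy' hy
  not_adj a ha b hb hax hbx hab := h.not_adj b hb a ha hbx hax hab.symm
  left_connected := h.right_connected
  right_connected := h.left_connected
  left_nontrivial := h.right_nontrivial
  right_nontrivial := h.left_nontrivial

theorem left_subset (h : IsSplit G S A B x) : A ⊆ S := h.union ▸ Set.subset_union_left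

theorem right_subset (h : IsSplit G S A B x) : B ⊆ S := h.symm.left_subset

theorem ncard [Finite V] (h : IsSplit G S A B x) : S.ncard + 1 = A.ncard + B.ncard := by
  have h1 : A ∩ B = {x} := by
    ext y
    constructor
    · exact fun hy => h.eq_of_mem y hy.1 hy.2
    · rintro rfl
      exact ⟨h.mem_left, h.mem_right⟩
  have := Set.ncard_union_add_ncard_inter A B
  rw [h1, ← h.union, Set.ncard_singleton] at this
  exact this

/-- A set without cut vertices lies on one side of a split. -/
theorem subset_or_subset (h : IsSplit G S A B x) (hT : Biconnected G T) (hTS : T ⊆ S) :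
    T ⊆ A ∨ T ⊆ B := by
  by_contra hno
  rw [not_or, Set.not_subset, Set.not_subset] at hno
  obtain ⟨⟨u, hu, huA⟩, w, hw, hwB⟩ := hno
  have hux : u ≠ x := fun e => huA (e ▸ h.mem_left)
  have hwx : w ≠ x := fun e => hwB (e ▸ h.mem_right)
  have hlink : Linked G (T \ {x}) u w := by
    by_cases hx : x ∈ T
    · exact hT.connectedOn_diff x hx u ⟨hu, hux⟩ w ⟨hw, hwx⟩
    · exact (hT.connectedOn u hu w hw).mono fun y hy => ⟨hy, fun e => hx (e ▸ hy)⟩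
  obtain ⟨a, b, ha, hb, haA, hbA, hab⟩ := hlink.exists_crossing (C := {y | y ∉ A}) huA
    (fun hwA => by
      have := hTS hw
      rw [h.union] at this
      exact this.elim hwA hwB)
  have hbA : b ∈ A := not_not.1 hbA
  have haB : a ∈ B := by
    have := hTS ha.1
    rw [h.union] at this
    exact this.resolve_left haA
  exact h.not_adj b hbA a haB hb.2 ha.2 hab.symm

theorem isBlockSet_of_left (h : IsSplit G S A B x) (hT : IsBlockSet G A T) : IsBlockSet G S T := by
  refine ⟨⟨hT.prop.1.trans h.left_subset, hT.prop.2⟩, fun U hU hTU => ?_⟩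
  rcases h.subset_or_subset hU.2 hU.1 with h' | h'
  · exact hT.le_of_ge ⟨h', hU.2⟩ hTU
  · exfalso
    obtain ⟨y, hy, hyx⟩ := (hT.nontrivial h.left_connected h.left_nontrivial).exists_ne x
    exact hyx (h.eq_of_mem y (hT.prop.1 hy) (h' (hTU hy)))

theorem isBlockSet_iff (h : IsSplit G S A B x) :
    IsBlockSet G S T ↔ IsBlockSet G A T ∨ IsBlockSet G B T := by
  constructor
  · intro hT
    rcases h.subset_or_subset hT.prop.2 hT.prop.1 with h' | h'
    · exact Or.inl ⟨⟨h', hT.prop.2⟩, fun U hU => hT.le_of_ge ⟨hU.1.trans h.left_subset, hU.2⟩⟩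
    · exact Or.inr ⟨⟨h', hT.prop.2⟩, fun U hU => hT.le_of_ge ⟨hU.1.trans h.right_subset, hU.2⟩⟩
  · rintro (hT | hT)
    exacts [h.isBlockSet_of_left hT, h.symm.isBlockSet_of_left hT]

theorem not_isBlockSet_both (h : IsSplit G S A B x) (hA : IsBlockSet G A T)
    (hB : IsBlockSet G B T) : False := by
  obtain ⟨y, hy, hyx⟩ := (hA.nontrivial h.left_connected h.left_nontrivial).exists_ne x
  exact hyx (h.eq_of_mem y (hA.prop.1 hy) (hB.prop.1 hy))

/-- Counting the blocks with a given property on the two sides of a split. -/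
theorem ncard_blockSets [Finite V] (h : IsSplit G S A B x) (P : Set V → Prop) :
    {T | IsBlockSet G S T ∧ P T}.ncard =
      {T | IsBlockSet G A T ∧ P T}.ncard + {T | IsBlockSet G B T ∧ P T}.ncard := by
  rw [← Set.ncard_union_eq _ (Set.toFinite _) (Set.toFinite _)]
  · congr 1
    ext T
    constructor
    · rintro ⟨h1, h2⟩
      exact (h.isBlockSet_iff.1 h1).imp (fun h => ⟨h, h2⟩) (fun h => ⟨h, h2⟩)
    · rintro (⟨h1, h2⟩ | ⟨h1, h2⟩)
      exacts [⟨h.isBlockSet_iff.2 (Or.inl h1), h2⟩, ⟨h.isBlockSet_iff.2 (Or.inr h1), h2⟩]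
  · rw [Set.disjoint_left]
    exact fun T h1 h2 => h.not_isBlockSet_both h1.1 h2.1

end IsSplit

/-- In a connected set every vertex reaches `x` through vertices from which it is not separated
by `x`. -/
theorem Linked.of_component {S : Set V} {x y : V} (h : Linked G S y x) :
    Linked G ({x} ∪ {z | Linked G (S \ {x}) y z}) y x := by
  obtain ⟨p, hp⟩ := h
  induction p with
  | nil => exact .refl (Or.inl rfl)
  | @cons a b d hab p ih =>
    by_cases hax : a = d
    · subst hax
      exact .refl (Or.inl rfl)
    have ha : a ∈ S \ {d} := ⟨hp a (by simp), hax⟩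
    have ih := ih fun z hz => hp z (by simp [hz])
    by_cases hbd : b = d
    · subst hbd
      exact .of_adj hab (Or.inr (.refl ha)) (Or.inl rfl)
    · have hlink : Linked G (S \ {d}) a b := .of_adj hab ha ⟨hp b (by simp), hbd⟩
      refine (Linked.of_adj hab (Or.inr (.refl ha)) (Or.inr hlink)).trans (ih.mono ?_)
      rintro z (hz | hz)
      exacts [Or.inl hz, Or.inr (hlink.trans hz)]

/-- One side is a component of the set without a cut vertex `x`, together with `x`; the other side
consists of `x` and the remaining components. -/
theorem ConnectedOn.exists_isSplit {S : Set V} (hS : ConnectedOn G S) (hne : S.Nonempty)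
    (hb : ¬ Biconnected G S) : ∃ A B x, IsSplit G S A B x := by
  obtain ⟨x, hx, u, hu, w, hw, huw⟩ :
      ∃ x ∈ S, ∃ u ∈ S \ {x}, ∃ w ∈ S \ {x}, ¬ Linked G (S \ {x}) u w := by
    by_contra hno
    push Not at hno
    exact hb ⟨hne, hS, fun x hx u hu w hw => hno x hx u hu w hw⟩
  set C : Set V := {z | Linked G (S \ {x}) u z} with hC
  have hCS : C ⊆ S := fun z hz => hz.right_mem.1
  have hxC : x ∉ C := fun hz => hz.right_mem.2 rfl
  have conn : ∀ D : Set V, (∀ y ∈ D, y ≠ x → Linked G D y x) → x ∈ D → ConnectedOn G D := by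
    intro D hD hxD
    have : ∀ y ∈ D, Linked G D y x := fun y hy => by
      rcases eq_or_ne y x with rfl | h
      exacts [.refl hxD, hD y hy h]
    exact fun y hy z hz => (this y hy).trans (this z hz).symm
  refine ⟨{x} ∪ C, S \ C, x, ?_, Or.inl rfl, ⟨hx, hxC⟩, ?_, ?_, ?_, ?_, ?_, ?_⟩
  · ext z
    constructor
    · intro hz
      by_cases h : z ∈ C
      exacts [Or.inl (Or.inr h), Or.inr ⟨hz, h⟩]
    · rintro ((rfl | hz) | hz)
      exacts [hx, hCS hz, hz.1]
  · rintro y (hy | hy) hy'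
    exacts [hy, absurd hy hy'.2]
  · rintro a (ha | ha) b hb hax hbx hab
    · exact hax ha
    · exact hb.2 (Linked.trans ha (.of_adj hab ha.right_mem ⟨hb.1, hbx⟩))
  · refine conn _ ?_ (Or.inl rfl)
    rintro y (hy | hy) hyx
    · exact absurd hy hyx
    · refine (hS y (hCS hy) x hx).of_component.mono ?_
      rintro z (hz | hz)
      exacts [Or.inl hz, Or.inr (Linked.trans hy hz)]
  · refine conn _ ?_ ⟨hx, hxC⟩
    intro y hy hyx
    refine (hS y hy.1 x hx).of_component.mono ?_
    rintro z (rfl | hz)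
    · exact ⟨hx, hxC⟩
    · exact ⟨hz.right_mem.1, fun h => hy.2 (Linked.trans h hz.symm)⟩
  · exact ⟨x, Or.inl rfl, u, Or.inr (.refl hu), fun e => hu.2 e.symm⟩
  · exact ⟨x, ⟨hx, hxC⟩, w, ⟨hw.1, huw⟩, fun e => hw.2 e.symm⟩

/-- Induction on the block structure of a connected set with at least two vertices. -/
theorem ConnectedOn.block_induction [Finite V] {P : Set V → Prop}
    (hb : ∀ S, Biconnected G S → S.Nontrivial → P S)
    (hs : ∀ S A B x, IsSplit G S A B x → P A → P B → P S) {S : Set V} (hS : ConnectedOn G S)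
    (hn : S.Nontrivial) : P S := by
  generalize h : S.ncard = n
  induction n using Nat.strong_induction_on generalizing S with
  | _ n ih =>
    by_cases hbi : Biconnected G S
    · exact hb S hbi hn
    · obtain ⟨A, B, x, hsp⟩ := hS.exists_isSplit hn.nonempty hbi
      have h1 := hsp.ncard
      have h2 := Set.one_lt_ncard_iff_nontrivial.2 hsp.left_nontrivial
      have h3 := Set.one_lt_ncard_iff_nontrivial.2 hsp.right_nontrivial
      exact hs S A B x hsp (ih _ (by omega) hsp.left_connected hsp.left_nontrivial rfl)
        (ih _ (by omega) hsp.right_connected hsp.right_nontrivial rfl)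

/-- The number of blocks of the subgraph induced on `S` whose vertex set satisfies `P`. -/
noncomputable def countBlocks (G : SimpleGraph V) (S : Set V) (P : Set V → Prop) : ℕ :=
  {T | IsBlockSet G S T ∧ P T}.ncard

theorem Biconnected.countBlocks_eq_one {S : Set V} {P : Set V → Prop} (hS : Biconnected G S)
    (hP : P S) : countBlocks G S P = 1 := by
  rw [countBlocks, Set.ncard_eq_one]
  refine ⟨S, ?_⟩
  ext T
  constructor
  · exact fun h => hS.isBlockSet_iff.1 h.1
  · rintro rfl
    exact ⟨hS.isBlockSet_iff.2 rfl, hP⟩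

theorem Biconnected.countBlocks_eq_zero {S : Set V} {P : Set V → Prop} (hS : Biconnected G S)
    (hP : ¬ P S) : countBlocks G S P = 0 := by
  have : {T | IsBlockSet G S T ∧ P T} = ∅ := by
    ext T
    constructor
    · rintro ⟨h1, h2⟩
      exact hP (hS.isBlockSet_iff.1 h1 ▸ h2)
    · exact fun h => h.elim
  rw [countBlocks, this, Set.ncard_empty]

theorem IsSplit.countBlocks [Finite V] {S A B : Set V} {x : V} (h : IsSplit G S A B x)
    (P : Set V → Prop) : countBlocks G S P = countBlocks G A P + countBlocks G B P :=
  h.ncard_blockSets P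

/-- The relations between order, number of blocks and number of even blocks: a block of order `k`
contributes `k - 1` to the order minus one. -/
theorem ConnectedOn.card_blocks [Finite V] {S : Set V} (hS : ConnectedOn G S) (hn : S.Nontrivial) :
    let q := countBlocks G S (fun _ => True)
    let r := countBlocks G S (fun T => Even T.ncard)
    2 * q + 1 ≤ S.ncard + r ∧ Odd (S.ncard + r) ∧ r ≤ q ∧ 1 ≤ q := by
  refine hS.block_induction (P := fun S => 2 * countBlocks G S (fun _ => True) + 1 ≤
    S.ncard + countBlocks G S (fun T => Even T.ncard) ∧
    Odd (S.ncard + countBlocks G S (fun T => Even T.ncard)) ∧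
    countBlocks G S (fun T => Even T.ncard) ≤ countBlocks G S (fun _ => True) ∧
    1 ≤ countBlocks G S (fun _ => True)) ?_ ?_ hn
  · intro S hS hn
    have h1 := Set.one_lt_ncard_iff_nontrivial.2 hn
    rw [hS.countBlocks_eq_one trivial]
    by_cases he : Even S.ncard
    · rw [hS.countBlocks_eq_one (P := fun T => Even T.ncard) he]
      exact ⟨by omega, he.add_one, le_rfl, le_rfl⟩
    · rw [hS.countBlocks_eq_zero (P := fun T => Even T.ncard) he]
      rw [Nat.not_even_iff_odd] at he
      refine ⟨?_, he, by omega, le_rfl⟩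
      obtain ⟨j, hj⟩ := he
      omega
  · intro S A B x hsp hA hB
    rw [hsp.countBlocks, hsp.countBlocks]
    have := hsp.ncard
    obtain ⟨a1, ⟨i, hi⟩, a3, a4⟩ := hA
    obtain ⟨b1, ⟨j, hj⟩, b3, b4⟩ := hB
    exact ⟨by omega, ⟨i + j, by omega⟩, by omega, by omega⟩

/-! ### Gluing colourings at cut vertices -/

/-- An edge lies on one side of a split only, so colourings of the two sides have a common
extension. -/
theorem IsSplit.exists_glue {S A B : Set V} {x : V} (h : IsSplit G S A B x)
    (cA cB : Sym2 V → ℕ) : ∃ c : Sym2 V → ℕ,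
      (∀ u w X, RainbowLink G cA A u w X → RainbowLink G c S u w X) ∧
      (∀ u w X, RainbowLink G cB B u w X → RainbowLink G c S u w X) := by
  classical
  refine ⟨fun e => if ∀ y ∈ e, y ∈ A then cA e else cB e, ?_, ?_⟩
  · intro u w X hl
    refine hl.congr h.left_subset fun a ha b hb _ => ?_
    rw [if_pos]
    intro y hy
    rcases Sym2.mem_iff.1 hy with rfl | rfl <;> assumption
  · intro u w X hl
    refine hl.congr h.right_subset fun a ha b hb hab => ?_
    rw [if_neg]
    intro hy
    exact hab.ne ((h.eq_of_mem a (hy a (Sym2.mem_mk_left a b)) ha).trans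
      (h.eq_of_mem b (hy b (Sym2.mem_mk_right a b)) hb).symm)

/-- Colourings of the two sides of a split, the side without the root being rooted at the common
vertex, combine: they share colour `0` only. -/
theorem IsSplit.exists_valid {S A B : Set V} {x v : V} {cA cB : Sym2 V → ℕ} {k l : ℕ}
    (h : IsSplit G S A B x) (hA : Valid G cA A v k) (hB : Valid G cB B x l) :
    ∃ c, Valid G c S v (k + l) := by
  obtain ⟨c, h1, h2⟩ := h.exists_glue cA (fun e => if cB e = 0 then 0 else cB e + k)
  have rB : ∀ u ∈ B, RainbowLink G c S x u (fun n => k < n ∧ n ≤ k + l) := fun u hu =>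
    h2 _ _ _ ((hB.root u hu).recolor (fun n => if n = 0 then 0 else n + k)
      (fun m n hm hn e => by split_ifs at e <;> omega)
      (fun n hn => by split_ifs <;> omega))
  have aB : ∀ u ∈ B, ∀ w ∈ B, RainbowLink G c S u w (fun n => n ≤ k + l) := fun u hu w hw =>
    h2 _ _ _ ((hB.all u hu w hw).recolor (fun n => if n = 0 then 0 else n + k)
      (fun m n hm hn e => by split_ifs at e <;> omega)
      (fun n hn => by split_ifs <;> omega))
  have aAB : ∀ u ∈ A, ∀ w ∈ B, RainbowLink G c S u w (fun n => n ≤ k + l) := fun u hu w hw =>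
    (h1 _ _ _ (hA.all u hu x h.mem_left)).trans (rB w hw) (fun n h h' => by omega)
      (fun n h => by omega) (fun n h => by omega)
  refine ⟨c, h.left_subset hA.mem, ?_, ?_⟩
  · intro u hu
    rw [h.union] at hu
    rcases hu with hu | hu
    · exact (h1 _ _ _ (hA.root u hu)).mono fun n h => by omega
    · exact (h1 _ _ _ (hA.root x h.mem_left)).trans (rB u hu) (fun n h h' => by omega)
        (fun n h => by omega) (fun n h => by omega)
  · intro u hu w hw
    rw [h.union] at hu hw
    rcases hu with hu | hu <;> rcases hw with hw | hw
    · exact (h1 _ _ _ (hA.all u hu w hw)).mono fun n h => by omega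
    · exact aAB u hu w hw
    · exact (aAB w hw u hu).symm
    · exact aB u hu w hw

/-- Every connected set `S` with `r` even blocks has a colouring with the colours
`0, …, (|S| + r - 1) / 2` in which no link of the root needs colour `0`. -/
theorem ConnectedOn.exists_valid [Finite V] {S : Set V} (hS : ConnectedOn G S)
    (hn : S.Nontrivial) {v : V} (hv : v ∈ S) :
    ∃ c, Valid G c S v ((S.ncard + countBlocks G S (fun T => Even T.ncard) - 1) / 2) := by
  refine hS.block_induction (P := fun S => ∀ v, v ∈ S →
    ∃ c, Valid G c S v ((S.ncard + countBlocks G S (fun T => Even T.ncard) - 1) / 2)) ?_ ?_ hn v hv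
  · intro S hS hn v hv
    obtain ⟨c, hc⟩ := hS.exists_valid hv
    refine ⟨c, hc.mono ?_⟩
    by_cases he : Even S.ncard
    · rw [hS.countBlocks_eq_one (P := fun T => Even T.ncard) he]
      omega
    · rw [hS.countBlocks_eq_zero (P := fun T => Even T.ncard) he]
      rw [Nat.not_even_iff_odd] at he
      obtain ⟨j, hj⟩ := he
      omega
  · intro S A B x hsp hA hB v hv
    have h1 := (hsp.left_connected.card_blocks hsp.left_nontrivial).2.1
    have h2 := (hsp.right_connected.card_blocks hsp.right_nontrivial).2.1
    have h3 := hsp.ncard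
    rw [hsp.countBlocks]
    obtain ⟨i, hi⟩ := h1
    obtain ⟨j, hj⟩ := h2
    have hv' := hv
    rw [hsp.union] at hv'
    rcases hv' with hv' | hv'
    · obtain ⟨cA, hA⟩ := hA v hv'
      obtain ⟨cB, hB⟩ := hB x hsp.mem_right
      obtain ⟨c, hc⟩ := hsp.exists_valid hA hB
      exact ⟨c, hc.mono (by omega)⟩
    · obtain ⟨cA, hA⟩ := hA x hsp.mem_left
      obtain ⟨cB, hB⟩ := hB v hv'
      obtain ⟨c, hc⟩ := hsp.symm.exists_valid hB hA
      exact ⟨c, hc.mono (by omega)⟩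

/-- When both sides of a split are rooted at the cut vertex, links between the sides need no
colour `0`, so on each side the colour `0` can be replaced by a colour of the other side. -/
theorem IsSplit.exists_coloring {S A B : Set V} {x : V} {cA cB : Sym2 V → ℕ} {k l : ℕ}
    (h : IsSplit G S A B x) (hA : Valid G cA A x k) (hB : Valid G cB B x l) (hk : 1 ≤ k)
    (hl : 1 ≤ l) : ∃ c, ∀ u ∈ S, ∀ w ∈ S, RainbowLink G c S u w (fun n => n < k + l) := by
  obtain ⟨c, h1, h2⟩ := h.exists_glue (fun e => if cA e = 0 then k else cA e - 1)
    (fun e => if cB e = 0 then 0 else cB e + k - 1)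
  have aA : ∀ u ∈ A, ∀ w ∈ A, RainbowLink G c S u w (fun n => n < k + l) := fun u hu w hw =>
    h1 _ _ _ ((hA.all u hu w hw).recolor (fun n => if n = 0 then k else n - 1)
      (fun m n hm hn e => by split_ifs at e <;> omega)
      (fun n hn => by split_ifs <;> omega))
  have aB : ∀ u ∈ B, ∀ w ∈ B, RainbowLink G c S u w (fun n => n < k + l) := fun u hu w hw =>
    h2 _ _ _ ((hB.all u hu w hw).recolor (fun n => if n = 0 then 0 else n + k - 1)
      (fun m n hm hn e => by split_ifs at e <;> omega)
      (fun n hn => by split_ifs <;> omega))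
  have rA : ∀ u ∈ A, RainbowLink G c S x u (fun n => n < k) := fun u hu =>
    h1 _ _ _ ((hA.root u hu).recolor (fun n => if n = 0 then k else n - 1)
      (fun m n hm hn e => by split_ifs at e <;> omega)
      (fun n hn => by split_ifs <;> omega))
  have rB : ∀ u ∈ B, RainbowLink G c S x u (fun n => k ≤ n ∧ n < k + l) := fun u hu =>
    h2 _ _ _ ((hB.root u hu).recolor (fun n => if n = 0 then 0 else n + k - 1)
      (fun m n hm hn e => by split_ifs at e <;> omega)
      (fun n hn => by split_ifs <;> omega))
  have aAB : ∀ u ∈ A, ∀ w ∈ B, RainbowLink G c S u w (fun n => n < k + l) := fun u hu w hw =>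
    (rA u hu).symm.trans (rB w hw) (fun n h h' => by omega) (fun n h => by omega)
      (fun n h => by omega)
  refine ⟨c, fun u hu w hw => ?_⟩
  rw [h.union] at hu hw
  rcases hu with hu | hu <;> rcases hw with hw | hw
  exacts [aA u hu w hw, aAB u hu w hw, (aAB w hw u hu).symm, aB u hu w hw]

/-! ### Blocks as subgraphs and blocks as vertex sets -/

theorem Linked.of_hom {W : Type*} {K : SimpleGraph W} {T : Set V} {a b : W} (f : K →g G)
    (hf : ∀ z, f z ∈ T) (h : K.Reachable a b) : Linked G T (f a) (f b) := by
  obtain ⟨p⟩ := h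
  refine ⟨p.map f, fun x hx => ?_⟩
  rw [SimpleGraph.Walk.support_map] at hx
  obtain ⟨z, -, rfl⟩ := List.mem_map.1 hx
  exact hf z

/-- A walk inside `T` carries over to any graph that receives the induced subgraph on `T`. -/
theorem Linked.reachable {W : Type*} {K : SimpleGraph W} {T : Set V} {u w : V}
    (h : Linked G T u w) (f : G.induce T →g K) :
    K.Reachable (f ⟨u, h.left_mem⟩) (f ⟨w, h.right_mem⟩) := by
  obtain ⟨p, hp⟩ := h
  exact ⟨(p.induce T hp).map f⟩

theorem biconnected_verts {H : G.Subgraph} (hH : H.Connected)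
    (hcut : ∀ v : H.verts, ¬ IsCutVertex H.coe v) : Biconnected G H.verts where
  nonempty := hH.nonempty
  connectedOn u hu w hw :=
    .of_hom H.hom (fun z => z.2) (hH.coe.preconnected ⟨u, hu⟩ ⟨w, hw⟩)
  connectedOn_diff x hx u hu w hw := by
    by_contra hno
    have key : ∀ y ∈ H.verts \ {x}, ∃ z : ({⟨x, hx⟩}ᶜ : Set H.verts), (z : V) = y :=
      fun y hy => ⟨⟨⟨y, hy.1⟩, fun e => hy.2 (congrArg Subtype.val e)⟩, rfl⟩
    obtain ⟨u, rfl⟩ := key u hu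
    obtain ⟨w, rfl⟩ := key w hw
    refine hcut ⟨x, hx⟩ ⟨u, w, hH.coe.preconnected _ _, fun h => hno ?_⟩
    exact Linked.of_hom (T := H.verts \ {x}) (H.hom.comp (SimpleGraph.Embedding.induce _).toHom)
      (fun z => ⟨z.1.2, fun e => z.2 (Subtype.ext e)⟩) h

theorem Biconnected.connected_induce {T : Set V} (hT : Biconnected G T) :
    ((⊤ : G.Subgraph).induce T).Connected := by
  rw [SimpleGraph.Subgraph.connected_iff']
  have := hT.nonempty.to_subtype
  have h : (G.induce T).Connected :=
    ⟨fun u w => (hT.connectedOn u u.2 w w.2).reachable SimpleGraph.Hom.id⟩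
  rwa [SimpleGraph.induce_eq_coe_induce_top] at h

theorem Biconnected.not_isCutVertex {T : Set V} (hT : Biconnected G T)
    (v : ((⊤ : G.Subgraph).induce T).verts) :
    ¬ IsCutVertex ((⊤ : G.Subgraph).induce T).coe v := by
  rintro ⟨u, w, -, h⟩
  have hne : ∀ z : ({v}ᶜ : Set ((⊤ : G.Subgraph).induce T).verts), (z : V) ∈ T \ {(v : V)} :=
    fun z => ⟨z.1.2, fun e => z.2 (Subtype.ext e)⟩
  let f : G.induce (T \ {(v : V)}) →g (((⊤ : G.Subgraph).induce T).coe.induce {v}ᶜ) :=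
    { toFun := fun z => ⟨⟨z, z.2.1⟩, fun e => z.2.2 (congrArg Subtype.val e)⟩
      map_rel' := fun {a b} hab => ⟨a.2.1, b.2.1, hab⟩ }
  exact h ((hT.connectedOn_diff v v.2 u (hne u) w (hne w)).reachable f)

/-- Blocks are induced subgraphs, determined by their vertex sets. -/
theorem isBlock_iff {B : G.Subgraph} :
    IsBlock B ↔ IsBlockSet G Set.univ B.verts ∧ B = (⊤ : G.Subgraph).induce B.verts := by
  constructor
  · intro h
    have hB := biconnected_verts h.prop.1 h.prop.2
    have key : ∀ T, Biconnected G T → B.verts ⊆ T → (⊤ : G.Subgraph).induce T ≤ B :=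
      fun T hT hBT => h.le_of_ge ⟨hT.connected_induce, hT.not_isCutVertex⟩
        (SimpleGraph.Subgraph.le_induce_top_verts.trans
          (SimpleGraph.Subgraph.induce_mono_right hBT))
    exact ⟨⟨⟨Set.subset_univ _, hB⟩, fun T hT hBT => (key T hT.2 hBT).1⟩,
      SimpleGraph.Subgraph.le_induce_top_verts.antisymm (key _ hB subset_rfl)⟩
  · rintro ⟨h, hB⟩
    refine ⟨?_, fun H hH hBH => ?_⟩
    · have := h.prop.2
      rw [hB]
      exact ⟨this.connected_induce, this.not_isCutVertex⟩
    · have h1 := h.le_of_ge ⟨Set.subset_univ _, biconnected_verts hH.1 hH.2⟩ hBH.1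
      rw [hB]
      exact SimpleGraph.Subgraph.le_induce_top_verts.trans
        (SimpleGraph.Subgraph.induce_mono_right h1)

theorem isBlock_induce {T : Set V} (hT : IsBlockSet G Set.univ T) :
    IsBlock ((⊤ : G.Subgraph).induce T) :=
  isBlock_iff.2 ⟨hT, rfl⟩

theorem ncard_isBlock (P : Set V → Prop) :
    {B : G.Subgraph | IsBlock B ∧ P B.verts}.ncard = countBlocks G Set.univ P := by
  rw [countBlocks, ← Set.ncard_image_of_injective (f := fun T => (⊤ : G.Subgraph).induce T) _
    (fun T T' h => congrArg SimpleGraph.Subgraph.verts h)]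
  congr 1
  ext B
  constructor
  · rintro ⟨h1, h2⟩
    obtain ⟨h3, h4⟩ := isBlock_iff.1 h1
    exact ⟨B.verts, ⟨h3, h2⟩, h4.symm⟩
  · rintro ⟨T, ⟨h1, h2⟩, rfl⟩
    exact ⟨isBlock_induce h1, h2⟩

theorem numBlocks_eq : numBlocks G = countBlocks G Set.univ (fun _ => True) := by
  rw [← ncard_isBlock, numBlocks]
  simp

theorem numEvenBlocks_eq : numEvenBlocks G = countBlocks G Set.univ (fun T => Even T.ncard) :=
  ncard_isBlock (fun T => Even T.ncard)

theorem connectedOn_univ (hG : G.Connected) : ConnectedOn G Set.univ := fun u _ w _ => by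
  obtain ⟨p⟩ := hG.preconnected u w
  exact ⟨p, fun _ _ => trivial⟩

/-- The relations between order, number of blocks and number of even blocks of a connected
graph. -/
theorem card_numBlocks [Finite V] [Nontrivial V] (hG : G.Connected) :
    2 * numBlocks G + 1 ≤ Nat.card V + numEvenBlocks G ∧ Odd (Nat.card V + numEvenBlocks G) ∧
      numEvenBlocks G ≤ numBlocks G := by
  obtain ⟨h1, h2, h3, -⟩ := (connectedOn_univ hG).card_blocks Set.nontrivial_univ
  rw [Set.ncard_univ] at h1 h2
  rw [numBlocks_eq, numEvenBlocks_eq]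
  exact ⟨h1, h2, h3⟩

/-! ### The upper bound -/

theorem rc_le_of_rainbowLink {K : ℕ} (hK : 0 < K) {c : Sym2 V → ℕ}
    (h : ∀ u w, RainbowLink G c Set.univ u w (fun n => n < K)) : rc G ≤ K := by
  classical
  -- Colours outside the range are never used by a link and are replaced by `0`.
  refine Nat.sInf_le ⟨fun e => if he : c e < K then ⟨c e, he⟩ else ⟨0, hK⟩, fun u w => ?_⟩
  obtain ⟨p, -, h2, h3⟩ := h u w
  refine ⟨p.bypass, p.bypass_isPath, fun e f he hf hef => ?_⟩
  have he := p.edges_bypass_sublist_edges.subset he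
  have hf := p.edges_bypass_sublist_edges.subset hf
  have he' : c e < K := h3 e he
  have hf' : c f < K := h3 f hf
  simp only [he', hf', dite_true] at hef
  exact Subtype.ext (List.inj_on_of_nodup_map h2 he hf (congrArg Fin.val hef))

/-- The graph is split at a cut vertex and both sides are coloured with that vertex as root, which
saves one colour compared with a rooted colouring of the whole graph. -/
theorem two_mul_rc_lt [Finite V] [Nontrivial V] (hG : G.Connected) (hq : 2 ≤ numBlocks G) :
    2 * rc G < Nat.card V + numEvenBlocks G := by
  have hS := connectedOn_univ hG
  have hb : ¬ Biconnected G Set.univ := fun hb => by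
    rw [numBlocks_eq, hb.countBlocks_eq_one trivial] at hq
    omega
  obtain ⟨A, B, x, hsp⟩ := hS.exists_isSplit Set.univ_nonempty hb
  obtain ⟨cA, hA⟩ := hsp.left_connected.exists_valid hsp.left_nontrivial hsp.mem_left
  obtain ⟨cB, hB⟩ := hsp.right_connected.exists_valid hsp.right_nontrivial hsp.mem_right
  obtain ⟨a1, ⟨i, hi⟩, -, a4⟩ := hsp.left_connected.card_blocks hsp.left_nontrivial
  obtain ⟨b1, ⟨j, hj⟩, -, b4⟩ := hsp.right_connected.card_blocks hsp.right_nontrivial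
  obtain ⟨c, hc⟩ := hsp.exists_coloring hA hB (by omega) (by omega)
  have h1 := rc_le_of_rainbowLink (by omega) fun u w => hc u trivial w trivial
  have h2 := hsp.ncard
  rw [Set.ncard_univ] at h2
  rw [numEvenBlocks_eq, hsp.countBlocks]
  omega

/-! ### Diameter and rainbow connection number -/

/-- A rainbow path has at most as many edges as there are colours. -/
theorem dist_le_rc [Finite V] (hG : G.Connected) (u w : V) : G.dist u w ≤ rc G := by
  obtain ⟨c, hc⟩ := rc_spec G hG
  obtain ⟨p, hp, hr⟩ := hc u w
  refine (SimpleGraph.dist_le p).trans ?_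
  have hnd : (p.edges.attach.map fun e : {e // e ∈ p.edges} =>
      c ⟨e, p.edges_subset_edgeSet e.2⟩).Nodup := by
    refine List.Nodup.map_on ?_ (List.nodup_attach.2 hp.isTrail.edges_nodup)
    intro e _ f _ hef
    exact Subtype.ext (Subtype.mk.inj (hr _ _ e.2 f.2 hef))
  simpa using hnd.length_le_card

theorem diam_le_rc [Finite V] [Nonempty V] (hG : G.Connected) : G.diam ≤ rc G := by
  obtain ⟨u, w, h⟩ := G.exists_dist_eq_diam
  exact h ▸ dist_le_rc hG u w

/-- A potential that changes by at most one along every edge bounds distances from below. -/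
theorem le_dist_of_potential (hG : G.Connected) (φ : V → ℕ)
    (hφ : ∀ u w, G.Adj u w → φ w ≤ φ u + 1) (u w : V) : φ w ≤ φ u + G.dist u w := by
  obtain ⟨p, hp⟩ := hG.exists_walk_length_eq_dist u w
  rw [← hp]
  clear hp
  induction p with
  | nil => simp
  | cons h p ih =>
    have := hφ _ _ h
    rw [SimpleGraph.Walk.length_cons]
    omega

/-! ### Intervals of consecutive vertices -/

/-- The vertices `l, …, h` of a graph on `0, …, n - 1`. -/
def interval (n l h : ℕ) : Set (Fin n) := {x | l ≤ (x : ℕ) ∧ (x : ℕ) ≤ h}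

section Interval

variable {n l p h m : ℕ} {H : SimpleGraph (Fin n)}

theorem connectedOn_interval (hH : ∀ i j : Fin n, (i : ℕ) + 1 = j → H.Adj i j) (l h : ℕ) :
    ConnectedOn H (interval n l h) := by
  have key : ∀ d : ℕ, ∀ u w : Fin n, (u : ℕ) + d = w → l ≤ (u : ℕ) → (w : ℕ) ≤ h →
      Linked H (interval n l h) u w := by
    intro d
    induction d with
    | zero =>
      intro u w hd hu hw
      obtain rfl : u = w := Fin.ext hd
      exact .refl ⟨hu, hw⟩
    | succ d ih =>
      intro u w hd hu hw
      have hlt : (u : ℕ) + d < n := by omega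
      exact (ih u ⟨u + d, hlt⟩ rfl hu (by simp only; omega)).trans
        (.of_adj (hH _ _ (by simp only; omega)) ⟨by simp only; omega, by simp only; omega⟩
          ⟨by omega, hw⟩)
  intro u hu w hw
  rcases le_total (u : ℕ) w with h' | h'
  · exact key (w - u) u w (by omega) hu.1 hw.2
  · exact (key (u - w) w u (by omega) hw.1 hu.2).symm

/-- An interval whose ends are adjacent carries a Hamiltonian cycle, or is an edge. -/
theorem biconnected_interval (hH : ∀ i j : Fin n, (i : ℕ) + 1 = j → H.Adj i j) (hlh : l < h)
    (hl : l < n) (hh : h < n) (hadj : H.Adj ⟨l, hl⟩ ⟨h, hh⟩) : Biconnected H (interval n l h) where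
  nonempty := ⟨⟨l, hl⟩, le_rfl, hlh.le⟩
  connectedOn := connectedOn_interval hH l h
  connectedOn_diff := by
    intro x hx
    by_cases hxl : (x : ℕ) = l
    · intro u hu w hw
      have aux : ∀ y ∈ interval n l h \ {x}, y ∈ interval n (l + 1) h := by
        intro y hy
        have : (y : ℕ) ≠ x := fun e => hy.2 (Fin.ext e)
        have := hy.1.1
        exact ⟨by omega, hy.1.2⟩
      refine (connectedOn_interval hH (l + 1) h u (aux u hu) w (aux w hw)).mono ?_
      rintro y ⟨h1, h2⟩
      refine ⟨⟨by omega, h2⟩, ?_⟩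
      rintro rfl
      omega
    · obtain ⟨hx1, hx2⟩ := hx
      have hlx : (⟨l, hl⟩ : Fin n) ∈ interval n l h \ {x} :=
        ⟨⟨le_rfl, hlh.le⟩, fun e => hxl (congrArg Fin.val e).symm⟩
      have key : ∀ u ∈ interval n l h \ {x}, Linked H (interval n l h \ {x}) u ⟨l, hl⟩ := by
        rintro u ⟨⟨h1, h2⟩, h3⟩
        have : (u : ℕ) ≠ x := fun e => h3 (Fin.ext e)
        rcases Nat.lt_or_ge u x with h4 | h4
        · refine (connectedOn_interval hH l (x - 1) u ⟨h1, by omega⟩ ⟨l, hl⟩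
            ⟨le_rfl, by simp only; omega⟩).mono ?_
          rintro y ⟨h5, h6⟩
          refine ⟨⟨h5, by omega⟩, ?_⟩
          rintro rfl
          omega
        · have hhx : (⟨h, hh⟩ : Fin n) ∈ interval n l h \ {x} := by
            refine ⟨⟨hlh.le, le_rfl⟩, ?_⟩
            rintro rfl
            simp only at *
            omega
          refine Linked.trans ((connectedOn_interval hH (x + 1) h u ⟨by omega, h2⟩ ⟨h, hh⟩
            ⟨by simp only; omega, le_rfl⟩).mono ?_) (.of_adj hadj.symm hhx hlx)
          rintro y ⟨h5, h6⟩
          refine ⟨⟨by omega, h6⟩, ?_⟩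
          rintro rfl
          omega
      exact fun u hu w hw => (key u hu).trans (key w hw).symm

theorem isSplit_interval (hH : ∀ i j : Fin n, (i : ℕ) + 1 = j → H.Adj i j) (hlp : l < p)
    (hph : p < h) (hh : h < n)
    (hcut : ∀ i j : Fin n, (i : ℕ) < p → p < (j : ℕ) → ¬ H.Adj i j) :
    IsSplit H (interval n l h) (interval n l p) (interval n p h) ⟨p, hph.trans hh⟩ where
  union := by
    ext x
    simp only [interval, Set.mem_ofPred_eq, Set.mem_union]
    omega
  mem_left := ⟨hlp.le, le_rfl⟩
  mem_right := ⟨le_rfl, hph.le⟩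
  eq_of_mem y hy hy' := Fin.ext (le_antisymm hy.2 hy'.1)
  not_adj a ha b hb hap hbp := by
    have h1 : (a : ℕ) ≠ p := fun e => hap (Fin.ext e)
    have h2 : (b : ℕ) ≠ p := fun e => hbp (Fin.ext e)
    exact hcut a b (lt_of_le_of_ne ha.2 h1) (lt_of_le_of_ne hb.1 h2.symm)
  left_connected := connectedOn_interval hH l p
  right_connected := connectedOn_interval hH p h
  left_nontrivial := ⟨⟨l, by omega⟩, ⟨le_rfl, hlp.le⟩, ⟨p, by omega⟩, ⟨hlp.le, le_rfl⟩,
    fun e => hlp.ne (congrArg Fin.val e)⟩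
  right_nontrivial := ⟨⟨p, by omega⟩, ⟨le_rfl, hph.le⟩, ⟨h, by omega⟩, ⟨hph.le, le_rfl⟩,
    fun e => hph.ne (congrArg Fin.val e)⟩

theorem Biconnected.countBlocks {S : Set V} (hS : Biconnected G S) (P : Set V → Prop)
    [Decidable (P S)] : countBlocks G S P = if P S then 1 else 0 := by
  split_ifs with hP
  exacts [hS.countBlocks_eq_one hP, hS.countBlocks_eq_zero hP]

theorem ncard_interval (hlh : l ≤ h) (hh : h < n) : (interval n l h).ncard = h + 1 - l := by
  have : interval n l h = (Finset.Icc (⟨l, by omega⟩ : Fin n) ⟨h, hh⟩ : Set (Fin n)) := by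
    ext x
    simp [interval, Fin.le_def]
  rw [this, Set.ncard_coe_finset, Fin.card_Icc]

/-- An interval whose edges join consecutive vertices or its two ends is a cycle (or `K₂`, as
`SimpleGraph.cycleGraph 2`). -/
theorem nonempty_iso_cycleGraph (hm : 2 ≤ m) (hh : l + m = h + 1) (hn : h < n)
    (hadj : ∀ i j : Fin n, l ≤ (i : ℕ) → (i : ℕ) < j → (j : ℕ) ≤ h →
      (H.Adj i j ↔ (i : ℕ) + 1 = j ∨ ((i : ℕ) = l ∧ (j : ℕ) = h))) :
    Nonempty (((⊤ : H.Subgraph).induce (interval n l h)).coe ≃g SimpleGraph.cycleGraph m) := by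
  have key : ∀ i j : Fin n, ∀ hi : l ≤ (i : ℕ), ∀ hij : (i : ℕ) < j, ∀ hj : (j : ℕ) ≤ h,
      ((SimpleGraph.cycleGraph m).Adj ⟨i - l, by omega⟩ ⟨j - l, by omega⟩ ↔ H.Adj i j) := by
    intro i j hi hij hj
    have h1 : (⟨i - l, by omega⟩ : Fin m) < ⟨j - l, by omega⟩ := by
      rw [Fin.lt_def]
      simp only
      omega
    rw [hadj i j hi hij hj, SimpleGraph.cycleGraph_adj', Fin.sub_val_of_le h1.le,
      Fin.coe_sub_iff_lt.2 h1]
    simp only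
    omega
  refine ⟨⟨⟨fun x => ⟨(x : Fin n) - l, ?_⟩, fun y => ⟨⟨y + l, by omega⟩, ?_⟩, ?_, ?_⟩, ?_⟩⟩
  · have := x.2.1
    have := x.2.2
    omega
  · exact ⟨by simp, by simp only; omega⟩
  · intro x
    have := x.2.1
    refine Subtype.ext (Fin.ext ?_)
    simp only
    omega
  · intro y
    simp
  · rintro ⟨x, hx⟩ ⟨y, hy⟩
    have hxy : ((⊤ : H.Subgraph).induce (interval n l h)).coe.Adj ⟨x, hx⟩ ⟨y, hy⟩ ↔ H.Adj x y :=
      ⟨fun h => h.2.2, fun h => ⟨hx, hy, h⟩⟩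
    rw [hxy]
    simp only [Equiv.coe_fn_mk]
    rcases lt_trichotomy (x : ℕ) y with h' | h' | h'
    · exact key x y hx.1 h' hy.2
    · obtain rfl := Fin.ext h'
      simp
    · rw [SimpleGraph.adj_comm, H.adj_comm]
      exact key y x hy.1 h' hx.2

end Interval

/-! ### Chains of edges and triangles ending in a cycle -/

/-- The graph on `0, …, n - 1` in which consecutive vertices are adjacent, with the chords that
turn `a + 2l, a + 2l + 1, a + 2l + 2` into a triangle for `l < b` and the vertices from `a + 2b`
on into a cycle. Its blocks are `a` edges, `b` triangles and this cycle, in a row. -/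
def blockChain (n a b : ℕ) : SimpleGraph (Fin n) :=
  SimpleGraph.fromRel fun i j => (i : ℕ) + 1 = j ∨
    (∃ l < b, (i : ℕ) = a + 2 * l ∧ (j : ℕ) = a + 2 * l + 2) ∨ ((i : ℕ) = a + 2 * b ∧ (j : ℕ) + 1 = n)

section BlockChain

variable {n a b m : ℕ}

theorem blockChain_adj_of_lt {i j : Fin n} (hij : (i : ℕ) < j) : (blockChain n a b).Adj i j ↔
    (i : ℕ) + 1 = j ∨ (∃ l < b, (i : ℕ) = a + 2 * l ∧ (j : ℕ) = a + 2 * l + 2) ∨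
      ((i : ℕ) = a + 2 * b ∧ (j : ℕ) + 1 = n) := by
  rw [blockChain, SimpleGraph.fromRel_adj]
  constructor
  · rintro ⟨-, h | h | ⟨l, -, h1, h2⟩ | ⟨h1, h2⟩⟩
    · exact h
    all_goals have := i.isLt; omega
  · exact fun h => ⟨fun e => hij.ne (congrArg Fin.val e), Or.inl h⟩

theorem blockChain_adj_succ {i j : Fin n} (h : (i : ℕ) + 1 = j) : (blockChain n a b).Adj i j :=
  (blockChain_adj_of_lt (by omega)).2 (Or.inl h)

theorem connected_blockChain [NeZero n] : (blockChain n a b).Connected := by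
  have : Nonempty (Fin n) := ⟨0⟩
  refine ⟨fun u w => ?_⟩
  obtain ⟨p, -⟩ := connectedOn_interval (fun _ _ => blockChain_adj_succ (a := a) (b := b)) 0 n u
    ⟨Nat.zero_le _, u.isLt.le⟩ w ⟨Nat.zero_le _, w.isLt.le⟩
  exact ⟨p⟩

theorem biconnected_edge {p : ℕ} (hp : p + 1 < n) :
    Biconnected (blockChain n a b) (interval n p (p + 1)) :=
  biconnected_interval (fun _ _ => blockChain_adj_succ) (by omega) (by omega) hp
    (blockChain_adj_succ rfl)

theorem biconnected_triangle {l : ℕ} (hl : l < b) (hn : a + 2 * l + 2 < n) :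
    Biconnected (blockChain n a b) (interval n (a + 2 * l) (a + 2 * l + 2)) :=
  biconnected_interval (fun _ _ => blockChain_adj_succ) (by omega) (by omega) hn
    ((blockChain_adj_of_lt (by simp)).2 (Or.inr (Or.inl ⟨l, hl, rfl, rfl⟩)))

theorem biconnected_cycle (hn : a + 2 * b + 2 ≤ n) :
    Biconnected (blockChain n a b) (interval n (a + 2 * b) (n - 1)) :=
  biconnected_interval (fun _ _ => blockChain_adj_succ) (by omega) (by omega) (by omega)
    ((blockChain_adj_of_lt (by simp only; omega)).2 (Or.inr (Or.inr ⟨rfl, by simp only; omega⟩)))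

theorem isSplit_edge {p : ℕ} (hp : p < a) (hn : a + 2 * b + 2 ≤ n) :
    IsSplit (blockChain n a b) (interval n p (n - 1)) (interval n p (p + 1))
      (interval n (p + 1) (n - 1)) ⟨p + 1, by omega⟩ := by
  refine isSplit_interval (fun _ _ => blockChain_adj_succ) (by omega) (by omega) (by omega) ?_
  intro i j hi hj
  rw [blockChain_adj_of_lt (by omega)]
  rintro (h | ⟨l, -, h1, h2⟩ | ⟨h1, h2⟩) <;> omega

theorem isSplit_triangle {l : ℕ} (hl : l < b) (hn : a + 2 * b + 2 ≤ n) :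
    IsSplit (blockChain n a b) (interval n (a + 2 * l) (n - 1))
      (interval n (a + 2 * l) (a + 2 * l + 2)) (interval n (a + 2 * (l + 1)) (n - 1))
      ⟨a + 2 * (l + 1), by omega⟩ := by
  refine isSplit_interval (fun _ _ => blockChain_adj_succ) (by omega) (by omega) (by omega) ?_
  intro i j hi hj
  rw [blockChain_adj_of_lt (by omega)]
  rintro (h | ⟨l, -, h1, h2⟩ | ⟨h1, h2⟩) <;> omega

/-- The blocks of a block chain are split off one after the other. -/
theorem countBlocks_blockChain (hn : a + 2 * b + 2 ≤ n) (P : Set (Fin n) → Prop)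
    [DecidablePred P] : countBlocks (blockChain n a b) Set.univ P =
      ∑ p ∈ Finset.range a, (if P (interval n p (p + 1)) then 1 else 0) +
      ∑ l ∈ Finset.range b, (if P (interval n (a + 2 * l) (a + 2 * l + 2)) then 1 else 0) +
      if P (interval n (a + 2 * b) (n - 1)) then 1 else 0 := by
  have h0 : (Set.univ : Set (Fin n)) = interval n 0 (n - 1) := by
    ext x
    simp only [Set.mem_univ, interval, Set.mem_ofPred_eq, true_iff]
    omega
  have hA : ∀ k, k ≤ a → countBlocks (blockChain n a b) Set.univ P =
      ∑ p ∈ Finset.range k, (if P (interval n p (p + 1)) then 1 else 0) +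
        countBlocks (blockChain n a b) (interval n k (n - 1)) P := by
    intro k
    induction k with
    | zero => simp [h0]
    | succ k ih =>
      intro hk
      rw [ih (by omega), (isSplit_edge hk hn).countBlocks, (biconnected_edge (by omega)).countBlocks,
        Finset.sum_range_succ, add_assoc]
  have hB : ∀ k, k ≤ b → countBlocks (blockChain n a b) (interval n a (n - 1)) P =
      ∑ l ∈ Finset.range k, (if P (interval n (a + 2 * l) (a + 2 * l + 2)) then 1 else 0) +
        countBlocks (blockChain n a b) (interval n (a + 2 * k) (n - 1)) P := by
    intro k
    induction k with
    | zero => simp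
    | succ k ih =>
      intro hk
      rw [ih (by omega), (isSplit_triangle hk hn).countBlocks,
        (biconnected_triangle hk (by omega)).countBlocks, Finset.sum_range_succ, ← add_assoc]
  rw [hA a le_rfl, hB b le_rfl, (biconnected_cycle hn).countBlocks, add_assoc]

theorem isBlockSet_blockChain (hn : a + 2 * b + 2 ≤ n) {T : Set (Fin n)}
    (hT : IsBlockSet (blockChain n a b) Set.univ T) :
    (∃ p < a, T = interval n p (p + 1)) ∨
      (∃ l < b, T = interval n (a + 2 * l) (a + 2 * l + 2)) ∨
      T = interval n (a + 2 * b) (n - 1) := by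
  classical
  by_contra hno
  push Not at hno
  obtain ⟨h1, h2, h3⟩ := hno
  -- The blocks that are not of these forms number zero.
  have h := countBlocks_blockChain hn (P := fun T => (∀ p < a, T ≠ interval n p (p + 1)) ∧
    (∀ l < b, T ≠ interval n (a + 2 * l) (a + 2 * l + 2)) ∧ T ≠ interval n (a + 2 * b) (n - 1))
  rw [Finset.sum_eq_zero fun p hp => if_neg fun h => h.1 p (Finset.mem_range.1 hp) rfl,
    Finset.sum_eq_zero fun l hl => if_neg fun h => h.2.1 l (Finset.mem_range.1 hl) rfl,
    if_neg fun h => h.2.2 rfl, countBlocks, add_zero, add_zero, Set.ncard_eq_zero] at h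
  exact h.subset ⟨hT, h1, h2, h3⟩

theorem numBlocks_blockChain (hn : a + 2 * b + 2 ≤ n) :
    numBlocks (blockChain n a b) = a + b + 1 := by
  rw [numBlocks_eq, countBlocks_blockChain hn]
  simp

theorem numEvenBlocks_blockChain (hn : a + 2 * b + m = n) (hm : 2 ≤ m) :
    numEvenBlocks (blockChain n a b) = a + if Even m then 1 else 0 := by
  rw [numEvenBlocks_eq, countBlocks_blockChain (by omega)]
  have h1 : ∀ p ∈ Finset.range a, (if Even (interval n p (p + 1)).ncard then 1 else 0) = 1 := by
    intro p hp
    have hp := Finset.mem_range.1 hp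
    rw [ncard_interval (by omega) (by omega), if_pos ⟨1, by omega⟩]
  have h2 : ∀ l ∈ Finset.range b,
      (if Even (interval n (a + 2 * l) (a + 2 * l + 2)).ncard then 1 else 0) = 0 := by
    intro l hl
    have hl := Finset.mem_range.1 hl
    rw [ncard_interval (by omega) (by omega), if_neg]
    rintro ⟨k, hk⟩
    omega
  rw [Finset.sum_congr rfl h1, Finset.sum_congr rfl h2, ncard_interval (by omega) (by omega),
    show n - 1 + 1 - (a + 2 * b) = m by omega]
  simp

theorem iso_edge {p : ℕ} (hp : p < a) (hn : a + 2 * b + 2 ≤ n) :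
    Nonempty (((⊤ : (blockChain n a b).Subgraph).induce (interval n p (p + 1))).coe ≃g
      SimpleGraph.completeGraph (Fin 2)) := by
  have h := nonempty_iso_cycleGraph (H := blockChain n a b) (l := p) (h := p + 1) le_rfl rfl
    (by omega) fun i j hi hij hj => by
      rw [blockChain_adj_of_lt hij]
      constructor
      · rintro (h | ⟨l, -, h1, h2⟩ | ⟨h1, h2⟩) <;> omega
      · intro h
        exact Or.inl (by omega)
  rwa [SimpleGraph.cycleGraph_two_eq_top] at h

theorem iso_triangle {l : ℕ} (hl : l < b) (hn : a + 2 * b + 2 ≤ n) :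
    Nonempty (((⊤ : (blockChain n a b).Subgraph).induce
      (interval n (a + 2 * l) (a + 2 * l + 2))).coe ≃g SimpleGraph.cycleGraph 3) :=
  nonempty_iso_cycleGraph (by omega) rfl (by omega) fun i j hi hij hj => by
    rw [blockChain_adj_of_lt hij]
    constructor
    · rintro (h | ⟨l, -, h1, h2⟩ | ⟨h1, h2⟩) <;> omega
    · rintro (h | h)
      exacts [Or.inl h, Or.inr (Or.inl ⟨l, hl, h⟩)]

theorem iso_cycle (hn : a + 2 * b + m = n) (hm : 2 ≤ m) :
    Nonempty (((⊤ : (blockChain n a b).Subgraph).induce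
      (interval n (a + 2 * b) (n - 1))).coe ≃g SimpleGraph.cycleGraph m) :=
  nonempty_iso_cycleGraph hm (by omega) (by omega) fun i j hi hij hj => by
    rw [blockChain_adj_of_lt hij]
    constructor
    · rintro (h | ⟨l, hl, h1, h2⟩ | ⟨h1, h2⟩) <;> omega
    · rintro (h | h)
      exacts [Or.inl h, Or.inr (Or.inr ⟨h.1, by omega⟩)]

theorem ncard_verts_of_iso {V : Type*} {G : SimpleGraph V} {B : G.Subgraph} {k : ℕ}
    {K : SimpleGraph (Fin k)} (h : Nonempty (B.coe ≃g K)) : B.verts.ncard = k := by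
  obtain ⟨e⟩ := h
  rw [← Nat.card_coe_set_eq, Nat.card_congr e.toEquiv, Nat.card_fin]

theorem hasCycleBlockDecomposition_blockChain (hn : a + 2 * b + m = n) (hm : 2 ≤ m) :
    HasCycleBlockDecomposition (blockChain n a b) m a b := by
  classical
  have hn' : a + 2 * b + 2 ≤ n := by omega
  set C := (⊤ : (blockChain n a b).Subgraph).induce (interval n (a + 2 * b) (n - 1)) with hC
  have hCb : IsBlock C := by
    have h := countBlocks_blockChain hn' (P := fun T => T = interval n (a + 2 * b) (n - 1))
    rw [if_pos rfl] at h
    obtain ⟨T, hT, rfl⟩ := Set.nonempty_of_ncard_ne_zero (h.trans_ne (Nat.succ_ne_zero _))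
    exact isBlock_induce hT
  -- A block other than the last one is an edge or a triangle according to its order.
  have key : ∀ B : (blockChain n a b).Subgraph, IsBlock B → B ≠ C →
      (B.verts.ncard = 2 ∧ Nonempty (B.coe ≃g SimpleGraph.completeGraph (Fin 2))) ∨
        (B.verts.ncard = 3 ∧ Nonempty (B.coe ≃g SimpleGraph.cycleGraph 3)) := by
    intro B hB hBC
    obtain ⟨h1, h2⟩ := isBlock_iff.1 hB
    rcases isBlockSet_blockChain hn' h1 with ⟨p, hp, h⟩ | ⟨l, hl, h⟩ | h <;> rw [h] at h2
    · have := h2 ▸ iso_edge hp hn'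
      exact Or.inl ⟨ncard_verts_of_iso this, this⟩
    · have := h2 ▸ iso_triangle hl hn'
      exact Or.inr ⟨ncard_verts_of_iso this, this⟩
    · exact absurd h2 hBC
  have ne_iff : ∀ B : (blockChain n a b).Subgraph, IsBlock B →
      (B ≠ C ↔ B.verts ≠ interval n (a + 2 * b) (n - 1)) := by
    intro B hB
    rw [not_iff_not]
    constructor
    · rintro rfl
      rfl
    · intro h
      rw [(isBlock_iff.1 hB).2, h]
  have hne : ∀ p h, p < a + 2 * b → p ≤ h → h < n →
      interval n p h ≠ interval n (a + 2 * b) (n - 1) := by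
    intro p h hp hph hh e
    have : (⟨p, by omega⟩ : Fin n) ∈ interval n (a + 2 * b) (n - 1) := e ▸ ⟨le_rfl, hph⟩
    have := this.1
    simp only at this
    omega
  refine ⟨C, hCb, iso_cycle hn hm, ?_, ?_, fun B hB hBC => (key B hB hBC).imp And.right And.right⟩
  · have : {B : (blockChain n a b).Subgraph | IsBlock B ∧ B ≠ C ∧
        Nonempty (B.coe ≃g SimpleGraph.completeGraph (Fin 2))} =
        {B | IsBlock B ∧ (B.verts ≠ interval n (a + 2 * b) (n - 1) ∧ B.verts.ncard = 2)} := by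
      ext B
      constructor
      · rintro ⟨h1, h2, h3⟩
        exact ⟨h1, (ne_iff B h1).1 h2, ncard_verts_of_iso h3⟩
      · rintro ⟨h1, h2, h3⟩
        have h2 := (ne_iff B h1).2 h2
        refine ⟨h1, h2, (key B h1 h2).elim And.right fun h => ?_⟩
        omega
    rw [this, ncard_isBlock (fun T => T ≠ interval n (a + 2 * b) (n - 1) ∧ T.ncard = 2),
      countBlocks_blockChain hn',
      Finset.sum_congr rfl fun p hp => if_pos ⟨hne p (p + 1) (by
        have := Finset.mem_range.1 hp; omega) (by omega) (by
        have := Finset.mem_range.1 hp; omega), by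
        have := Finset.mem_range.1 hp
        rw [ncard_interval (by omega) (by omega)]; omega⟩,
      Finset.sum_congr rfl fun l hl => if_neg fun h => by
        have := Finset.mem_range.1 hl
        have := h.2
        rw [ncard_interval (by omega) (by omega)] at this
        omega, if_neg fun h => h.1 rfl]
    simp
  · have : {B : (blockChain n a b).Subgraph | IsBlock B ∧ B ≠ C ∧
        Nonempty (B.coe ≃g SimpleGraph.cycleGraph 3)} =
        {B | IsBlock B ∧ (B.verts ≠ interval n (a + 2 * b) (n - 1) ∧ B.verts.ncard = 3)} := by
      ext B
      constructor
      · rintro ⟨h1, h2, h3⟩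
        exact ⟨h1, (ne_iff B h1).1 h2, ncard_verts_of_iso h3⟩
      · rintro ⟨h1, h2, h3⟩
        have h2 := (ne_iff B h1).2 h2
        refine ⟨h1, h2, (key B h1 h2).elim (fun h => ?_) And.right⟩
        omega
    rw [this, ncard_isBlock (fun T => T ≠ interval n (a + 2 * b) (n - 1) ∧ T.ncard = 3),
      countBlocks_blockChain hn',
      Finset.sum_congr rfl fun p hp => if_neg fun h => by
        have := Finset.mem_range.1 hp
        have := h.2
        rw [ncard_interval (by omega) (by omega)] at this
        omega,
      Finset.sum_congr rfl fun l hl => if_pos ⟨hne (a + 2 * l) (a + 2 * l + 2) (by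
        have := Finset.mem_range.1 hl; omega) (by omega) (by
        have := Finset.mem_range.1 hl; omega), by
        have := Finset.mem_range.1 hl
        rw [ncard_interval (by omega) (by omega)]; omega⟩,
      if_neg fun h => h.1 rfl]
    simp

/-- A lower bound for the distance from vertex `0` is a potential that grows by one along each edge
block and each triangle, and on the cycle is the distance to its first vertex, up to `m / 2`. -/
theorem le_diam_blockChain (hn : a + 2 * b + m = n) (hm : 2 ≤ m) :
    a + b + m / 2 ≤ (blockChain n a b).diam := by
  have : NeZero n := ⟨by omega⟩
  have hG : (blockChain n a b).Connected := connected_blockChain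
  let φ : Fin n → ℕ := fun x => if (x : ℕ) ≤ a then x else if (x : ℕ) ≤ a + 2 * b then
    a + ((x : ℕ) - a) / 2 else a + b + min ((x : ℕ) - (a + 2 * b)) (n - x)
  have hφ : ∀ u w, (blockChain n a b).Adj u w → φ w ≤ φ u + 1 ∧ φ u ≤ φ w + 1 := by
    have aux : ∀ u w : Fin n, (u : ℕ) < w → (blockChain n a b).Adj u w →
        φ w ≤ φ u + 1 ∧ φ u ≤ φ w + 1 := by
      intro u w huw h
      have := w.isLt
      simp only [φ]
      rcases (blockChain_adj_of_lt huw).1 h with h | ⟨l, hl, h1, h2⟩ | ⟨h1, h2⟩ <;>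
        split_ifs <;> omega
    intro u w h
    rcases lt_trichotomy (u : ℕ) w with h' | h' | h'
    · exact aux u w h' h
    · exact absurd (Fin.ext h') h.ne
    · exact (aux w u h' h.symm).symm
  have h1 := le_dist_of_potential hG φ (fun u w h => (hφ u w h).1) 0
    ⟨a + 2 * b + m / 2, by omega⟩
  have h2 : (blockChain n a b).dist 0 ⟨a + 2 * b + m / 2, by omega⟩ ≤ (blockChain n a b).diam :=
    SimpleGraph.dist_le_diam (SimpleGraph.connected_iff_ediam_ne_top.1 hG)
  have h3 : φ 0 = 0 := by simp [φ]
  have h4 : φ ⟨a + 2 * b + m / 2, by omega⟩ = a + b + m / 2 := by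
    simp only [φ]
    split_ifs <;> omega
  omega

end BlockChain

end RainbowBlocks

theorem theorem1 :
    (∀ (V : Type*) [Fintype V] (G : SimpleGraph V) (n q r : ℕ),
      G.Connected → Fintype.card V = n → 3 ≤ n →
      numBlocks G = q → 2 ≤ q → numEvenBlocks G = r →
        (rc G : ℚ) ≤ ((n : ℚ) + r - 1) / 2) ∧
    (∀ n q r : ℕ, 3 ≤ n → 2 ≤ q →
      (∃ G : SimpleGraph (Fin n), G.Connected ∧ numBlocks G = q ∧ numEvenBlocks G = r) →
      ∃ H : SimpleGraph (Fin n), H.Connected ∧ numBlocks H = q ∧ numEvenBlocks H = r ∧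
        (H.diam : ℚ) = ((n : ℚ) + r - 1) / 2 ∧
        (rc H : ℚ) = ((n : ℚ) + r - 1) / 2 ∧
        (r < q → ∃ m : ℕ, Odd m ∧ 3 ≤ m ∧ m + 2 * q = n + r + 2 ∧
          HasCycleBlockDecomposition H m r (q - r - 1))) := by
  refine ⟨fun V _ G n q r hG hn hn3 hq hq2 hr => ?_, fun n q r hn hq2 ⟨G, hG, hq, hr⟩ => ?_⟩
  · subst hn hq hr
    have : Nontrivial V := Fintype.one_lt_card_iff_nontrivial.1 (by omega)
    have h := two_mul_rc_lt hG hq2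
    rw [Nat.card_eq_fintype_card] at h
    have h' : ((2 * rc G + 1 : ℕ) : ℚ) ≤ ((Fintype.card V + numEvenBlocks G : ℕ) : ℚ) :=
      Nat.cast_le.2 h
    push_cast at h'
    linarith
  · have : NeZero n := ⟨by omega⟩
    have : Nontrivial (Fin n) := Fin.nontrivial_iff_two_le.2 (by omega)
    obtain ⟨h1, h2, h3⟩ := card_numBlocks hG
    rw [Nat.card_fin, hq, hr] at *
    -- The last cycle is odd, unless all blocks are even.
    obtain ⟨a, b, m, hm, ham, hab, hr', hD, hlt⟩ : ∃ a b m : ℕ, 2 ≤ m ∧ a + 2 * b + m = n ∧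
        a + b + 1 = q ∧ (a + if Even m then 1 else 0) = r ∧ 2 * (a + b + m / 2) + 1 = n + r ∧
        (r < q → Odd m ∧ 3 ≤ m ∧ a = r ∧ b = q - r - 1) := by
      obtain ⟨k, hk⟩ := h2
      rcases h3.lt_or_eq with h | h
      · have ho : Odd (n + r + 2 - 2 * q) := ⟨k + 1 - q, by omega⟩
        refine ⟨r, q - r - 1, n + r + 2 - 2 * q, by omega, by omega, by omega, ?_, by omega,
          fun _ => ⟨ho, by omega, rfl, rfl⟩⟩
        rw [if_neg (Nat.not_even_iff_odd.2 ho), add_zero]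
      · have he : Even (n - r + 1) := ⟨k + 1 - r, by omega⟩
        refine ⟨r - 1, 0, n - r + 1, by omega, by omega, by omega, ?_, by omega, fun _ => by omega⟩
        rw [if_pos he]
        omega
    have hH : (blockChain n a b).Connected := connected_blockChain
    have hnb : numBlocks (blockChain n a b) = q :=
      (numBlocks_blockChain (by omega)).trans hab
    have hne : numEvenBlocks (blockChain n a b) = r :=
      (numEvenBlocks_blockChain ham hm).trans hr'
    have hup := two_mul_rc_lt hH (hnb.symm ▸ hq2)
    rw [Nat.card_fin, hne] at hup
    have hlow := le_diam_blockChain ham hm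
    have hdr := diam_le_rc hH
    have hcast : ((2 * (a + b + m / 2) + 1 : ℕ) : ℚ) = ((n + r : ℕ) : ℚ) := by rw [hD]
    have hrc : rc (blockChain n a b) = a + b + m / 2 := by omega
    have hdiam : (blockChain n a b).diam = a + b + m / 2 := by omega
    push_cast at hcast
    refine ⟨blockChain n a b, hH, hnb, hne, ?_, ?_, fun h => ?_⟩
    · rw [hdiam]
      push_cast
      linarith
    · rw [hrc]
      push_cast
      linarith
    · obtain ⟨ho, hm3, rfl, rfl⟩ := hlt h
      exact ⟨m, ho, hm3, by omega, hasCycleBlockDecomposition_blockChain ham hm⟩
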